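/- Let $\mu,T,L>0$ and $Q_T=(0,T)\times(0,L)$. Consider the isothermal Matovich--Pearson system without surface tension $$\partial_t A+\partial_x(vA)=0,\qquad \partial_x(3\mu A\,\partial_x v)=0\qquad\text{in }Q_T,$$ with the initial and boundary conditions $$A(t,0)=S_0(t),\quad v(t,0)=v_{in}(t),\quad v(t,L)=v_L(t)\quad (t\in(0,T)),\qquad A(0,x)=S_1(x)\quad (x\in(0,L)).$$ Suppose that $S_0\in W^{2,\infty}(0,T)$, $S_1\in H^2(0,L)$, $v_{in},v_L\in W^{1,\infty}(0,T)$ (all identified with their representatives that are continuous on the closed interval), and that there are constants $v_m,V_M,S_m,S_M$ with $$0<v_m\le v_{in}(t)<v_L(t)\le V_M,\qquad 0<S_m\le S_0(t),\,S_1(x)\le S_M\qquad\text{for all }(t,x)\in Q_T,\qquad S_0(0)=S_1(0).$$ Call a pair $(A,v)$ of functions a strong solution if $A,\partial_tA,\partial_xA\in L^\infty(Q_T)$ and $v,\partial_tv,\partial_xv,\partial^2_{tx}v,\partial^2_{xx}v\in L^\infty(Q_T)$ (weak derivatives; $A$ and $v$ are identified with their representatives that are continuous on $\overline{Q_T}$),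 if $A>0$ on $Q_T$, if both equations hold almost everywhere in $Q_T$, and if the initial and boundary conditions hold pointwise. Then there is a strong solution $(A,v)$; it satisfies $A\ge A_m$ on $\overline{Q_T}$ for some constant $A_m>0$; and it is unique: every strong solution coincides with $(A,v)$ on $\overline{Q_T}$. -/

import Mathlib

open MeasureTheory Set
open scoped ContDiff ENNReal

namespace MatovichPearson

/-- `g` is the weak derivative of `u` in the direction `e` on the open set `Ω`:
both are locally integrable on `Ω`, and `∫_Ω u ∂ₑφ = - ∫_Ω g φ` for every smooth `φ` with
compact support contained in `Ω`. -/
def HasWeakDeriv {E : Type*} [NormedAddCommGroup E] [NormedSpace ℝ E] [MeasureSpace E]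
    (Ω : Set E) (e : E) (u g : E → ℝ) : Prop :=
  LocallyIntegrableOn u Ω ∧ LocallyIntegrableOn g Ω ∧
    ∀ φ : E → ℝ, ContDiff ℝ ∞ φ → HasCompactSupport φ → tsupport φ ⊆ Ω →
      ∫ z in Ω, u z * fderiv ℝ φ z e = - ∫ z in Ω, g z * φ z

/-- `u` belongs to `L^p(Ω)`. -/
def MemL {E : Type*} [MeasureSpace E] (Ω : Set E) (p : ℝ≥0∞) (u : E → ℝ) : Prop :=
  MemLp u p (volume.restrict Ω)

/-- `u` belongs to the Sobolev space `W^{k,p}(I)` on the open interval `I ⊆ ℝ`: `u` and its weak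
derivatives up to the order `k` belong to `L^p(I)`. -/
def MemSobolev (I : Set ℝ) (p : ℝ≥0∞) : ℕ → (ℝ → ℝ) → Prop
  | 0, u => MemL I p u
  | k + 1, u => MemL I p u ∧ ∃ g : ℝ → ℝ, HasWeakDeriv I 1 u g ∧ MemSobolev I p k g

/-- The open space-time rectangle `(0,T) × (0,L)`; points are pairs `(t, x)`. -/
def Q (T L : ℝ) : Set (ℝ × ℝ) := Ioo 0 T ×ˢ Ioo 0 L

/-- The closed space-time rectangle `[0,T] × [0,L]`. -/
def Qbar (T L : ℝ) : Set (ℝ × ℝ) := Icc 0 T ×ˢ Icc 0 L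

/-- The direction of time. -/
def dt : ℝ × ℝ := (1, 0)

/-- The direction of space. -/
def dx : ℝ × ℝ := (0, 1)

/-- `(A, v)` is a strong solution on `(0,T) × (0,L)` of the isothermal Matovich–Pearson system
`∂ₜA + ∂ₓ(vA) = 0`, `∂ₓ(3μ A ∂ₓv) = 0` with the data `A(t,0) = S₀(t)`, `A(0,x) = S₁(x)`,
`v(t,0) = v_in(t)`, `v(t,L) = v_L(t)`. All derivatives are weak derivatives. The functions `A` and
`v` are the representatives that are continuous on the closed rectangle, so that their pointwise
values are meaningful. -/
structure IsStrongSolution (μ T L : ℝ) (S₀ S₁ vin vL : ℝ → ℝ) (A v : ℝ × ℝ → ℝ) : Prop where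
  continuousOn_A : ContinuousOn A (Qbar T L)
  continuousOn_v : ContinuousOn v (Qbar T L)
  /-- `A ∈ W^{1,∞}`. -/
  regularity_A : MemL (Q T L) ∞ A ∧
    ∃ At Ax : ℝ × ℝ → ℝ,
      HasWeakDeriv (Q T L) dt A At ∧ MemL (Q T L) ∞ At ∧
      HasWeakDeriv (Q T L) dx A Ax ∧ MemL (Q T L) ∞ Ax
  /-- `v, ∂ₜv, ∂ₓv, ∂²ₜₓv, ∂²ₓₓv ∈ L^∞`. -/
  regularity_v : MemL (Q T L) ∞ v ∧
    ∃ vt vx vtx vxx : ℝ × ℝ → ℝ,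
      HasWeakDeriv (Q T L) dt v vt ∧ MemL (Q T L) ∞ vt ∧
      HasWeakDeriv (Q T L) dx v vx ∧ MemL (Q T L) ∞ vx ∧
      HasWeakDeriv (Q T L) dt vx vtx ∧ MemL (Q T L) ∞ vtx ∧
      HasWeakDeriv (Q T L) dx vx vxx ∧ MemL (Q T L) ∞ vxx
  /-- `∂ₜA + ∂ₓ(vA) = 0` almost everywhere. -/
  mass : ∃ At F : ℝ × ℝ → ℝ,
    HasWeakDeriv (Q T L) dt A At ∧
    HasWeakDeriv (Q T L) dx (fun z => v z * A z) F ∧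
    ∀ᵐ z ∂(volume.restrict (Q T L)), At z + F z = 0
  /-- `∂ₓ(3μ A ∂ₓv) = 0` almost everywhere. -/
  momentum : ∃ vx G : ℝ × ℝ → ℝ,
    HasWeakDeriv (Q T L) dx v vx ∧
    HasWeakDeriv (Q T L) dx (fun z => 3 * μ * A z * vx z) G ∧
    ∀ᵐ z ∂(volume.restrict (Q T L)), G z = 0
  pos : ∀ z ∈ Q T L, 0 < A z
  inflow : ∀ t ∈ Ioo 0 T, A (t, 0) = S₀ t
  initial : ∀ x ∈ Ioo 0 L, A (0, x) = S₁ x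
  velocity_left : ∀ t ∈ Ioo 0 T, v (t, 0) = vin t
  velocity_right : ∀ t ∈ Ioo 0 T, v (t, L) = vL t

end MatovichPearson

/-!
The proof rests on two structural facts. The momentum equation says that the tension `A ∂ₓv = c(t)`
does not depend on `x`, so that `v` is the explicit functional `v = v_in + c ∫₀ˣ 1/A` of `A`, with
`c ∫₀ᴸ 1/A = v_L - v_in`. The mass equation then reads `∂ₜA + v ∂ₓA = -c`: along every material
point the cross-section decreases at the rate `c(t)`, independently of the point.

Existence. Label the material points by mass: let `M(t) = ∫₀ᵗ S₀ v_in` be the mass that has entered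
until the time `t`, give the label `y > 0` to the point that enters when `M = y`, and the label
`y < 0` to the point that initially has the mass `-y` between itself and the inlet. With `θ = M(t)`
as the time variable, `g(y)` the initial or inflow cross-section of the label `y`, and `C` the
primitive of `c dt/dθ`, the cross-section is `g(y) + C(y) - C(θ)`. The whole system reduces to one
scalar fixed point equation for `c` as a function of `θ` (`exists_reduced_solution`). After a
cut-off of the cross-section it is a Volterra equation with a Lipschitz right-hand side
(`exists_fixedPoint_of_volterra`, `exists_truncated_solution`). The cut-off is removed by a lower
bound: in the mass coordinate the cross-section is Lipschitz with a constant independent of the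
cut-off, whereas the filament has the fixed length `L = ∫ 1/A`, and a Lipschitz function that comes
close to zero would make this integral logarithmically large (`exp_neg_mul_le_of_integral_inv_le`).
The implicit function theorem for the position of a label gives the label map `Y(t,x)` with
`∂ₓY = -A`, `∂ₜY = A v` (`exists_mass_coordinate`), and the mass equation becomes the equality of
the mixed derivatives of `Y` (`HasWeakDeriv.symm`, `exists_strongSolution`). For the regularity it
is enough that `A`, `v` and `∂ₓv = c/A` are Lipschitz.

Uniqueness. A strong solution satisfies the two structural facts almost everywhere
(`IsStrongSolution.exists_isFluxSolution`), because bounded weak derivatives amount to Lipschitz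
continuity (`exists_lipschitzWith_ae_eq`). Positivity up to the outlet, which is not part of the
definition, holds because the constant tension cannot vanish while `v_in < v_L`. The difference
`d = A' - A` of two solutions satisfies `∂ₜd + v' ∂ₓd = (v - v') ∂ₓA + c - c'`, where `c - c'` and
`v - v'` are controlled by the `L¹` norm of `d` (`tension_velocity_stability`); since `d` vanishes
initially and at the inlet and the outflow has a sign, Grönwall's inequality for `∫ d²` gives
`d = 0` (`IsFluxSolution.eq_of_eq_data`).
-/

namespace MatovichPearson

open Filter Topology Metric
open scoped NNReal Convolution

/-! ### Weak derivatives -/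

section WeakDeriv

theorem setIntegral_mul_eq_integral {E : Type*} [TopologicalSpace E] [MeasureSpace E]
    {Ω : Set E} {φ : E → ℝ}
    (hφ : tsupport φ ⊆ Ω) (u : E → ℝ) :
    ∫ z in Ω, u z * φ z = ∫ z, u z * φ z := by
  apply setIntegral_eq_integral_of_forall_compl_eq_zero
  intro x hx
  rw [image_eq_zero_of_notMem_tsupport (fun h => hx (hφ h)), mul_zero]

variable {E : Type*} [NormedAddCommGroup E] [NormedSpace ℝ E] [MeasureSpace E]

theorem HasWeakDeriv.congr {Ω : Set E} {e : E}
    {u u' g g' : E → ℝ}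
    (h : HasWeakDeriv Ω e u g) (hu : u =ᵐ[volume.restrict Ω] u')
    (hg : g =ᵐ[volume.restrict Ω] g') : HasWeakDeriv Ω e u' g' := by
  have key : ∀ {f f' : E → ℝ}, f =ᵐ[volume.restrict Ω] f' →
      LocallyIntegrableOn f Ω → LocallyIntegrableOn f' Ω := by
    intro f f' hff hf x hx
    obtain ⟨s, hs, hfs⟩ := hf x hx
    refine ⟨s ∩ Ω, inter_mem hs self_mem_nhdsWithin, ?_⟩
    exact (hfs.mono_set inter_subset_left).congr_fun_ae
      (ae_restrict_of_ae_restrict_of_subset inter_subset_right hff)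
  refine ⟨key hu h.1, key hg h.2.1, fun φ hφ hc hs => ?_⟩
  have h1 : ∫ z in Ω, u' z * fderiv ℝ φ z e = ∫ z in Ω, u z * fderiv ℝ φ z e :=
    integral_congr_ae (hu.mono fun z hz => by simp only [hz])
  have h2 : ∫ z in Ω, g' z * φ z = ∫ z in Ω, g z * φ z :=
    integral_congr_ae (hg.mono fun z hz => by simp only [hz])
  rw [h1, h2, h.2.2 φ hφ hc hs]

variable [BorelSpace E] [FiniteDimensional ℝ E]

/-- Weak derivatives are unique. -/
theorem HasWeakDeriv.ae_eq {Ω : Set E} (hΩ : IsOpen Ω) {e : E} {u g g' : E → ℝ}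
    (h : HasWeakDeriv Ω e u g) (h' : HasWeakDeriv Ω e u g') : g =ᵐ[volume.restrict Ω] g' := by
  have h0 := hΩ.ae_eq_zero_of_integral_contDiff_smul_eq_zero (μ := volume)
    (f := fun z => g z - g' z)
    (h.2.1.sub h'.2.1) (fun φ hφ hc hs => by
      have hi : ∀ f : E → ℝ, LocallyIntegrableOn f Ω → IntegrableOn (fun z => f z * φ z) Ω := by
        intro f hf
        have h1 : IntegrableOn (fun z => f z * φ z) (tsupport φ) :=
          (hf.integrableOn_compact_subset hs hc).mul_continuousOn hφ.continuous.continuousOn hc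
        refine (IntegrableOn.integrable_of_forall_notMem_eq_zero h1 fun x hx => ?_).integrableOn
        rw [image_eq_zero_of_notMem_tsupport hx, mul_zero]
      have h1 := h.2.2 φ hφ hc hs
      have h2 := h'.2.2 φ hφ hc hs
      have h3 : ∫ z in Ω, (g z - g' z) * φ z = 0 := by
        simp_rw [sub_mul]
        rw [integral_sub (hi g h.2.1) (hi g' h'.2.1)]
        linarith
      rw [setIntegral_mul_eq_integral hs] at h3
      simpa [mul_comm] using h3)
  rw [Filter.EventuallyEq, ae_restrict_iff' hΩ.measurableSet]
  filter_upwards [h0] with z hz hzΩ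
  linarith [hz hzΩ]

variable [(volume : Measure E).IsAddHaarMeasure]

/-- Integration by parts for Lipschitz functions, which are differentiable almost everywhere. -/
theorem hasWeakDeriv_lineDeriv {C : ℝ≥0} {u : E → ℝ} (hu : LipschitzWith C u) (Ω : Set E) (e : E) :
    HasWeakDeriv Ω e u (fun z => lineDeriv ℝ u z e) := by
  refine ⟨hu.continuous.locallyIntegrable.locallyIntegrableOn _,
    (hu.locallyIntegrable_lineDeriv (μ := volume) e).locallyIntegrableOn _, fun φ hφ hc hs => ?_⟩
  obtain ⟨D, hD⟩ := ContDiff.lipschitzWith_of_hasCompactSupport hc hφ (by simp)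
  have h := hu.integral_lineDeriv_mul_eq (μ := volume) hD hc e
  rw [setIntegral_mul_eq_integral hs,
    setIntegral_mul_eq_integral ((tsupport_fderiv_apply_subset ℝ e).trans hs), h,
    ← integral_neg]
  congr 1
  ext z
  rw [(hφ.differentiable (by simp)).differentiableAt.lineDeriv_eq_fderiv]
  simp [mul_comm]

theorem hasWeakDeriv_of_lipschitzOnWith {C : ℝ≥0} {Ω : Set E} (hΩ : IsOpen Ω) {e : E}
    {u g : E → ℝ} (hu : LipschitzOnWith C u Ω) (hg : ∀ z ∈ Ω, HasLineDerivAt ℝ u (g z) z e) :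
    HasWeakDeriv Ω e u g := by
  obtain ⟨U, hU, hUu⟩ := hu.extend_real
  refine (hasWeakDeriv_lineDeriv hU Ω e).congr ?_ ?_
  · exact (ae_restrict_mem hΩ.measurableSet).mono fun z hz => (hUu hz).symm
  · refine (ae_restrict_mem hΩ.measurableSet).mono fun z hz => ?_
    refine HasLineDerivAt.lineDeriv ((hg z hz).congr_of_eventuallyEq ?_)
    filter_upwards [hΩ.mem_nhds hz] with w hw using (hUu hw).symm

/-- A Lipschitz function has bounded weak derivatives. -/
theorem exists_hasWeakDeriv_of_lipschitzOnWith {C : ℝ≥0} {Ω : Set E} (hΩ : IsOpen Ω) (e : E)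
    {u : E → ℝ} (hu : LipschitzOnWith C u Ω) :
    ∃ g, HasWeakDeriv Ω e u g ∧ MemL Ω ∞ g := by
  obtain ⟨U, hU, hUu⟩ := hu.extend_real
  refine ⟨_, (hasWeakDeriv_lineDeriv hU Ω e).congr ?_ (ae_eq_refl _), hU.memLp_lineDeriv e⟩
  exact (ae_restrict_mem hΩ.measurableSet).mono fun z hz => (hUu hz).symm

/-- Mollification: an integrable function is an almost everywhere limit of differentiable functions
which inherit, away from the boundary of `Ω`, every bound on a weak derivative. -/
theorem exists_smooth_approximation {Ω : Set E} (hΩ : IsOpen Ω) {u : E → ℝ}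
    (hu : IntegrableOn u Ω) :
    ∃ f : ℕ → E → ℝ, (∀ n, Differentiable ℝ (f n)) ∧
      (∀ᵐ z ∂(volume.restrict Ω), Tendsto (fun n => f n z) atTop (𝓝 (u z))) ∧
      ∀ (e : E) (g : E → ℝ) (K : ℝ), HasWeakDeriv Ω e u g →
        (∀ᵐ z ∂(volume.restrict Ω), |g z| ≤ K) →
        ∀ (n : ℕ) (z : E), closedBall z (1 / ((n : ℝ) + 1)) ⊆ Ω → |fderiv ℝ (f n) z e| ≤ K := by
  have hpos : ∀ n : ℕ, (0 : ℝ) < 1 / ((n : ℝ) + 1) := fun n => by positivity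
  let φ : ℕ → ContDiffBump (0 : E) := fun n =>
    ⟨1 / ((n : ℝ) + 1) / 2, 1 / ((n : ℝ) + 1), half_pos (hpos n), half_lt_self (hpos n)⟩
  have hui : Integrable (Ω.indicator u) := (integrable_indicator_iff hΩ.measurableSet).2 hu
  have hcs : ∀ n, HasCompactSupport (fderiv ℝ ((φ n).normed volume)) := fun n =>
    (φ n).hasCompactSupport_normed.fderiv ℝ
  have hcont : ∀ n, Continuous (fderiv ℝ ((φ n).normed volume)) := fun n =>
    ((φ n).contDiff_normed (n := 1)).continuous_fderiv (by simp)
  have hder : ∀ n z, HasFDerivAt (((φ n).normed volume) ⋆[ContinuousLinearMap.lsmul ℝ ℝ, volume]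
      (Ω.indicator u)) ((fderiv ℝ ((φ n).normed volume)
        ⋆[(ContinuousLinearMap.lsmul ℝ ℝ).precompL E, volume] (Ω.indicator u)) z) z := fun n z =>
    (φ n).hasCompactSupport_normed.hasFDerivAt_convolution_left _ (φ n).contDiff_normed
      hui.locallyIntegrable z
  refine ⟨fun n => ((φ n).normed volume) ⋆[ContinuousLinearMap.lsmul ℝ ℝ, volume]
      (Ω.indicator u), fun n z => (hder n z).differentiableAt, ?_, ?_⟩
  · have h := ContDiffBump.ae_convolution_tendsto_right_of_locallyIntegrable (μ := volume)
      (φ := φ) (l := atTop) (K := 2) (g := Ω.indicator u) tendsto_one_div_add_atTop_nhds_zero_nat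
      (Eventually.of_forall fun n => by simp only [φ]; linarith) hui.locallyIntegrable
    filter_upwards [ae_restrict_of_ae h, ae_restrict_mem hΩ.measurableSet] with z hz hzΩ
    simpa only [indicator_of_mem hzΩ] using hz
  · intro e g K hg hK n z hz
    rw [(hder n z).fderiv]
    set ψ : E → ℝ := fun y => (φ n).normed volume (z - y) with hψ
    have hψd : ContDiff ℝ ∞ ψ := (φ n).contDiff_normed.comp (contDiff_const.sub contDiff_id)
    have hψs : tsupport ψ ⊆ closedBall z (1 / ((n : ℝ) + 1)) := by
      refine closure_minimal (fun y hy => ?_) isClosed_closedBall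
      have : z - y ∈ Function.support ((φ n).normed volume) := hy
      rw [(φ n).support_normed_eq, mem_ball_zero_iff] at this
      rw [mem_closedBall, dist_eq_norm, norm_sub_rev]
      exact this.le
    have hψc : HasCompactSupport ψ := (isCompact_closedBall _ _).of_isClosed_subset
      (isClosed_tsupport _) hψs
    have hint : ∫ y, ψ y = 1 := by
      rw [hψ, integral_sub_left_eq_self (fun y => (φ n).normed volume y)]
      exact (φ n).integral_normed
    have hψn : ∀ y, 0 ≤ ψ y := fun y => (φ n).nonneg_normed _
    have hψi : Integrable ψ := hψd.continuous.integrable_of_hasCompactSupport hψc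
    have hfd : ∀ y, fderiv ℝ ψ y e = - fderiv ℝ ((φ n).normed volume) (z - y) e := by
      intro y
      have h1 : HasFDerivAt ψ ((fderiv ℝ ((φ n).normed volume) (z - y)).comp
          (-(ContinuousLinearMap.id ℝ E))) y := by
        refine HasFDerivAt.comp y (g := (φ n).normed volume) (f := fun y => z - y) ?_ ?_
        · exact ((φ n).contDiff_normed.differentiable (n := 1) (by
            simp)).differentiableAt.hasFDerivAt
        · exact (hasFDerivAt_id y).const_sub z
      rw [h1.fderiv]; simp
    have hci : ConvolutionExistsAt (fderiv ℝ ((φ n).normed volume)) (Ω.indicator u) z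
        ((ContinuousLinearMap.lsmul ℝ ℝ).precompL E) volume :=
      (hcs n).convolutionExists_left _ (hcont n) hui.locallyIntegrable z
    have h1 : ((fderiv ℝ ((φ n).normed volume)
        ⋆[(ContinuousLinearMap.lsmul ℝ ℝ).precompL E, volume] (Ω.indicator u)) z) e
        = ∫ y in Ω, g y * ψ y := by
      rw [convolution_def, ContinuousLinearMap.integral_apply hci]
      have h2 := hg.2.2 ψ hψd hψc (hψs.trans hz)
      rw [← neg_eq_iff_eq_neg] at h2
      rw [← h2, ← integral_neg, ← integral_indicator hΩ.measurableSet,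
        ← integral_sub_left_eq_self _ volume z]
      congr 1
      ext y
      by_cases hy : y ∈ Ω
      · simp [hy, hfd, mul_comm]
      · simp [hy]
    rw [h1]
    calc |∫ y in Ω, g y * ψ y| ≤ ∫ y in Ω, K * ψ y := by
          rw [← Real.norm_eq_abs]
          refine norm_integral_le_of_norm_le (hψi.integrableOn.const_mul K) ?_
          filter_upwards [hK] with y hy
          rw [norm_mul, Real.norm_eq_abs, Real.norm_eq_abs, abs_of_nonneg (hψn y)]
          exact mul_le_mul_of_nonneg_right hy (hψn y)
      _ = K := by
          rw [setIntegral_mul_eq_integral (hψs.trans hz) (fun _ => K), integral_const_mul, hint,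
            mul_one]

/-- A function whose weak derivatives in spanning directions are bounded has a Lipschitz
representative. -/
theorem exists_lipschitzWith_ae_eq {Ω : Set E} (hΩ : IsOpen Ω) (hconv : Convex ℝ Ω) {u : E → ℝ}
    (hu : IntegrableOn u Ω) {ι : Type*} (e : ι → E) (g : ι → E → ℝ) {K : ℝ} {C : ℝ≥0}
    (hg : ∀ i, HasWeakDeriv Ω (e i) u (g i)) (hK : ∀ i, ∀ᵐ z ∂(volume.restrict Ω), |g i z| ≤ K)
    (hC : ∀ f' : E →L[ℝ] ℝ, (∀ i, |f' (e i)| ≤ K) → ‖f'‖ ≤ C) :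
    ∃ U : E → ℝ, LipschitzWith C U ∧ u =ᵐ[volume.restrict Ω] U := by
  obtain ⟨f, hfd, hft, hfK⟩ := exists_smooth_approximation hΩ hu
  -- on the convergence set the Lipschitz bound of the approximations passes to the limit
  set S : Set E := {z | z ∈ Ω ∧ Tendsto (fun n => f n z) atTop (𝓝 (u z))} with hS
  have hlip : LipschitzOnWith C u S := by
    refine LipschitzOnWith.of_dist_le_mul fun x hx y hy => ?_
    have hseg : segment ℝ x y ⊆ Ω := hconv.segment_subset hx.1 hy.1
    have hcomp : IsCompact (segment ℝ x y) := by
      rw [segment_eq_image_lineMap]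
      exact isCompact_Icc.image AffineMap.lineMap_continuous
    obtain ⟨δ, hδ, hδΩ⟩ := hcomp.exists_cthickening_subset_open hΩ hseg
    have hev : ∀ᶠ n : ℕ in atTop, dist (f n x) (f n y) ≤ C * dist x y := by
      have := (tendsto_one_div_add_atTop_nhds_zero_nat (𝕜 := ℝ)).eventually (gt_mem_nhds hδ)
      filter_upwards [this] with n hn
      rw [dist_comm (f n x), dist_comm x, dist_eq_norm, dist_eq_norm]
      refine (convex_segment x y).norm_image_sub_le_of_norm_fderiv_le (f := f n)
        (fun w _ => (hfd n) w) (fun w hw => hC _ fun i => hfK (e i) (g i) K (hg i) (hK i) n w ?_)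
        (left_mem_segment _ _ _) (right_mem_segment _ _ _)
      exact ((closedBall_subset_cthickening hw _).trans (cthickening_mono hn.le _)).trans hδΩ
    exact le_of_tendsto (hx.2.dist hy.2) hev
  obtain ⟨U, hU, hUu⟩ := hlip.extend_real
  refine ⟨U, hU, ?_⟩
  filter_upwards [hft, ae_restrict_mem hΩ.measurableSet] with z hz hzΩ using hUu ⟨hzΩ, hz⟩

end WeakDeriv

theorem HasWeakDeriv.sub {E : Type*} [NormedAddCommGroup E] [NormedSpace ℝ E] [MeasureSpace E]
    [BorelSpace E] {Ω : Set E} {e : E} {u u' g g' : E → ℝ} (h : HasWeakDeriv Ω e u g)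
    (h' : HasWeakDeriv Ω e u' g') :
    HasWeakDeriv Ω e (fun z => u z - u' z) (fun z => g z - g' z) := by
  refine ⟨h.1.sub h'.1, h.2.1.sub h'.2.1, fun φ hφ hc hs => ?_⟩
  have hi : ∀ (f φ : E → ℝ), LocallyIntegrableOn f Ω → Continuous φ → HasCompactSupport φ →
      tsupport φ ⊆ Ω → IntegrableOn (fun z => f z * φ z) Ω := by
    intro f φ hf hφ hc hs
    have h1 : IntegrableOn (fun z => f z * φ z) (tsupport φ) :=
      (hf.integrableOn_compact_subset hs hc).mul_continuousOn hφ.continuousOn hc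
    refine (IntegrableOn.integrable_of_forall_notMem_eq_zero h1 fun x hx => ?_).integrableOn
    rw [image_eq_zero_of_notMem_tsupport hx, mul_zero]
  have hφ' : Continuous fun z => fderiv ℝ φ z e :=
    (hφ.continuous_fderiv (by simp)).clm_apply continuous_const
  have hs' := (tsupport_fderiv_apply_subset ℝ (f := φ) e)
  have hc' : HasCompactSupport fun z => fderiv ℝ φ z e :=
    hc.of_isClosed_subset (isClosed_tsupport _) hs'
  simp_rw [sub_mul]
  rw [integral_sub (hi _ _ h.1 hφ' hc' (hs'.trans hs)) (hi _ _ h'.1 hφ' hc' (hs'.trans hs)),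
    integral_sub (hi _ _ h.2.1 hφ.continuous hc hs) (hi _ _ h'.2.1 hφ.continuous hc hs),
    h.2.2 φ hφ hc hs, h'.2.2 φ hφ hc hs]
  ring

/-- The primitive of an integrable function has this function as its weak derivative. -/
theorem hasWeakDeriv_intervalIntegral {a b : ℝ} (hab : a < b) {g : ℝ → ℝ}
    (hg : IntegrableOn g (Ioo a b)) :
    HasWeakDeriv (Ioo a b) 1 (fun x => ∫ s in a..x, g s) g := by
  have hgi : IntervalIntegrable g volume a b :=
    (intervalIntegrable_iff_integrableOn_Ioo_of_le hab.le).2 hg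
  have hac := hgi.absolutelyContinuousOnInterval_intervalIntegral (c := a) (by simp)
  have hcont : ContinuousOn (fun x => ∫ s in a..x, g s) (Icc a b) := by
    have := hac.continuousOn
    rwa [uIcc_of_le hab.le] at this
  refine ⟨(hcont.mono Ioo_subset_Icc_self).locallyIntegrableOn measurableSet_Ioo,
    hg.locallyIntegrableOn, fun φ hφ hc hs => ?_⟩
  have hφ0 : ∀ x, x ∉ Ioo a b → φ x = 0 := fun x hx =>
    image_eq_zero_of_notMem_tsupport fun h => hx (hs h)
  obtain ⟨D, hD⟩ := ContDiff.lipschitzWith_of_hasCompactSupport hc hφ (by simp)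
  have hφac : AbsolutelyContinuousOnInterval φ a b :=
    hD.lipschitzOnWith.absolutelyContinuousOnInterval
  have h := hac.integral_mul_deriv_eq_deriv_mul hφac
  rw [hφ0 a (by simp), hφ0 b (by simp), mul_zero, mul_zero, sub_zero, zero_sub,
    intervalIntegral.integral_of_le hab.le, intervalIntegral.integral_of_le hab.le,
    integral_Ioc_eq_integral_Ioo, integral_Ioc_eq_integral_Ioo] at h
  simp_rw [fderiv_apply_one_eq_deriv]
  rw [h]
  congr 1
  refine integral_congr_ae ?_
  filter_upwards [ae_restrict_of_ae hgi.ae_hasDerivAt_integral, ae_restrict_mem measurableSet_Ioo]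
    with x hx hxm
  rw [(hx (by rw [uIcc_of_le hab.le]; exact Ioo_subset_Icc_self hxm) a (by simp)).deriv]

/-- Equality of mixed weak derivatives: from `g = ∂ₑu`, `g' = ∂ₑ'u` and `h = ∂ₑ'g` it follows that
`h = ∂ₑg'`. -/
theorem HasWeakDeriv.symm {E : Type*} [NormedAddCommGroup E] [NormedSpace ℝ E] [MeasureSpace E]
    {Ω : Set E} {e e' : E} {u g g' h : E → ℝ} (h₁ : HasWeakDeriv Ω e u g)
    (h₂ : HasWeakDeriv Ω e' u g') (h₃ : HasWeakDeriv Ω e' g h) : HasWeakDeriv Ω e g' h := by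
  refine ⟨h₂.2.1, h₃.2.1, fun φ hφ hc hs => ?_⟩
  have hd : ∀ v : E, ContDiff ℝ ∞ (fun z => fderiv ℝ φ z v) ∧
      HasCompactSupport (fun z => fderiv ℝ φ z v) ∧ tsupport (fun z => fderiv ℝ φ z v) ⊆ Ω := by
    intro v
    have hsub := tsupport_fderiv_apply_subset ℝ (f := φ) v
    exact ⟨(hφ.fderiv_right (m := ∞) (by simp)).clm_apply contDiff_const,
      hc.of_isClosed_subset (isClosed_tsupport _) hsub, hsub.trans hs⟩
  have e1 := h₂.2.2 _ (hd e).1 (hd e).2.1 (hd e).2.2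
  have e2 := h₁.2.2 _ (hd e').1 (hd e').2.1 (hd e').2.2
  have e3 := h₃.2.2 φ hφ hc hs
  have hsymm : ∀ z, fderiv ℝ (fun z => fderiv ℝ φ z e) z e'
      = fderiv ℝ (fun z => fderiv ℝ φ z e') z e := by
    intro z
    have hdz : DifferentiableAt ℝ (fderiv ℝ φ) z :=
      ((hφ.fderiv_right (m := 1) (by norm_cast)).differentiable (by simp)) z
    have hs2 : IsSymmSndFDerivAt ℝ φ z :=
      (contDiff_infty.1 hφ 2).contDiffAt.isSymmSndFDerivAt (by simp)
    rw [fderiv_clm_apply hdz (differentiableAt_const e),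
      fderiv_clm_apply hdz (differentiableAt_const e')]
    simpa using hs2 e' e
  simp_rw [hsymm] at e1
  linarith

/-! ### Functions that are Lipschitz on a set -/

theorem abs_inv_sub_inv_le {a b δ : ℝ} (hδ : 0 < δ) (ha : δ ≤ a) (hb : δ ≤ b) :
    |a⁻¹ - b⁻¹| ≤ |a - b| / δ ^ 2 := by
  have ha' := hδ.trans_le ha
  have hb' := hδ.trans_le hb
  rw [inv_sub_inv ha'.ne' hb'.ne', abs_div, abs_sub_comm, abs_of_pos (mul_pos ha' hb'), sq]
  gcongr

/-- `f` is Lipschitz on `s`, with an unspecified constant. -/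
def IsLipOn {E : Type*} [PseudoMetricSpace E] (f : E → ℝ) (s : Set E) : Prop :=
  ∃ K : ℝ≥0, LipschitzOnWith K f s

namespace IsLipOn

variable {E : Type*} [PseudoMetricSpace E] {f g : E → ℝ} {s t : Set E}

theorem of_bound {K : ℝ} (h : ∀ x ∈ s, ∀ y ∈ s, |f x - f y| ≤ K * dist x y) : IsLipOn f s := by
  refine ⟨K.toNNReal, LipschitzOnWith.of_dist_le_mul fun x hx y hy => (h x hx y hy).trans ?_⟩
  exact mul_le_mul_of_nonneg_right (Real.le_coe_toNNReal K) dist_nonneg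

theorem exists_bound (hf : IsLipOn f s) :
    ∃ K : ℝ, 0 ≤ K ∧ ∀ x ∈ s, ∀ y ∈ s, |f x - f y| ≤ K * dist x y := by
  obtain ⟨K, hK⟩ := hf
  exact ⟨K, K.2, fun x hx y hy => hK.dist_le_mul x hx y hy⟩

theorem mono (hf : IsLipOn f t) (h : s ⊆ t) : IsLipOn f s := ⟨hf.choose, hf.choose_spec.mono h⟩

theorem continuousOn (hf : IsLipOn f s) : ContinuousOn f s := hf.choose_spec.continuousOn

theorem congr (hf : IsLipOn f s) (h : EqOn g f s) : IsLipOn g s := by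
  obtain ⟨K, -, hK⟩ := hf.exists_bound
  exact of_bound fun x hx y hy => by rw [h hx, h hy]; exact hK x hx y hy

theorem comp {F : Type*} [PseudoMetricSpace F] {p : F → E} {r : Set F} {K : ℝ≥0} (hf : IsLipOn f s)
    (hp : LipschitzOnWith K p r) (h : MapsTo p r s) : IsLipOn (fun x => f (p x)) r :=
  ⟨_, hf.choose_spec.comp hp h⟩

theorem const (c : ℝ) : IsLipOn (fun _ : E => c) s := of_bound (K := 0) fun x _ y _ => by simp

theorem add (hf : IsLipOn f s) (hg : IsLipOn g s) : IsLipOn (fun x => f x + g x) s := by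
  obtain ⟨K, -, hK⟩ := hf.exists_bound
  obtain ⟨K', -, hK'⟩ := hg.exists_bound
  refine of_bound (K := K + K') fun x hx y hy => ?_
  rw [add_sub_add_comm, add_mul]
  exact (abs_add_le _ _).trans (add_le_add (hK x hx y hy) (hK' x hx y hy))

theorem neg (hf : IsLipOn f s) : IsLipOn (fun x => -f x) s := by
  obtain ⟨K, -, hK⟩ := hf.exists_bound
  refine of_bound (K := K) fun x hx y hy => ?_
  rw [neg_sub_neg, abs_sub_comm]
  exact hK x hx y hy

theorem sub (hf : IsLipOn f s) (hg : IsLipOn g s) : IsLipOn (fun x => f x - g x) s := by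
  simpa only [sub_eq_add_neg] using hf.add hg.neg

theorem exists_abs_le (hf : IsLipOn f s) (hs : Bornology.IsBounded s) :
    ∃ B : ℝ, 0 ≤ B ∧ ∀ x ∈ s, |f x| ≤ B := by
  obtain ⟨K, hK⟩ := hf
  rcases s.eq_empty_or_nonempty with rfl | ⟨x₀, hx₀⟩
  · exact ⟨0, le_rfl, fun x hx => hx.elim⟩
  obtain ⟨D, hD⟩ := Metric.isBounded_iff.1 hs
  refine ⟨|f x₀| + K * D, ?_, fun x hx => ?_⟩
  · have : 0 ≤ D := by simpa using hD hx₀ hx₀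
    positivity
  · have h1 := hK.dist_le_mul x hx x₀ hx₀
    rw [Real.dist_eq] at h1
    have h2 : (K : ℝ) * dist x x₀ ≤ K * D := mul_le_mul_of_nonneg_left (hD hx hx₀) K.2
    have h3 := abs_sub_abs_le_abs_sub (f x) (f x₀)
    linarith

theorem mul (hf : IsLipOn f s) (hg : IsLipOn g s) (hs : Bornology.IsBounded s) :
    IsLipOn (fun x => f x * g x) s := by
  obtain ⟨K, hK0, hK⟩ := hf.exists_bound
  obtain ⟨K', hK0', hK'⟩ := hg.exists_bound
  obtain ⟨B, hB0, hB⟩ := hf.exists_abs_le hs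
  obtain ⟨B', hB0', hB'⟩ := hg.exists_abs_le hs
  refine of_bound (K := B * K' + K * B') fun x hx y hy => ?_
  have e : f x * g x - f y * g y = f x * (g x - g y) + (f x - f y) * g y := by ring
  rw [e]
  refine (abs_add_le _ _).trans ?_
  rw [abs_mul, abs_mul]
  calc |f x| * |g x - g y| + |f x - f y| * |g y|
      ≤ B * (K' * dist x y) + K * dist x y * B' :=
        add_le_add (mul_le_mul (hB x hx) (hK' x hx y hy) (abs_nonneg _) hB0)
          (mul_le_mul (hK x hx y hy) (hB' y hy) (abs_nonneg _) (by positivity))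
    _ = _ := by ring

theorem inv (hf : IsLipOn f s) {a : ℝ} (ha : 0 < a) (hfa : ∀ x ∈ s, a ≤ f x) :
    IsLipOn (fun x => (f x)⁻¹) s := by
  obtain ⟨K, hK0, hK⟩ := hf.exists_bound
  refine of_bound (K := K / a ^ 2) fun x hx y hy => ?_
  refine (abs_inv_sub_inv_le ha (hfa x hx) (hfa y hy)).trans ?_
  rw [div_mul_eq_mul_div]
  exact div_le_div_of_nonneg_right (hK x hx y hy) (by positivity)

theorem closure (hf : IsLipOn f s) (hc : ContinuousOn f (closure s)) : IsLipOn f (closure s) :=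
  ⟨_, hf.choose_spec.closure hc⟩

theorem memL {E : Type*} [NormedAddCommGroup E] [MeasureSpace E] [BorelSpace E]
    {f : E → ℝ} {s : Set E} (hf : IsLipOn f s) (hs : Bornology.IsBounded s)
    (hm : MeasurableSet s) : MemL s ∞ f := by
  obtain ⟨B, -, hB⟩ := hf.exists_abs_le hs
  obtain ⟨K, hK⟩ := hf
  obtain ⟨U, hU, hUf⟩ := hK.extend_real
  refine memLp_top_of_bound ?_ B ((ae_restrict_mem hm).mono hB)
  exact hU.continuous.aestronglyMeasurable.congr
    ((ae_restrict_mem hm).mono fun z hz => (hUf hz).symm)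

end IsLipOn

/-! ### Regularity of the data -/

theorem MemL.exists_ae_abs_le {E : Type*} [MeasureSpace E] {Ω : Set E} {u : E → ℝ}
    (hu : MemL Ω ∞ u) : ∃ K : ℝ, 0 ≤ K ∧ ∀ᵐ z ∂(volume.restrict Ω), |u z| ≤ K := by
  have h := hu.2
  rw [eLpNorm_exponent_top] at h
  refine ⟨(eLpNormEssSup u (volume.restrict Ω)).toReal, ENNReal.toReal_nonneg, ?_⟩
  filter_upwards [ae_le_eLpNormEssSup (f := u) (μ := volume.restrict Ω)] with z hz
  rw [← Real.norm_eq_abs, ← toReal_enorm]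
  exact ENNReal.toReal_mono h.ne hz

theorem MemSobolev.one_of_two {I : Set ℝ} {u : ℝ → ℝ} (h : MemSobolev I ⊤ 2 u) :
    MemSobolev I ⊤ 1 u := by
  obtain ⟨hu, g, hg, hg', -⟩ := h
  exact ⟨hu, g, hg, hg'⟩

/-- A continuous function on an interval with a bounded weak derivative is Lipschitz. -/
theorem isLipOn_Icc_of_hasWeakDeriv {a b K : ℝ} (hab : a < b) {u g : ℝ → ℝ}
    (hu : ContinuousOn u (Icc a b)) (hg : HasWeakDeriv (Ioo a b) 1 u g)
    (hK : ∀ᵐ z ∂(volume.restrict (Ioo a b)), |g z| ≤ K) : IsLipOn u (Icc a b) := by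
  have hui : IntegrableOn u (Ioo a b) :=
    (hu.integrableOn_compact isCompact_Icc).mono_set Ioo_subset_Icc_self
  obtain ⟨U, hU, hUu⟩ := exists_lipschitzWith_ae_eq (ι := Unit) (C := K.toNNReal) isOpen_Ioo
    (convex_Ioo a b) hui (fun _ => 1) (fun _ => g) (K := K) (fun _ => hg) (fun _ => hK) (by
      intro f' hf'
      have h1 := hf' ()
      have h2 : ‖f'‖ = |f' 1| := by
        rw [← Real.norm_eq_abs]
        refine le_antisymm (f'.opNorm_le_bound (norm_nonneg _) fun x => ?_) ?_
        · have : f' x = x * f' 1 := by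
            conv_lhs => rw [← mul_one x, ← smul_eq_mul, map_smul, smul_eq_mul]
          rw [this, norm_mul, mul_comm]
        · simpa using f'.le_opNorm 1
      rw [h2]
      exact h1.trans (Real.le_coe_toNNReal K))
  have heq : EqOn u U (Ioo a b) :=
    Measure.eqOn_open_of_ae_eq hUu isOpen_Ioo (hu.mono Ioo_subset_Icc_self)
      hU.continuous.continuousOn
  have h : IsLipOn u (Ioo a b) := IsLipOn.congr ⟨_, hU.lipschitzOnWith⟩ heq
  rw [← closure_Ioo hab.ne] at hu ⊢
  exact h.closure hu

theorem MemSobolev.isLipOn {T : ℝ} (hT : 0 < T) {u : ℝ → ℝ} (hu : ContinuousOn u (Icc 0 T))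
    (h : MemSobolev (Ioo 0 T) ⊤ 1 u) : IsLipOn u (Icc 0 T) := by
  obtain ⟨-, g, hg, hg'⟩ := h
  obtain ⟨K, -, hK⟩ := MemL.exists_ae_abs_le hg'
  exact isLipOn_Icc_of_hasWeakDeriv hT hu hg hK

/-- In one dimension `H²` embeds into the Lipschitz functions. -/
theorem MemSobolev.isLipOn_of_two {L : ℝ} (hL : 0 < L) {u : ℝ → ℝ} (hu : ContinuousOn u (Icc 0 L))
    (h : MemSobolev (Ioo 0 L) 2 2 u) : IsLipOn u (Icc 0 L) := by
  obtain ⟨-, w, hw, hw2, g, hg, hg2⟩ := h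
  have hwi : IntegrableOn w (Ioo 0 L) := hw2.integrable (by norm_num)
  have hgi : IntegrableOn g (Ioo 0 L) := MemLp.integrable (by norm_num) hg2
  have hU := hasWeakDeriv_intervalIntegral hL hgi
  have hUc : ContinuousOn (fun x => ∫ s in (0 : ℝ)..x, g s) (Icc 0 L) := by
    have := (((intervalIntegrable_iff_integrableOn_Ioo_of_le
      hL.le).2 hgi).absolutelyContinuousOnInterval_intervalIntegral (c := 0) (by simp)).continuousOn
    rwa [uIcc_of_le hL.le] at this
  have hUi : IntegrableOn (fun x => ∫ s in (0 : ℝ)..x, g s) (Ioo 0 L) :=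
    (hUc.integrableOn_compact isCompact_Icc).mono_set Ioo_subset_Icc_self
  -- `w` minus the primitive of its weak derivative has weak derivative zero, so it is constant
  obtain ⟨W, hW, hWw⟩ := exists_lipschitzWith_ae_eq (ι := Unit) (C := 0) isOpen_Ioo
    (convex_Ioo 0 L) (hwi.sub hUi) (fun _ => 1) (fun _ z => g z - g z) (K := 0)
    (fun _ => hg.sub hU) (fun _ => Eventually.of_forall fun z => by simp) (by
      intro f' hf'
      have h1 : f' 1 = 0 := abs_nonpos_iff.1 (hf' ())
      have : f' = 0 := by
        ext
        simpa using h1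
      simp [this])
  obtain ⟨B, hB⟩ := isCompact_Icc.exists_bound_of_continuousOn
    (hUc.add hW.continuous.continuousOn)
  refine isLipOn_Icc_of_hasWeakDeriv (K := B) hL hu hw ?_
  filter_upwards [hWw, ae_restrict_mem measurableSet_Ioo] with x hx hxm
  have h1 := hB x (Ioo_subset_Icc_self hxm)
  have h2 : w x = (∫ s in (0 : ℝ)..x, g s) + W x := by
    simp only [Pi.sub_apply] at hx
    linarith
  rw [h2]
  exact h1

/-! ### A filament of prescribed length -/

/-- The amount of mass `r` that fills a filament of length `L` when the cross-section is `f`. -/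
theorem exists_integral_inv_eq {f : ℝ → ℝ} (hf : Continuous f) {δ H L : ℝ} (hδ : 0 < δ)
    (hL : 0 < L) (hfb : ∀ z, δ ≤ f z ∧ f z ≤ H) :
    ∃ r, 0 ≤ r ∧ r ≤ H * L ∧ ∫ z in (0 : ℝ)..r, (f z)⁻¹ = L := by
  have hH : 0 < H := hδ.trans_le ((hfb 0).1.trans (hfb 0).2)
  have hpos : ∀ z, 0 < f z := fun z => hδ.trans_le (hfb z).1
  have hc : Continuous fun z => (f z)⁻¹ := hf.inv₀ fun z => (hpos z).ne'
  have hHL : 0 ≤ H * L := by positivity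
  have h1 : L ≤ ∫ z in (0 : ℝ)..(H * L), (f z)⁻¹ := by
    have : ∫ _ in (0 : ℝ)..(H * L), H⁻¹ ≤ ∫ z in (0 : ℝ)..(H * L), (f z)⁻¹ :=
      intervalIntegral.integral_mono_on hHL (by simp) (hc.intervalIntegrable _ _)
        fun z _ => inv_anti₀ (hpos z) (hfb z).2
    rw [intervalIntegral.integral_const, smul_eq_mul] at this
    calc L = (H * L - 0) * H⁻¹ := by field_simp; ring
      _ ≤ _ := this
  obtain ⟨r, hr, hrL⟩ := intermediate_value_Icc hHL
    (intervalIntegral.continuous_primitive (fun a b => hc.intervalIntegrable a b) 0).continuousOn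
    (show L ∈ Icc _ _ from ⟨by simpa using hL.le, h1⟩)
  exact ⟨r, hr.1, hr.2, hrL⟩

theorem abs_inv_sq_sub_inv_sq_le {a b δ : ℝ} (hδ : 0 < δ) (ha : δ ≤ a) (hb : δ ≤ b) :
    |a⁻¹ ^ 2 - b⁻¹ ^ 2| ≤ 2 * |a - b| / δ ^ 3 := by
  have ha1 : a⁻¹ ≤ δ⁻¹ := inv_anti₀ hδ ha
  have hb1 : b⁻¹ ≤ δ⁻¹ := inv_anti₀ hδ hb
  have ha' : 0 < a⁻¹ := inv_pos.2 (hδ.trans_le ha)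
  have hb' : 0 < b⁻¹ := inv_pos.2 (hδ.trans_le hb)
  rw [sq_sub_sq, abs_mul, abs_of_pos (add_pos ha' hb')]
  calc (a⁻¹ + b⁻¹) * |a⁻¹ - b⁻¹| ≤ (δ⁻¹ + δ⁻¹) * (|a - b| / δ ^ 2) := by
        gcongr
        exact abs_inv_sub_inv_le hδ ha hb
    _ = _ := by field_simp; ring

/-- Stability of `∫ 1/f²` over the filament of length `L` under uniform perturbations of `f`. -/
theorem abs_integral_inv_sq_sub_le {f₁ f₂ : ℝ → ℝ} (hf₁ : Continuous f₁) (hf₂ : Continuous f₂)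
    {δ H L η r₁ r₂ : ℝ} (hδ : 0 < δ) (hfb₁ : ∀ z, δ ≤ f₁ z) (hfb₂ : ∀ z, δ ≤ f₂ z)
    (hη : ∀ z ∈ Icc 0 (H * L), |f₁ z - f₂ z| ≤ η)
    (hr₁ : 0 ≤ r₁ ∧ r₁ ≤ H * L ∧ ∫ z in (0 : ℝ)..r₁, (f₁ z)⁻¹ = L)
    (hr₂ : 0 ≤ r₂ ∧ r₂ ≤ H * L ∧ ∫ z in (0 : ℝ)..r₂, (f₂ z)⁻¹ = L) :
    |(∫ z in (0 : ℝ)..r₁, (f₁ z)⁻¹ ^ 2) - ∫ z in (0 : ℝ)..r₂, (f₂ z)⁻¹ ^ 2|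
      ≤ 3 * (H * L) / δ ^ 3 * η := by
  wlog h12 : r₁ ≤ r₂ generalizing f₁ f₂ r₁ r₂
  · rw [abs_sub_comm]
    exact this hf₂ hf₁ hfb₂ hfb₁ (fun z hz => by rw [abs_sub_comm]; exact hη z hz) hr₂ hr₁
      (le_of_not_ge h12)
  have hp₁ : ∀ z, 0 < f₁ z := fun z => hδ.trans_le (hfb₁ z)
  have hp₂ : ∀ z, 0 < f₂ z := fun z => hδ.trans_le (hfb₂ z)
  have hc₁ : Continuous fun z => (f₁ z)⁻¹ := hf₁.inv₀ fun z => (hp₁ z).ne'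
  have hc₂ : Continuous fun z => (f₂ z)⁻¹ := hf₂.inv₀ fun z => (hp₂ z).ne'
  have hi₁ : ∀ a b, IntervalIntegrable (fun z => (f₁ z)⁻¹) volume a b :=
    fun a b => hc₁.intervalIntegrable a b
  have hi₂ : ∀ a b, IntervalIntegrable (fun z => (f₂ z)⁻¹) volume a b :=
    fun a b => hc₂.intervalIntegrable a b
  have hs₁ : ∀ a b, IntervalIntegrable (fun z => (f₁ z)⁻¹ ^ 2) volume a b :=
    fun a b => (hc₁.pow 2).intervalIntegrable a b
  have hs₂ : ∀ a b, IntervalIntegrable (fun z => (f₂ z)⁻¹ ^ 2) volume a b :=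
    fun a b => (hc₂.pow 2).intervalIntegrable a b
  have hη0 : 0 ≤ η := (abs_nonneg _).trans (hη 0 ⟨le_rfl, hr₁.1.trans hr₁.2.1⟩)
  have hmem : ∀ z ∈ uIoc 0 r₁, z ∈ Icc 0 (H * L) := fun z hz => by
    rw [uIoc_of_le hr₁.1] at hz
    exact ⟨hz.1.le, hz.2.trans hr₁.2.1⟩
  -- the surplus over `[r₁, r₂]` is small because both lengths are equal to `L`
  have ha : ∫ z in r₁..r₂, (f₂ z)⁻¹ ≤ H * L * (η / δ ^ 2) := by
    have e1 : ∫ z in r₁..r₂, (f₂ z)⁻¹ = ∫ z in (0 : ℝ)..r₁, ((f₁ z)⁻¹ - (f₂ z)⁻¹) := by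
      rw [intervalIntegral.integral_sub (hi₁ _ _) (hi₂ _ _), hr₁.2.2, ← hr₂.2.2,
        ← intervalIntegral.integral_add_adjacent_intervals (hi₂ 0 r₁) (hi₂ r₁ r₂)]
      ring
    have e2 := intervalIntegral.norm_integral_le_of_norm_le_const (a := 0) (b := r₁)
      (f := fun z => (f₁ z)⁻¹ - (f₂ z)⁻¹) (C := η / δ ^ 2) fun z hz => by
        refine (abs_inv_sub_inv_le hδ (hfb₁ z) (hfb₂ z)).trans ?_
        have := hη z (hmem z hz)
        gcongr
    rw [e1]
    refine (le_abs_self _).trans (e2.trans ?_)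
    rw [sub_zero, abs_of_nonneg hr₁.1, mul_comm]
    have := hr₁.2.1
    gcongr
  have hb : |∫ z in r₁..r₂, (f₂ z)⁻¹ ^ 2| ≤ δ⁻¹ * (H * L * (η / δ ^ 2)) := by
    rw [abs_of_nonneg (intervalIntegral.integral_nonneg h12 fun z _ => by positivity)]
    calc ∫ z in r₁..r₂, (f₂ z)⁻¹ ^ 2 ≤ ∫ z in r₁..r₂, δ⁻¹ * (f₂ z)⁻¹ := by
          refine intervalIntegral.integral_mono_on h12 (hs₂ _ _) ((hi₂ _ _).const_mul _)
            fun z _ => ?_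
          rw [sq]
          exact mul_le_mul_of_nonneg_right (inv_anti₀ hδ (hfb₂ z)) (inv_pos.2 (hp₂ z)).le
      _ = δ⁻¹ * ∫ z in r₁..r₂, (f₂ z)⁻¹ := intervalIntegral.integral_const_mul _ _
      _ ≤ _ := by gcongr
  have hc : |∫ z in (0 : ℝ)..r₁, ((f₁ z)⁻¹ ^ 2 - (f₂ z)⁻¹ ^ 2)| ≤ H * L * (2 * η / δ ^ 3) := by
    have e2 := intervalIntegral.norm_integral_le_of_norm_le_const (a := 0) (b := r₁)
      (f := fun z => (f₁ z)⁻¹ ^ 2 - (f₂ z)⁻¹ ^ 2) (C := 2 * η / δ ^ 3) fun z hz => by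
        refine (abs_inv_sq_sub_inv_sq_le hδ (hfb₁ z) (hfb₂ z)).trans ?_
        have := hη z (hmem z hz)
        gcongr
    refine e2.trans ?_
    rw [sub_zero, abs_of_nonneg hr₁.1, mul_comm]
    have := hr₁.2.1
    gcongr
  have hd : (∫ z in (0 : ℝ)..r₁, (f₁ z)⁻¹ ^ 2) - ∫ z in (0 : ℝ)..r₂, (f₂ z)⁻¹ ^ 2
      = (∫ z in (0 : ℝ)..r₁, ((f₁ z)⁻¹ ^ 2 - (f₂ z)⁻¹ ^ 2)) - ∫ z in r₁..r₂, (f₂ z)⁻¹ ^ 2 := by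
    rw [intervalIntegral.integral_sub (hs₁ _ _) (hs₂ _ _),
      ← intervalIntegral.integral_add_adjacent_intervals (hs₂ 0 r₁) (hs₂ r₁ r₂)]
    ring
  rw [hd]
  calc _ ≤ H * L * (2 * η / δ ^ 3) + δ⁻¹ * (H * L * (η / δ ^ 2)) :=
        (abs_sub _ _).trans (add_le_add hc hb)
    _ = _ := by field_simp; ring

/-- A filament of length `L` whose cross-section is at most `H` has `∫ 1/f² ≥ L/H`, which keeps
the denominator of the fixed point equation away from zero. -/
theorem le_integral_inv_sq {f : ℝ → ℝ} (hf : Continuous f) {δ H L r : ℝ} (hδ : 0 < δ)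
    (hfb : ∀ z, δ ≤ f z ∧ f z ≤ H) (hr : 0 ≤ r) (hrL : ∫ z in (0 : ℝ)..r, (f z)⁻¹ = L) :
    L / H ≤ ∫ z in (0 : ℝ)..r, (f z)⁻¹ ^ 2 := by
  have hpos : ∀ z, 0 < f z := fun z => hδ.trans_le (hfb z).1
  have hc : Continuous fun z => (f z)⁻¹ := hf.inv₀ fun z => (hpos z).ne'
  calc L / H = ∫ z in (0 : ℝ)..r, H⁻¹ * (f z)⁻¹ := by
        rw [intervalIntegral.integral_const_mul, hrL, div_eq_inv_mul]
    _ ≤ _ := by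
        refine intervalIntegral.integral_mono_on hr ((hc.const_mul _).intervalIntegrable _ _)
          ((hc.pow 2).intervalIntegrable _ _) fun z _ => ?_
        rw [sq]
        exact mul_le_mul_of_nonneg_right (inv_anti₀ (hpos z) (hfb z).2) (inv_pos.2 (hpos z)).le

theorem abs_div_sub_div_le {b B N₁ N₂ m : ℝ} (hm : 0 < m) (hb : 0 ≤ b) (hB : b ≤ B) (h₁ : m ≤ N₁)
    (h₂ : m ≤ N₂) : |b / N₁ - b / N₂| ≤ B / m ^ 2 * |N₁ - N₂| := by
  rw [div_eq_mul_inv, div_eq_mul_inv, ← mul_sub, abs_mul, abs_of_nonneg hb]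
  calc b * |N₁⁻¹ - N₂⁻¹| ≤ B * (|N₁ - N₂| / m ^ 2) := by
        gcongr
        · exact hb.trans hB
        · exact abs_inv_sub_inv_le hm h₁ h₂
    _ = _ := by ring

/-! ### Primitives vanishing on the negative half-line -/

/-- The primitive of `c` that vanishes on the negative half-line. -/
noncomputable def primitive (c : ℝ → ℝ) (y : ℝ) : ℝ := ∫ s in (0 : ℝ)..(max y 0), c s

theorem continuous_primitive {c : ℝ → ℝ} (hc : Continuous c) : Continuous (primitive c) :=
  (intervalIntegral.continuous_primitive (fun a b => hc.intervalIntegrable a b) 0).comp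
    (continuous_id.max continuous_const)

/-- The primitives up to `θ` depend on the past of `θ` only, which makes the reduced problem a
Volterra equation. -/
theorem abs_primitive_sub_le {c₁ c₂ : ℝ → ℝ} (h₁ : Continuous c₁) (h₂ : Continuous c₂) {y θ : ℝ}
    (hy : y ≤ θ) :
    |primitive c₁ y - primitive c₂ y| ≤ ∫ s in (0 : ℝ)..(max θ 0), |c₁ s - c₂ s| := by
  have hc : Continuous fun s => |c₁ s - c₂ s| := (h₁.sub h₂).abs
  rw [primitive, primitive, ← intervalIntegral.integral_sub (h₁.intervalIntegrable _ _)
    (h₂.intervalIntegrable _ _)]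
  refine (intervalIntegral.abs_integral_le_integral_abs (le_max_right _ _)).trans ?_
  exact intervalIntegral.integral_mono_interval le_rfl (le_max_right _ _) (max_le_max_right _ hy)
    (Eventually.of_forall fun s => abs_nonneg _) (hc.intervalIntegrable _ _)

theorem abs_primitive_sub_le_mul {c : ℝ → ℝ} (hc : Continuous c) {B : ℝ}
    (hcB : ∀ θ, 0 ≤ c θ ∧ c θ ≤ B) (x y : ℝ) :
    |primitive c x - primitive c y| ≤ B * |x - y| := by
  rw [primitive, primitive, intervalIntegral.integral_interval_sub_left
    (hc.intervalIntegrable _ _) (hc.intervalIntegrable _ _)]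
  have h := intervalIntegral.norm_integral_le_of_norm_le_const (a := max y 0) (b := max x 0)
    (f := c) (C := B) fun s _ => by
      rw [Real.norm_eq_abs, abs_of_nonneg (hcB s).1]
      exact (hcB s).2
  refine h.trans ?_
  have hB : 0 ≤ B := (hcB 0).1.trans (hcB 0).2
  exact mul_le_mul_of_nonneg_left (abs_max_sub_max_le_abs x y 0) hB

theorem primitive_mono {c : ℝ → ℝ} (hc : Continuous c) (hc0 : ∀ θ, 0 ≤ c θ) :
    Monotone (primitive c) := fun _ _ hxy =>
  intervalIntegral.integral_mono_interval le_rfl (le_max_right _ _) (max_le_max_right _ hxy)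
    (Eventually.of_forall hc0) (hc.intervalIntegrable _ _)

theorem primitive_of_nonpos (c : ℝ → ℝ) {y : ℝ} (hy : y ≤ 0) : primitive c y = 0 := by
  simp [primitive, max_eq_right hy]

theorem hasDerivAt_primitive {c : ℝ → ℝ} (hc : Continuous c) {y : ℝ} (hy : 0 < y) :
    HasDerivAt (primitive c) (c y) y := by
  refine (hc.integral_hasStrictDerivAt 0 y).hasDerivAt.congr_of_eventuallyEq ?_
  filter_upwards [lt_mem_nhds hy] with s hs
  simp [primitive, max_eq_left hs.le]

/-! ### The reduced problem in the mass coordinate -/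

/-- The cross-section at the point that is separated from the inlet by the mass `z`, at the time at
which the mass `θ` has entered, cut off to the interval `[δ, H]`. -/
noncomputable def truncatedSection (δ H : ℝ) (g c : ℝ → ℝ) (θ z : ℝ) : ℝ :=
  max δ (min H (g (θ - z) + primitive c (θ - z) - primitive c θ))

theorem abs_max_min_sub_le (δ H a b : ℝ) : |max δ (min H a) - max δ (min H b)| ≤ |a - b| := by
  have h : LipschitzWith 1 fun x : ℝ => max δ (min H x) :=
    (LipschitzWith.id.const_min H).const_max δ
  simpa [Real.dist_eq] using h.dist_le_mul a b

theorem continuous_truncatedSection {δ H : ℝ} {g c : ℝ → ℝ} (hg : Continuous g)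
    (hc : Continuous c) : Continuous fun p : ℝ × ℝ => truncatedSection δ H g c p.1 p.2 := by
  have := continuous_primitive hc
  unfold truncatedSection
  fun_prop

theorem truncatedSection_mem {δ H : ℝ} (h : δ ≤ H) (g c : ℝ → ℝ) (θ z : ℝ) :
    δ ≤ truncatedSection δ H g c θ z ∧ truncatedSection δ H g c θ z ≤ H :=
  ⟨le_max_left _ _, max_le h (min_le_left _ _)⟩

/-- A bounded Volterra operator on continuous functions on the line, Lipschitz with respect to the
integral of the difference over the past, has a fixed point: it is a contraction for the sup norm
weighted by an exponential. -/
theorem exists_fixedPoint_of_volterra {F : (ℝ → ℝ) → ℝ → ℝ} {B K : ℝ} (hK : 0 ≤ K)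
    (hFc : ∀ c, Continuous c → Continuous (F c))
    (hFb : ∀ c, Continuous c → ∀ θ, |F c θ| ≤ B)
    (hF : ∀ c₁ c₂, Continuous c₁ → Continuous c₂ → ∀ θ,
      |F c₁ θ - F c₂ θ| ≤ K * ∫ s in (0 : ℝ)..(max θ 0), |c₁ s - c₂ s|) :
    ∃ c, Continuous c ∧ F c = c := by
  -- any weight `exp (l s)` with `K / l ≤ 1 / 2` makes the operator a `1 / 2`-contraction
  set l : ℝ := 2 * K + 1 with hl
  have hl0 : 0 < l := by positivity
  let w : ℝ → ℝ := fun s => Real.exp (l * max s 0)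
  have hw0 : ∀ s, 0 < w s := fun s => Real.exp_pos _
  have hw1 : ∀ s, 1 ≤ w s := fun s => Real.one_le_exp (mul_nonneg hl0.le (le_max_right _ _))
  have hwc : Continuous w := by fun_prop
  have hwD : ∀ D : BoundedContinuousFunction ℝ ℝ, Continuous fun s => w s * D s :=
    fun D => hwc.mul D.continuous
  -- `F` conjugated with the weight, so that the unweighted sup norm can be used
  let Φ : BoundedContinuousFunction ℝ ℝ → BoundedContinuousFunction ℝ ℝ := fun D =>
    BoundedContinuousFunction.ofNormedAddCommGroup (fun s => (w s)⁻¹ * F (fun s => w s * D s) s)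
      ((hwc.inv₀ fun s => (hw0 s).ne').mul (hFc _ (hwD D))) B fun s => by
        rw [norm_mul, Real.norm_eq_abs, Real.norm_eq_abs, abs_of_pos (inv_pos.2 (hw0 s))]
        calc (w s)⁻¹ * |F (fun s => w s * D s) s| ≤ 1 * |F (fun s => w s * D s) s| := by
              gcongr
              exact inv_le_one_of_one_le₀ (hw1 s)
          _ ≤ B := by rw [one_mul]; exact hFb _ (hwD D) s
  have hΦ : ∀ D s, Φ D s = (w s)⁻¹ * F (fun s => w s * D s) s := fun D s => rfl
  have hexp : ∀ a : ℝ, 0 ≤ a → ∫ s in (0 : ℝ)..a, w s = (Real.exp (l * a) - 1) / l := by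
    intro a ha
    have h1 : ∫ s in (0 : ℝ)..a, w s = ∫ s in (0 : ℝ)..a, Real.exp (l * s) := by
      refine intervalIntegral.integral_congr fun s hs => ?_
      rw [uIcc_of_le ha] at hs
      simp only [w, max_eq_left hs.1]
    rw [h1, intervalIntegral.integral_comp_mul_left (f := Real.exp) hl0.ne', integral_exp,
      mul_zero, Real.exp_zero, smul_eq_mul, inv_mul_eq_div]
  have hcontr : ContractingWith (1 / 2) Φ := by
    refine ⟨by norm_num [← NNReal.coe_lt_coe], LipschitzWith.of_dist_le_mul fun D₁ D₂ => ?_⟩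
    refine (BoundedContinuousFunction.dist_le (by positivity)).2 fun s => ?_
    rw [hΦ, hΦ, Real.dist_eq, ← mul_sub, abs_mul, abs_of_pos (inv_pos.2 (hw0 s)),
      inv_mul_le_iff₀ (hw0 s)]
    refine (hF _ _ (hwD D₁) (hwD D₂) s).trans ?_
    have h1 : ∫ r in (0 : ℝ)..(max s 0), |w r * D₁ r - w r * D₂ r|
        ≤ ∫ r in (0 : ℝ)..(max s 0), w r * dist D₁ D₂ := by
      refine intervalIntegral.integral_mono_on (le_max_right _ _)
        (((hwD D₁).sub (hwD D₂)).abs.intervalIntegrable _ _)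
        ((hwc.mul continuous_const).intervalIntegrable _ _) fun r _ => ?_
      rw [← mul_sub, abs_mul, abs_of_pos (hw0 r)]
      have : |D₁ r - D₂ r| ≤ dist D₁ D₂ :=
        BoundedContinuousFunction.dist_coe_le_dist (f := D₁) (g := D₂) r
      have := (hw0 r).le
      gcongr
    rw [intervalIntegral.integral_mul_const, hexp _ (le_max_right _ _)] at h1
    have h2 : Real.exp (l * max s 0) = w s := rfl
    rw [h2] at h1
    have hd : 0 ≤ dist D₁ D₂ := dist_nonneg
    calc K * ∫ r in (0 : ℝ)..(max s 0), |w r * D₁ r - w r * D₂ r|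
        ≤ K * ((w s - 1) / l * dist D₁ D₂) := by gcongr
      _ ≤ K * (w s / l * dist D₁ D₂) := by gcongr; linarith
      _ = (K / l) * (w s * dist D₁ D₂) := by ring
      _ ≤ (1 / 2) * (w s * dist D₁ D₂) := by
          have h3 : K / l ≤ 1 / 2 := by
            rw [div_le_iff₀ hl0]
            linarith
          exact mul_le_mul_of_nonneg_right h3 (mul_nonneg (hw0 s).le hd)
      _ = w s * (((1 / 2 : ℝ≥0) : ℝ) * dist D₁ D₂) := by push_cast; ring
  have hfix : Φ (hcontr.fixedPoint Φ) = hcontr.fixedPoint Φ := hcontr.fixedPoint_isFixedPt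
  refine ⟨fun s => w s * hcontr.fixedPoint Φ s, hwD _, funext fun s => ?_⟩
  have h := congrArg (fun D : BoundedContinuousFunction ℝ ℝ => D s) hfix
  simp only [hΦ] at h
  rw [← h, mul_inv_cancel_left₀ (hw0 s).ne']

/-- Solution of the reduced problem with cut-off cross-sections. -/
theorem exists_truncated_solution {g b : ℝ → ℝ} (hg : Continuous g) (hb : Continuous b)
    {B δ H L : ℝ} (hb0 : ∀ θ, 0 ≤ b θ) (hbB : ∀ θ, b θ ≤ B) (hδ : 0 < δ) (hδH : δ ≤ H)
    (hL : 0 < L) :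
    ∃ c : ℝ → ℝ, Continuous c ∧ (∀ θ, 0 ≤ c θ ∧ c θ ≤ B * H / L) ∧
      ∀ θ, ∃ r, 0 ≤ r ∧ ∫ z in (0 : ℝ)..r, (truncatedSection δ H g c θ z)⁻¹ = L ∧
        c θ * ∫ z in (0 : ℝ)..r, (truncatedSection δ H g c θ z)⁻¹ ^ 2 = b θ := by
  have hH : 0 < H := hδ.trans_le hδH
  have hm : 0 < L / H := by positivity
  have hB : 0 ≤ B := (hb0 0).trans (hbB 0)
  have key : ∀ f : ℝ → ℝ, (Continuous f ∧ ∀ z, δ ≤ f z ∧ f z ≤ H) →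
      ∃ r, 0 ≤ r ∧ r ≤ H * L ∧ ∫ z in (0 : ℝ)..r, (f z)⁻¹ = L :=
    fun f hf => exists_integral_inv_eq hf.1 hδ hL hf.2
  -- the mass `R f` that fills the length `L` if the cross-section is `f`
  choose! R hR using key
  have hP : ∀ c, Continuous c → ∀ θ, Continuous (truncatedSection δ H g c θ) ∧
      ∀ z, δ ≤ truncatedSection δ H g c θ z ∧ truncatedSection δ H g c θ z ≤ H := fun c hc θ =>
    ⟨(continuous_truncatedSection hg hc).comp (Continuous.prodMk_right θ),
      truncatedSection_mem hδH g c θ⟩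
  let N : (ℝ → ℝ) → ℝ → ℝ := fun c θ =>
    ∫ z in (0 : ℝ)..(R (truncatedSection δ H g c θ)), (truncatedSection δ H g c θ z)⁻¹ ^ 2
  have hN : ∀ c, Continuous c → ∀ θ, L / H ≤ N c θ := fun c hc θ =>
    le_integral_inv_sq (hP c hc θ).1 hδ (hP c hc θ).2 (hR _ (hP c hc θ)).1 (hR _ (hP c hc θ)).2.2
  have hNpos : ∀ c, Continuous c → ∀ θ, 0 < N c θ := fun c hc θ => hm.trans_le (hN c hc θ)
  have hNdiff : ∀ c₁ c₂, Continuous c₁ → Continuous c₂ → ∀ θ₁ θ₂ η,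
      (∀ z ∈ Icc 0 (H * L), |truncatedSection δ H g c₁ θ₁ z - truncatedSection δ H g c₂ θ₂ z| ≤ η) →
      |N c₁ θ₁ - N c₂ θ₂| ≤ 3 * (H * L) / δ ^ 3 * η := fun c₁ c₂ h₁ h₂ θ₁ θ₂ η hη =>
    abs_integral_inv_sq_sub_le (hP c₁ h₁ θ₁).1 (hP c₂ h₂ θ₂).1 hδ (fun z => ((hP c₁ h₁ θ₁).2 z).1)
      (fun z => ((hP c₂ h₂ θ₂).2 z).1) hη (hR _ (hP c₁ h₁ θ₁)) (hR _ (hP c₂ h₂ θ₂))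
  have hNcont : ∀ c, Continuous c → Continuous (N c) := by
    intro c hc
    refine continuous_iff_continuousAt.2 fun θ₀ => Metric.tendsto_nhds.2 fun ε hε => ?_
    set M : ℝ := 3 * (H * L) / δ ^ 3 with hM
    have hM0 : 0 < M := by positivity
    obtain ⟨v, hv, hvu⟩ := (isCompact_Icc (a := (0 : ℝ)) (b := H * L)).mem_uniformity_of_prod
      (f := fun θ z => truncatedSection δ H g c θ z) (s := univ) (q := θ₀)
      (continuous_truncatedSection hg hc).continuousOn (mem_univ _)
      (dist_mem_uniformity (show 0 < ε / (2 * M) by positivity))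
    rw [nhdsWithin_univ] at hv
    filter_upwards [hv] with θ hθ
    have := hNdiff c c hc hc θ θ₀ (ε / (2 * M)) fun z hz => (hvu θ hθ z hz).le
    rw [Real.dist_eq]
    calc _ ≤ M * (ε / (2 * M)) := this
      _ = ε / 2 := by field_simp
      _ < ε := half_lt_self hε
  set K : ℝ := B / (L / H) ^ 2 * (3 * (H * L) / δ ^ 3 * 2) with hKdef
  -- the equation `c N(c) = b` as a fixed point problem
  obtain ⟨c, hc, hFc⟩ := exists_fixedPoint_of_volterra (F := fun c θ => b θ / N c θ)
    (B := B / (L / H)) (K := K) (by positivity)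
    (fun c hc => hb.div (hNcont c hc) fun θ => (hNpos c hc θ).ne')
    (fun c hc θ => by
      rw [abs_of_nonneg (div_nonneg (hb0 θ) (hNpos c hc θ).le)]
      exact div_le_div₀ hB (hbB θ) hm (hN c hc θ))
    (fun c₁ c₂ h₁ h₂ θ => by
      refine (abs_div_sub_div_le hm (hb0 θ) (hbB θ) (hN c₁ h₁ θ) (hN c₂ h₂ θ)).trans ?_
      set I := ∫ s in (0 : ℝ)..(max θ 0), |c₁ s - c₂ s| with hI
      have := hNdiff c₁ c₂ h₁ h₂ θ θ (2 * I) fun z hz => by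
        refine (abs_max_min_sub_le _ _ _ _).trans ?_
        have e1 := abs_primitive_sub_le h₁ h₂ (sub_le_self θ hz.1)
        have e2 := abs_primitive_sub_le h₁ h₂ (le_refl θ)
        rw [← hI] at e1 e2
        rw [abs_le] at *
        constructor <;> linarith
      calc _ ≤ B / (L / H) ^ 2 * (3 * (H * L) / δ ^ 3 * (2 * I)) := by gcongr
        _ = K * I := by rw [hKdef]; ring)
  have hFcθ : ∀ θ, b θ / N c θ = c θ := fun θ => congrFun hFc θ
  refine ⟨c, hc, fun θ => ?_, fun θ => ⟨R (truncatedSection δ H g c θ), (hR _ (hP c hc θ)).1,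
    (hR _ (hP c hc θ)).2.2, ?_⟩⟩
  · rw [← hFcθ θ]
    refine ⟨div_nonneg (hb0 θ) (hNpos c hc θ).le, ?_⟩
    calc b θ / N c θ ≤ B / (L / H) := div_le_div₀ hB (hbB θ) hm (hN c hc θ)
      _ = B * H / L := by field_simp
  · rw [← hFcθ θ]
    exact div_mul_cancel₀ _ (hNpos c hc θ).ne'

/-- A Lipschitz cross-section that is at least `m` at the inlet stays bounded below along a filament
of length `L`, because the length of a thin piece grows logarithmically. -/
theorem exp_neg_mul_le_of_integral_inv_le {f : ℝ → ℝ} (hf : Continuous f) (hpos : ∀ z, 0 < f z)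
    {K L m r : ℝ} (hK : 0 < K) (hm : 0 < m) (hlip : ∀ x y, |f x - f y| ≤ K * |x - y|)
    (hf0 : m ≤ f 0) (hrL : ∫ z in (0 : ℝ)..r, (f z)⁻¹ ≤ L) {z : ℝ} (hz : z ∈ Icc 0 r) :
    m * Real.exp (-(K * L)) ≤ f z := by
  have hc : Continuous fun z => (f z)⁻¹ := hf.inv₀ fun z => (hpos z).ne'
  -- an affine majorant of `f` on `[0, z]`, for which `∫ 1/h` is a logarithm
  set h : ℝ → ℝ := fun s => f z + K * (z - s) with hh
  have hhpos : ∀ s ∈ Icc 0 z, 0 < h s := fun s hs => by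
    have := hpos z
    have := mul_nonneg hK.le (sub_nonneg.2 hs.2)
    simp only [hh]
    linarith
  have hfh : ∀ s ∈ Icc 0 z, f s ≤ h s := fun s hs => by
    have := hlip s z
    rw [abs_sub_comm s z, abs_of_nonneg (sub_nonneg.2 hs.2)] at this
    have := (abs_le.1 this).2
    simp only [hh]
    linarith
  have hint : ∫ s in (0 : ℝ)..z, (h s)⁻¹ = (Real.log (h 0) - Real.log (h z)) / K := by
    have hd : ∀ s ∈ uIcc 0 z, HasDerivAt (fun s => -(Real.log (h s) / K)) (h s)⁻¹ s := by
      intro s hs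
      rw [uIcc_of_le hz.1] at hs
      have h1 : HasDerivAt h (-K) s := by
        have := (((hasDerivAt_id s).const_sub z).const_mul K).const_add (f z)
        simpa [hh] using this
      have h2 := ((h1.log (hhpos s hs).ne').div_const K).neg
      have h3 : -(-K / h s / K) = (h s)⁻¹ := by
        have := (hhpos s hs).ne'
        field_simp
      rwa [h3] at h2
    have hcont : ContinuousOn (fun s => (h s)⁻¹) (uIcc 0 z) := by
      rw [uIcc_of_le hz.1]
      refine ContinuousOn.inv₀ ?_ fun s hs => (hhpos s hs).ne'
      simp only [hh]
      fun_prop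
    rw [intervalIntegral.integral_eq_sub_of_hasDerivAt hd hcont.intervalIntegrable]
    ring
  have h1 : ∫ s in (0 : ℝ)..z, (h s)⁻¹ ≤ L := by
    refine le_trans ?_ hrL
    calc ∫ s in (0 : ℝ)..z, (h s)⁻¹ ≤ ∫ s in (0 : ℝ)..z, (f s)⁻¹ := by
          refine intervalIntegral.integral_mono_on hz.1 ?_ (hc.intervalIntegrable _ _)
            fun s hs => inv_anti₀ (hpos s) (hfh s hs)
          refine ContinuousOn.intervalIntegrable ?_
          rw [uIcc_of_le hz.1]
          refine ContinuousOn.inv₀ ?_ fun s hs => (hhpos s hs).ne'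
          simp only [hh]
          fun_prop
      _ ≤ ∫ s in (0 : ℝ)..r, (f s)⁻¹ :=
          intervalIntegral.integral_mono_interval le_rfl hz.1 hz.2
            (Eventually.of_forall fun s => (inv_pos.2 (hpos s)).le) (hc.intervalIntegrable _ _)
  rw [hint, div_le_iff₀ hK] at h1
  have hz0 : h z = f z := by simp [hh]
  have hm0 : m ≤ h 0 := hf0.trans (hfh 0 ⟨le_rfl, hz.1⟩)
  have h2 : Real.log m ≤ Real.log (h 0) := Real.log_le_log hm hm0
  rw [hz0] at h1
  calc m * Real.exp (-(K * L)) = Real.exp (Real.log m - K * L) := by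
        rw [sub_eq_add_neg, Real.exp_add, Real.exp_log hm]
    _ ≤ Real.exp (Real.log (f z)) := Real.exp_le_exp.2 (by linarith)
    _ = f z := Real.exp_log (hpos z)

/-- The reduced problem in the mass coordinate. Time is measured by the mass `θ` that has entered;
`z` is the mass between the inlet and the point considered, `g` the initial or inflow value of the
cross-section on the material point with label `θ - z`, and the cross-section on a material point
decreases by the increment of `primitive c`. -/
theorem exists_reduced_solution {g b : ℝ → ℝ} {k B m H L : ℝ}
    (hk : 0 ≤ k) (hg : ∀ x y, |g x - g y| ≤ k * |x - y|) (hgb : ∀ y, m ≤ g y ∧ g y ≤ H)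
    (hb : Continuous b) (hb0 : ∀ θ, 0 ≤ b θ) (hbB : ∀ θ, b θ ≤ B) (hm : 0 < m) (hL : 0 < L) :
    ∃ c : ℝ → ℝ, ∃ a > 0, Continuous c ∧ (∀ θ, 0 ≤ c θ ∧ c θ ≤ B * H / L) ∧
      ∀ θ, ∃ r, 0 ≤ r ∧
        (∀ z ∈ Icc 0 r, a ≤ g (θ - z) + primitive c (θ - z) - primitive c θ) ∧
        ∫ z in (0 : ℝ)..r, (g (θ - z) + primitive c (θ - z) - primitive c θ)⁻¹ = L ∧
        c θ * ∫ z in (0 : ℝ)..r, (g (θ - z) + primitive c (θ - z) - primitive c θ)⁻¹ ^ 2 = b θ := by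
  have hmH : m ≤ H := (hgb 0).1.trans (hgb 0).2
  have hH : 0 < H := hm.trans_le hmH
  have hB : 0 ≤ B := (hb0 0).trans (hbB 0)
  -- this Lipschitz constant does not depend on the cut-off, so the lower bound `a` does not either
  set K : ℝ := k + B * H / L + 1 with hK
  have hK0 : 0 < K := by positivity
  set a : ℝ := m * Real.exp (-(K * L)) with ha
  have ha0 : 0 < a := by positivity
  have ham : a ≤ m := by
    rw [ha]
    exact mul_le_of_le_one_right hm.le (Real.exp_le_one_iff.2 (by nlinarith))
  have hgc : Continuous g := (LipschitzWith.of_dist_le_mul (K := ⟨k, hk⟩) hg).continuous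
  -- cutting off at `a / 2 < a` makes the lower bound strict, so that the cut-off is never active
  obtain ⟨c, hc, hcB, hsol⟩ := exists_truncated_solution hgc hb hb0 hbB (half_pos ha0)
    (by linarith : a / 2 ≤ H) hL
  have hcm := primitive_mono hc fun θ => (hcB θ).1
  refine ⟨c, a, ha0, hc, hcB, fun θ => ?_⟩
  obtain ⟨r, hr, hrL, hrc⟩ := hsol θ
  have hcont : Continuous (truncatedSection (a / 2) H g c θ) :=
    (continuous_truncatedSection hgc hc).comp (Continuous.prodMk_right θ)
  have hlow : ∀ z ∈ Icc 0 r, a ≤ truncatedSection (a / 2) H g c θ z := fun z hz => by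
    refine exp_neg_mul_le_of_integral_inv_le hcont
      (fun z => (half_pos ha0).trans_le (le_max_left _ _)) hK0 hm (fun x y => ?_) ?_ hrL.le hz
    · refine (abs_max_min_sub_le _ _ _ _).trans ?_
      have e1 := hg (θ - x) (θ - y)
      have e2 := abs_primitive_sub_le_mul hc hcB (θ - x) (θ - y)
      have e3 : |θ - x - (θ - y)| = |x - y| := by rw [abs_sub_comm x y]; ring_nf
      rw [e3] at e1 e2
      have e4 : K * |x - y| = k * |x - y| + B * H / L * |x - y| + |x - y| := by rw [hK]; ring
      rw [e4]
      have := abs_nonneg (x - y)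
      rw [abs_le] at e1 e2 ⊢
      constructor <;> linarith
    · refine le_max_of_le_right (le_min hmH ?_)
      simpa using (hgb θ).1
  have heq : ∀ z ∈ Icc 0 r, truncatedSection (a / 2) H g c θ z
      = g (θ - z) + primitive c (θ - z) - primitive c θ := fun z hz => by
    have h1 := hlow z hz
    have h2 : g (θ - z) + primitive c (θ - z) - primitive c θ ≤ H := by
      have := hcm (sub_le_self θ hz.1)
      have := (hgb (θ - z)).2
      linarith
    rw [truncatedSection, min_eq_right h2] at h1 ⊢
    refine max_eq_right ?_
    rcases le_max_iff.1 h1 with h | h <;> linarith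
  refine ⟨r, hr, fun z hz => heq z hz ▸ hlow z hz, ?_, ?_⟩
  · rw [← hrL]
    refine intervalIntegral.integral_congr fun z hz => ?_
    rw [uIcc_of_le hr] at hz
    simp only [heq z hz]
  · rw [← hrc]
    congr 1
    refine intervalIntegral.integral_congr fun z hz => ?_
    rw [uIcc_of_le hr] at hz
    simp only [heq z hz]

/-! ### From the mass coordinate to the position -/

/-- A `C¹` extension of `s ↦ 1/s` from `[a, ∞)` to a positive function on the line. -/
theorem exists_inv_extension {a : ℝ} (ha : 0 < a) :
    ∃ q q' : ℝ → ℝ, (∀ s, HasDerivAt q (q' s) s) ∧ Continuous q' ∧ (∀ s, 0 < q s) ∧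
      ∀ s, a ≤ s → q s = s⁻¹ ∧ q' s = -s⁻¹ ^ 2 := by
  have hpos : ∀ s, 0 < max s a := fun s => ha.trans_le (le_max_right _ _)
  let q' : ℝ → ℝ := fun s => -(max s a)⁻¹ ^ 2
  have hq' : Continuous q' :=
    (((continuous_id.max continuous_const).inv₀ fun s => (hpos s).ne').pow 2).neg
  let q : ℝ → ℝ := fun s => a⁻¹ + ∫ u in a..s, q' u
  have hq : ∀ s, a ≤ s → q s = s⁻¹ := by
    intro s hs
    have h1 : ∫ u in a..s, q' u = s⁻¹ - a⁻¹ := by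
      have hd : ∀ u ∈ uIcc a s, HasDerivAt (fun u : ℝ => u⁻¹) (q' u) u := by
        intro u hu
        rw [uIcc_of_le hs] at hu
        have h2 : q' u = -(u ^ 2)⁻¹ := by simp [q', max_eq_left hu.1]
        rw [h2]
        exact hasDerivAt_inv (ha.trans_le hu.1).ne'
      exact intervalIntegral.integral_eq_sub_of_hasDerivAt hd (hq'.intervalIntegrable _ _)
    simp only [q, h1]
    ring
  refine ⟨q, q', fun s => ?_, hq', fun s => ?_, fun s hs => ⟨hq s hs, by
    simp only [q', max_eq_left hs]⟩⟩
  · exact (hq'.integral_hasStrictDerivAt a s).hasDerivAt.const_add _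
  · rcases le_total a s with h | h
    · rw [hq s h]
      exact inv_pos.2 (ha.trans_le h)
    · have h1 : 0 ≤ ∫ u in a..s, q' u := by
        rw [intervalIntegral.integral_symm, ← intervalIntegral.integral_neg]
        refine intervalIntegral.integral_nonneg h fun u _ => ?_
        simp only [q', neg_neg]
        positivity
      have := inv_pos.2 ha
      simp only [q]
      linarith

/-- Joint differentiability of `(κ, y) ↦ ∫₀ʸ q(G - κ)`, the position of a label up to a term that
depends on time only. -/
theorem hasFDerivAt_parametric_primitive {q q' G : ℝ → ℝ} (hq : ∀ s, HasDerivAt q (q' s) s)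
    (hq' : Continuous q') (hG : Continuous G) (p : ℝ × ℝ) :
    HasFDerivAt (fun p : ℝ × ℝ => ∫ s in (0 : ℝ)..p.2, q (G s - p.1))
      ((∫ s in (0 : ℝ)..p.2, -q' (G s - p.1)) • ContinuousLinearMap.fst ℝ ℝ ℝ
        + q (G p.2 - p.1) • ContinuousLinearMap.snd ℝ ℝ ℝ) p := by
  have hqc : Continuous q := continuous_iff_continuousAt.2 fun s => (hq s).continuousAt
  have h1 : ∀ y κ : ℝ, HasDerivAt (fun κ => ∫ s in (0 : ℝ)..y, q (G s - κ))
      (∫ s in (0 : ℝ)..y, -q' (G s - κ)) κ := by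
    intro y κ
    have hcu : Continuous fun z : ℝ × ℝ => -q' (G z.2 - z.1) := by fun_prop
    obtain ⟨C, hC⟩ := ((isCompact_closedBall κ 1).prod
      (isCompact_uIcc (a := (0 : ℝ)) (b := y))).exists_bound_of_continuousOn hcu.continuousOn
    refine (intervalIntegral.hasDerivAt_integral_of_dominated_loc_of_deriv_le
      (F := fun κ s => q (G s - κ)) (F' := fun κ s => -q' (G s - κ)) (bound := fun _ => C)
      (closedBall_mem_nhds κ one_pos) (Eventually.of_forall fun κ => ?_) ?_ ?_
      (Eventually.of_forall fun s hs κ' hκ' => ?_) (by simp)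
      (Eventually.of_forall fun s _ κ' _ => ?_)).2
    · exact (by fun_prop : Continuous fun s => q (G s - κ)).aestronglyMeasurable
    · exact (by fun_prop : Continuous fun s => q (G s - κ)).intervalIntegrable _ _
    · exact (by fun_prop : Continuous fun s => -q' (G s - κ)).aestronglyMeasurable
    · exact hC (κ', s) ⟨hκ', uIoc_subset_uIcc hs⟩
    · have := (hq (G s - κ')).comp κ' ((hasDerivAt_id κ').const_sub (G s))
      rw [mul_neg_one] at this
      exact this
  have h2 : ∀ y κ : ℝ, HasDerivAt (fun y => ∫ s in (0 : ℝ)..y, q (G s - κ)) (q (G y - κ)) y :=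
    fun y κ => ((by fun_prop : Continuous fun s => q (G s - κ)).integral_hasStrictDerivAt
      0 y).hasDerivAt
  have h := (hasStrictFDerivAt_uncurry_coprod (𝕜 := ℝ) (u := p)
    (f := fun κ y => ∫ s in (0 : ℝ)..y, q (G s - κ))
    (f₁ := fun κ y => ContinuousLinearMap.toSpanSingleton ℝ (∫ s in (0 : ℝ)..y, -q' (G s - κ)))
    (f₂ := fun κ y => ContinuousLinearMap.toSpanSingleton ℝ (q (G y - κ)))
    (Eventually.of_forall fun v => (h1 v.2 v.1).hasFDerivAt)
    (Eventually.of_forall fun v => (h2 v.2 v.1).hasFDerivAt) ?_ ?_).hasFDerivAt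
  · have e : (∫ s in (0 : ℝ)..p.2, -q' (G s - p.1)) • ContinuousLinearMap.fst ℝ ℝ ℝ
        + q (G p.2 - p.1) • ContinuousLinearMap.snd ℝ ℝ ℝ
        = (ContinuousLinearMap.toSpanSingleton ℝ (∫ s in (0 : ℝ)..p.2, -q' (G s - p.1))).coprod
          (ContinuousLinearMap.toSpanSingleton ℝ (q (G p.2 - p.1))) := by
      ext <;> simp
    rw [e]
    exact h
  · refine Continuous.continuousAt ?_
    refine (ContinuousLinearMap.toSpanSingletonCLE (𝕜 := ℝ) (E := ℝ)).continuous.comp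
      (g := ContinuousLinearMap.toSpanSingletonCLE) ?_
    exact intervalIntegral.continuous_parametric_intervalIntegral_of_continuous
      (f := fun (z : ℝ × ℝ) s => -q' (G s - z.1)) (by simp only [Function.uncurry_def]; fun_prop)
      continuous_snd
  · refine Continuous.continuousAt ?_
    refine (ContinuousLinearMap.toSpanSingletonCLE (𝕜 := ℝ) (E := ℝ)).continuous.comp
      (g := ContinuousLinearMap.toSpanSingletonCLE) ?_
    show Continuous fun z : ℝ × ℝ => q (G z.2 - z.1)
    fun_prop

/-- Derivative of a function given implicitly by `X (t, Y (t, x)) = x`. -/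
theorem hasFDerivAt_of_implicit {X Y : ℝ × ℝ → ℝ} {p : ℝ × ℝ} {α β : ℝ}
    (hX : HasFDerivAt X (α • ContinuousLinearMap.fst ℝ ℝ ℝ + β • ContinuousLinearMap.snd ℝ ℝ ℝ)
      (p.1, Y p)) (hβ : β ≠ 0) (hY : ContinuousAt Y p)
    (h : ∀ᶠ z in 𝓝 p, X (z.1, Y z) = z.2) :
    HasFDerivAt Y (-(α * β⁻¹) • ContinuousLinearMap.fst ℝ ℝ ℝ
      + β⁻¹ • ContinuousLinearMap.snd ℝ ℝ ℝ) p := by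
  let e : (ℝ × ℝ) ≃L[ℝ] (ℝ × ℝ) := ContinuousLinearEquiv.equivOfInverse
    ((ContinuousLinearMap.fst ℝ ℝ ℝ).prod
      (α • ContinuousLinearMap.fst ℝ ℝ ℝ + β • ContinuousLinearMap.snd ℝ ℝ ℝ))
    ((ContinuousLinearMap.fst ℝ ℝ ℝ).prod (-(α * β⁻¹) • ContinuousLinearMap.fst ℝ ℝ ℝ
      + β⁻¹ • ContinuousLinearMap.snd ℝ ℝ ℝ))
    (fun z => by ext <;> simp; field_simp; ring)
    (fun z => by ext <;> simp; field_simp; ring)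
  have hΨ : HasFDerivAt (fun z : ℝ × ℝ => (z.1, X z)) (e : (ℝ × ℝ) →L[ℝ] (ℝ × ℝ)) (p.1, Y p) :=
    HasFDerivAt.prodMk hasFDerivAt_fst hX
  have hinv := HasFDerivAt.of_local_left_inverse (f := fun z : ℝ × ℝ => (z.1, X z))
    (g := fun z : ℝ × ℝ => (z.1, Y z)) (f' := e) (a := p) (continuousAt_fst.prodMk hY) hΨ (by
      filter_upwards [h] with z hz
      simp [hz])
  exact (hasFDerivAt_snd.comp p hinv)

/-- The mass coordinate of a solution of the reduced problem: `Y (t, x)` is the label of the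
material point that is at the position `x` at time `t`. -/
theorem exists_mass_coordinate {g c b M M' : ℝ → ℝ} {a H L : ℝ} (hL : 0 < L)
    (hgc : Continuous g) (hgH : ∀ y, g y ≤ H) (hc : Continuous c) (hc0 : ∀ θ, 0 ≤ c θ)
    (ha : 0 < a) (hM : ∀ t, HasDerivAt M (M' t) t) (hM0 : M 0 = 0) (hM' : ∀ t, 0 < M' t)
    (hsol : ∀ θ, ∃ r, 0 ≤ r ∧
        (∀ z ∈ Icc 0 r, a ≤ g (θ - z) + primitive c (θ - z) - primitive c θ) ∧
        ∫ z in (0 : ℝ)..r, (g (θ - z) + primitive c (θ - z) - primitive c θ)⁻¹ = L ∧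
        c θ * ∫ z in (0 : ℝ)..r, (g (θ - z) + primitive c (θ - z) - primitive c θ)⁻¹ ^ 2 = b θ) :
    ∃ Y A : ℝ × ℝ → ℝ,
      (∀ z, A z = g (Y z) + primitive c (Y z) - primitive c (M z.1)) ∧
      ContinuousOn Y {z | z.2 ∈ Icc 0 L} ∧
      (∀ z : ℝ × ℝ, z.2 ∈ Icc 0 L → a ≤ A z ∧ A z ≤ H) ∧
      (∀ t, Y (t, 0) = M t) ∧
      (∀ x ∈ Icc 0 L, ∀ y ≤ 0, ∫ s in y..(0 : ℝ), (g s)⁻¹ = x → Y (0, x) = y) ∧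
      (∀ t, 0 < t → c (M t) * ∫ x in (0 : ℝ)..L, (A (t, x))⁻¹ = b (M t)) ∧
      ∀ z : ℝ × ℝ, 0 < z.1 → z.2 ∈ Ioo 0 L → HasFDerivAt Y
        ((A z * (M' z.1 * (g (M z.1))⁻¹ + c (M z.1) * M' z.1 * ∫ x in (0 : ℝ)..z.2, (A (z.1, x))⁻¹))
          • ContinuousLinearMap.fst ℝ ℝ ℝ + (-A z) • ContinuousLinearMap.snd ℝ ℝ ℝ) z := by
  obtain ⟨q, q', hq, hq'c, hqpos, hqa⟩ := exists_inv_extension ha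
  have hqc : Continuous q := continuous_iff_continuousAt.2 fun s => (hq s).continuousAt
  have hCc := continuous_primitive hc
  have hCm := primitive_mono hc hc0
  have hMc : Continuous M := continuous_iff_continuousAt.2 fun t => (hM t).continuousAt
  have hMmono : StrictMono M := strictMono_of_deriv_pos fun t => by rw [(hM t).deriv]; exact hM' t
  set G : ℝ → ℝ := fun y => g y + primitive c y with hG
  have hGc : Continuous G := hgc.add hCc
  set P : ℝ → ℝ := fun t => primitive c (M t) with hP
  have hPc : Continuous P := hCc.comp hMc
  set W : ℝ × ℝ → ℝ := fun p => ∫ s in (0 : ℝ)..p.2, q (G s - p.1) with hW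
  have hWd := hasFDerivAt_parametric_primitive hq hq'c hGc
  have hWc : Continuous W := continuous_iff_continuousAt.2 fun p => (hWd p).continuousAt
  have hqi : ∀ κ u v, IntervalIntegrable (fun s => q (G s - κ)) volume u v := fun κ u v =>
    (by fun_prop : Continuous fun s => q (G s - κ)).intervalIntegrable _ _
  have hqi' : ∀ κ u v, IntervalIntegrable (fun s => q' (G s - κ)) volume u v := fun κ u v =>
    (by fun_prop : Continuous fun s => q' (G s - κ)).intervalIntegrable _ _
  -- the position of the material point with label `p.2` at time `p.1`
  set X : ℝ × ℝ → ℝ := fun p => W (P p.1, M p.1) - W (P p.1, p.2) with hX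
  have hXint : ∀ t y, X (t, y) = ∫ s in y..M t, q (G s - P t) := fun t y =>
    intervalIntegral.integral_interval_sub_left (hqi _ _ _) (hqi _ _ _)
  have hXc : Continuous X := by fun_prop
  have hXanti : ∀ t, StrictAnti fun y => X (t, y) := by
    intro t y₁ y₂ h
    have h1 : 0 < ∫ s in y₁..y₂, q (G s - P t) :=
      intervalIntegral.intervalIntegral_pos_of_pos (hqi _ _ _) (fun s => hqpos _) h
    have h2 := intervalIntegral.integral_add_adjacent_intervals (hqi (P t) y₁ y₂)
      (hqi (P t) y₂ (M t))
    simp only [hXint]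
    linarith
  -- the label `ρ` of the material point at the outlet
  have hlabel : ∀ t, ∃ ρ ≤ M t, (∀ s ∈ Icc ρ (M t), a ≤ G s - P t) ∧ X (t, ρ) = L ∧
      c (M t) * -∫ s in ρ..M t, q' (G s - P t) = b (M t) := by
    intro t
    obtain ⟨r, hr, hra, hrL, hrb⟩ := hsol (M t)
    have hle : M t - r ≤ M t := sub_le_self _ hr
    have hlow : ∀ s ∈ Icc (M t - r) (M t), a ≤ G s - P t := fun s hs => by
      have := hra (M t - s) ⟨sub_nonneg.2 hs.2, by linarith [hs.1]⟩
      rwa [sub_sub_cancel] at this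
    refine ⟨M t - r, hle, hlow, ?_, ?_⟩
    · rw [hXint, ← hrL, intervalIntegral.integral_comp_sub_left
        (fun s => (g s + primitive c s - primitive c (M t))⁻¹), sub_zero]
      refine intervalIntegral.integral_congr fun s hs => ?_
      rw [uIcc_of_le hle] at hs
      exact (hqa _ (hlow s hs)).1
    · rw [← hrb, intervalIntegral.integral_comp_sub_left
        (fun s => (g s + primitive c s - primitive c (M t))⁻¹ ^ 2), sub_zero,
        ← intervalIntegral.integral_neg]
      congr 1
      refine intervalIntegral.integral_congr fun s hs => ?_
      rw [uIcc_of_le hle] at hs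
      have := (hqa _ (hlow s hs)).2
      simp only [this, neg_neg]
      rfl
  have hX0 : ∀ t, X (t, M t) = 0 := fun t => by simp [hX]
  have hex : ∀ z : ℝ × ℝ, z.2 ∈ Icc 0 L → ∃ y, X (z.1, y) = z.2 ∧ y ≤ M z.1 ∧
      ∀ s ∈ Icc y (M z.1), a ≤ G s - P z.1 := by
    rintro ⟨t, x⟩ hx
    obtain ⟨ρ, hρ, hρa, hρL, -⟩ := hlabel t
    have hc1 : Continuous fun y => X (t, y) := by fun_prop
    obtain ⟨y, hy, hyx⟩ := intermediate_value_Icc' hρ hc1.continuousOn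
      (show x ∈ Icc (X (t, M t)) (X (t, ρ)) by rw [hX0, hρL]; exact hx)
    exact ⟨y, hyx, hy.2, fun s hs => hρa s ⟨hy.1.trans hs.1, hs.2⟩⟩
  choose! Y hYX hYM hYa using hex
  have hYuniq : ∀ t x y, x ∈ Icc 0 L → X (t, y) = x → Y (t, x) = y := fun t x y hx hy =>
    (hXanti t).injective ((hYX (t, x) hx).trans hy.symm)
  have hYc : ContinuousOn Y {z | z.2 ∈ Icc 0 L} := by
    intro z₀ hz₀
    refine Metric.tendsto_nhds.2 fun ε hε => ?_
    have h1 : X (z₀.1, Y z₀ + ε) < z₀.2 := by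
      have := hXanti z₀.1 (lt_add_of_pos_right (Y z₀) hε)
      simp only [hYX z₀ hz₀] at this
      exact this
    have h2 : z₀.2 < X (z₀.1, Y z₀ - ε) := by
      have := hXanti z₀.1 (sub_lt_self (Y z₀) hε)
      simp only [hYX z₀ hz₀] at this
      exact this
    have e1 : ∀ᶠ z : ℝ × ℝ in 𝓝 z₀, X (z.1, Y z₀ + ε) < z.2 :=
      (by fun_prop : Continuous fun z : ℝ × ℝ => X (z.1, Y z₀ + ε)).continuousAt.eventually_lt
        continuous_snd.continuousAt h1
    have e2 : ∀ᶠ z : ℝ × ℝ in 𝓝 z₀, z.2 < X (z.1, Y z₀ - ε) :=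
      continuous_snd.continuousAt.eventually_lt
        (by fun_prop : Continuous fun z : ℝ × ℝ => X (z.1, Y z₀ - ε)).continuousAt h2
    filter_upwards [nhdsWithin_le_nhds e1, nhdsWithin_le_nhds e2, self_mem_nhdsWithin]
      with z hz1 hz2 hz
    have hz' : X (z.1, Y z) = z.2 := hYX z hz
    rw [← hz'] at hz1 hz2
    have l1 := (hXanti z.1).lt_iff_gt.1 hz1
    have l2 := (hXanti z.1).lt_iff_gt.1 hz2
    rw [Real.dist_eq, abs_lt]
    constructor <;> linarith
  have hY0 : ∀ t, Y (t, 0) = M t := fun t => hYuniq t 0 _ ⟨le_rfl, hL.le⟩ (hX0 t)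
  set A : ℝ × ℝ → ℝ := fun z => g (Y z) + primitive c (Y z) - primitive c (M z.1) with hA
  have hAa : ∀ z : ℝ × ℝ, z.2 ∈ Icc 0 L → a ≤ A z := fun z hz =>
    hYa z hz (Y z) ⟨le_rfl, hYM z hz⟩
  have hAH : ∀ z : ℝ × ℝ, z.2 ∈ Icc 0 L → A z ≤ H := fun z hz => by
    have h1 := hCm (hYM z hz)
    have h2 := hgH (Y z)
    simp only [hA]
    linarith
  have hYc' : ∀ z : ℝ × ℝ, z.2 ∈ Ioo 0 L → ContinuousAt Y z := fun z hz =>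
    hYc.continuousAt (mem_of_superset (continuous_snd.continuousAt.preimage_mem_nhds
      (Ioo_mem_nhds hz.1 hz.2)) fun w hw => Ioo_subset_Icc_self hw)
  have hAc : ContinuousOn A {z | z.2 ∈ Icc 0 L} :=
    (hGc.comp_continuousOn hYc).sub (hPc.comp continuous_fst).continuousOn
  have hYd : ∀ z : ℝ × ℝ, 0 < z.1 → z.2 ∈ Ioo 0 L → HasFDerivAt Y
        ((A z * (M' z.1 * (g (M z.1))⁻¹ + c (M z.1) * M' z.1 *
          -∫ s in Y z..M z.1, q' (G s - P z.1))) • ContinuousLinearMap.fst ℝ ℝ ℝ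
          + (-A z) • ContinuousLinearMap.snd ℝ ℝ ℝ) z := by
    intro z hz1 hz2
    have hz2' := Ioo_subset_Icc_self hz2
    have hMz : 0 < M z.1 := hM0 ▸ hMmono hz1
    have hPd : HasDerivAt P (c (M z.1) * M' z.1) z.1 :=
      (hasDerivAt_primitive hc hMz).comp z.1 (hM z.1)
    have hd1 : HasFDerivAt (fun p : ℝ × ℝ => P p.1)
        ((c (M z.1) * M' z.1) • ContinuousLinearMap.fst ℝ ℝ ℝ) (z.1, Y z) :=
      HasDerivAt.comp_hasFDerivAt (h₂ := P) (f := Prod.fst) (z.1, Y z) hPd hasFDerivAt_fst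
    have hd2 : HasFDerivAt (fun p : ℝ × ℝ => M p.1)
        (M' z.1 • ContinuousLinearMap.fst ℝ ℝ ℝ) (z.1, Y z) :=
      HasDerivAt.comp_hasFDerivAt (h₂ := M) (f := Prod.fst) (z.1, Y z) (hM z.1) hasFDerivAt_fst
    have hX1 := (hWd (P z.1, M z.1)).comp (z.1, Y z)
      (f := fun p : ℝ × ℝ => (P p.1, M p.1)) (hd1.prodMk hd2)
    have hX2 := (hWd (P z.1, Y z)).comp (z.1, Y z)
      (f := fun p : ℝ × ℝ => (P p.1, p.2)) (hd1.prodMk hasFDerivAt_snd)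
    have hA1 : 0 < A z := ha.trans_le (hAa z hz2')
    have hqA : q (G (Y z) - P z.1) = (A z)⁻¹ := (hqa _ (hAa z hz2')).1
    have hgM : q (G (M z.1) - P z.1) = (g (M z.1))⁻¹ := by
      have h1 : G (M z.1) - P z.1 = g (M z.1) := by simp [hG, hP]
      have h2 := hYa z hz2' (M z.1) ⟨hYM z hz2', le_rfl⟩
      rw [(hqa _ h2).1, h1]
    have hXd : HasFDerivAt X
        ((M' z.1 * (g (M z.1))⁻¹ + c (M z.1) * M' z.1 * -∫ s in Y z..M z.1, q' (G s - P z.1))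
          • ContinuousLinearMap.fst ℝ ℝ ℝ + (-(A z)⁻¹) • ContinuousLinearMap.snd ℝ ℝ ℝ)
        (z.1, Y z) := by
      have hsub := hX1.sub hX2
      refine hsub.congr_fderiv ?_
      have e : ∫ s in Y z..M z.1, q' (G s - P z.1) = (∫ s in (0 : ℝ)..M z.1, q' (G s - P z.1))
          - ∫ s in (0 : ℝ)..Y z, q' (G s - P z.1) :=
        (intervalIntegral.integral_interval_sub_left (hqi' _ _ _) (hqi' _ _ _)).symm
      rw [e]
      ext <;> simp [hqA, hgM]; ring
    have h := hasFDerivAt_of_implicit hXd (neg_ne_zero.2 (inv_ne_zero hA1.ne')) (hYc' z hz2) (by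
      filter_upwards [continuous_snd.continuousAt.preimage_mem_nhds (Ioo_mem_nhds hz2.1 hz2.2)]
        with w hw using hYX w (Ioo_subset_Icc_self hw))
    refine h.congr_fderiv ?_
    rw [inv_neg, inv_inv]
    congr 2
    ring
  have hJ : ∀ t, 0 < t → ∀ x ∈ Icc 0 L, ∫ x' in (0 : ℝ)..x, (A (t, x'))⁻¹
      = -∫ s in Y (t, x)..M t, q' (G s - P t) := by
    intro t ht x hx
    have hI : ∀ y, HasDerivAt (fun y => -∫ s in y..M t, q' (G s - P t)) (q' (G y - P t)) y := by
      intro y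
      have hcont : Continuous fun s => q' (G s - P t) := by fun_prop
      have := ((hcont.integral_hasStrictDerivAt (M t) y).hasDerivAt)
      simpa only [intervalIntegral.integral_symm (M t), neg_neg] using this
    have hsub : ∀ x' ∈ Icc 0 x, x' ∈ Icc 0 L := fun x' hx' => ⟨hx'.1, hx'.2.trans hx.2⟩
    have hslice : ContinuousOn (fun x' => Y (t, x')) (Icc 0 x) :=
      hYc.comp (Continuous.prodMk_right t).continuousOn fun x' hx' => hsub x' hx'
    have hAslice : ContinuousOn (fun x' => (A (t, x'))⁻¹) (Icc 0 x) :=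
      (hAc.comp (Continuous.prodMk_right t).continuousOn fun x' hx' => hsub x' hx').inv₀
        fun x' hx' => (ha.trans_le (hAa (t, x') (hsub x' hx'))).ne'
    have h := intervalIntegral.integral_eq_sub_of_hasDerivAt_of_le hx.1
      (f := fun x' => -∫ s in Y (t, x')..M t, q' (G s - P t)) (f' := fun x' => (A (t, x'))⁻¹) ?_
      (fun x' hx' => ?_) (by rw [← uIcc_of_le hx.1] at hAslice; exact hAslice.intervalIntegrable)
    · rw [h, hY0]
      simp
    · exact (continuous_iff_continuousAt.2 fun y => (hI y).continuousAt).comp_continuousOn hslice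
    · have hx'L : x' ∈ Ioo 0 L := ⟨hx'.1, hx'.2.trans_le hx.2⟩
      have h1 : HasDerivAt (fun x' => (t, x')) ((0 : ℝ), (1 : ℝ)) x' :=
        (hasDerivAt_const x' t).prodMk (hasDerivAt_id x')
      have h2 := (hYd (t, x') ht hx'L).comp_hasDerivAt x' h1
      have h3 := (hI (Y (t, x'))).comp x' h2
      have hpos := ha.trans_le (hAa (t, x') (Ioo_subset_Icc_self hx'L))
      have h4 : q' (G (Y (t, x')) - P t) = -(A (t, x'))⁻¹ ^ 2 :=
        (hqa _ (hAa (t, x') (Ioo_subset_Icc_self hx'L))).2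
      refine h3.congr_deriv ?_
      rw [h4]
      simp
      field_simp
  refine ⟨Y, A, fun z => rfl, hYc, fun z hz => ⟨hAa z hz, hAH z hz⟩, hY0, ?_, ?_, ?_⟩
  · intro x hx y hy hyx
    refine hYuniq 0 x y hx ?_
    rw [hXint, hM0, ← hyx]
    refine intervalIntegral.integral_congr fun s hs => ?_
    rw [uIcc_of_le hy] at hs
    have hga : a ≤ g s := by
      obtain ⟨r, hr, hra, -⟩ := hsol s
      simpa using hra 0 ⟨le_rfl, hr⟩
    have e : G s - P 0 = g s := by
      simp [hG, hP, hM0, primitive_of_nonpos c hs.2, primitive_of_nonpos c le_rfl]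
    simp only [e]
    exact (hqa _ hga).1
  · intro t ht
    obtain ⟨ρ, -, -, hρL, hρb⟩ := hlabel t
    rw [hJ t ht L ⟨hL.le, le_rfl⟩, hYuniq t L ρ ⟨hL.le, le_rfl⟩ hρL, hρb]
  · intro z hz1 hz2
    rw [hJ z.1 hz1 z.2 (Ioo_subset_Icc_self hz2)]
    exact hYd z hz1 hz2

/-! ### The space-time rectangle -/

theorem isBounded_Qbar (T L : ℝ) : Bornology.IsBounded (Qbar T L) :=
  (isCompact_Icc.prod isCompact_Icc).isBounded

theorem Q_subset_Qbar (T L : ℝ) : Q T L ⊆ Qbar T L :=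
  prod_mono Ioo_subset_Icc_self Ioo_subset_Icc_self

theorem isBounded_Q (T L : ℝ) : Bornology.IsBounded (Q T L) :=
  (isBounded_Qbar T L).subset (Q_subset_Qbar T L)

theorem isOpen_Q (T L : ℝ) : IsOpen (Q T L) := isOpen_Ioo.prod isOpen_Ioo

theorem convex_Q (T L : ℝ) : Convex ℝ (Q T L) := (convex_Ioo 0 T).prod (convex_Ioo 0 L)

theorem closure_Q {T L : ℝ} (hT : 0 < T) (hL : 0 < L) : closure (Q T L) = Qbar T L := by
  rw [Q, Qbar, closure_prod_eq, closure_Ioo hT.ne, closure_Ioo hL.ne]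

theorem isLipOn_fst {f : ℝ → ℝ} {s : Set ℝ} {r : Set (ℝ × ℝ)} (hf : IsLipOn f s)
    (h : ∀ z ∈ r, z.1 ∈ s) : IsLipOn (fun z : ℝ × ℝ => f z.1) r :=
  hf.comp (LipschitzWith.prod_fst.lipschitzOnWith) h

/-- The primitive in the space variable of a Lipschitz function is Lipschitz in both variables. -/
theorem IsLipOn.integral_snd {T L : ℝ} {f : ℝ × ℝ → ℝ}
    (hf : IsLipOn f (Qbar T L)) :
    IsLipOn (fun z : ℝ × ℝ => ∫ x in (0 : ℝ)..z.2, f (z.1, x)) (Qbar T L) := by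
  obtain ⟨K, hK0, hK⟩ := hf.exists_bound
  obtain ⟨B, hB0, hB⟩ := hf.exists_abs_le (isBounded_Qbar T L)
  have hint : ∀ t ∈ Icc 0 T, ∀ x ∈ Icc 0 L, ∀ y ∈ Icc 0 L,
      IntervalIntegrable (fun x => f (t, x)) volume x y := by
    intro t ht x hx y hy
    refine ContinuousOn.intervalIntegrable ?_
    exact hf.continuousOn.comp (Continuous.prodMk_right t).continuousOn fun u hu =>
      ⟨ht, (uIcc_subset_Icc hx hy) hu⟩
  refine IsLipOn.of_bound (K := L * K + B) ?_
  rintro ⟨t, x⟩ ⟨ht, hx⟩ ⟨t', x'⟩ ⟨ht', hx'⟩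
  dsimp only at ht hx ht' hx' ⊢
  have h0 : (0 : ℝ) ∈ Icc 0 L := ⟨le_rfl, hx.1.trans hx.2⟩
  have e : (∫ u in (0 : ℝ)..x, f (t, u)) - ∫ u in (0 : ℝ)..x', f (t', u)
      = (∫ u in (0 : ℝ)..x, (f (t, u) - f (t', u))) + ∫ u in x'..x, f (t', u) := by
    rw [intervalIntegral.integral_sub (hint t ht 0 h0 x hx) (hint t' ht' 0 h0 x hx),
      ← intervalIntegral.integral_add_adjacent_intervals (hint t' ht' 0 h0 x' hx')
        (hint t' ht' x' hx' x hx)]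
    ring
  have h1 : |∫ u in (0 : ℝ)..x, (f (t, u) - f (t', u))| ≤ K * dist t t' * |x - 0| := by
    rw [← Real.norm_eq_abs]
    refine intervalIntegral.norm_integral_le_of_norm_le_const fun u hu => ?_
    have hu' := uIcc_subset_Icc h0 hx (uIoc_subset_uIcc hu)
    refine (hK (t, u) ⟨ht, hu'⟩ (t', u) ⟨ht', hu'⟩).trans ?_
    simp [Prod.dist_eq]
  have h2 : |∫ u in x'..x, f (t', u)| ≤ B * |x - x'| := by
    rw [← Real.norm_eq_abs]
    exact intervalIntegral.norm_integral_le_of_norm_le_const fun u hu =>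
      hB (t', u) ⟨ht', uIcc_subset_Icc hx' hx (uIoc_subset_uIcc hu)⟩
  rw [e, sub_zero, abs_of_nonneg hx.1] at *
  have d1 : dist t t' ≤ dist (t, x) (t', x') := le_max_left _ _
  have d2 : |x - x'| ≤ dist (t, x) (t', x') := le_max_right (dist t t') (dist x x')
  refine (abs_add_le _ _).trans ?_
  have hd : 0 ≤ dist t t' := dist_nonneg
  calc _ ≤ K * dist t t' * x + B * |x - x'| := add_le_add h1 h2
    _ ≤ K * dist (t, x) (t', x') * L + B * dist (t, x) (t', x') := by
        gcongr
        exacts [hx.1, hx.2]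
    _ = _ := by ring

theorem hasLineDerivAt_dx {f : ℝ × ℝ → ℝ} {z : ℝ × ℝ} {f' : ℝ}
    (h : HasDerivAt (fun x => f (z.1, x)) f' z.2) : HasLineDerivAt ℝ f f' z dx := by
  have h1 : HasDerivAt (fun s : ℝ => z.2 + s) 1 0 := by
    simpa using (hasDerivAt_id (0 : ℝ)).const_add z.2
  have h2 := HasDerivAt.comp (h₂ := fun x => f (z.1, x)) (h := fun s => z.2 + s) (0 : ℝ)
    (by simpa using h) h1
  rw [mul_one] at h2
  refine HasDerivAt.congr_of_eventuallyEq h2 (Eventually.of_forall fun s => ?_)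
  have e : z + s • dx = (z.1, z.2 + s) := by ext <;> simp [dx]
  simp only [e, Function.comp_apply]

/-! ### Existence -/

/-- The primitive of a continuous function `s ≥ m > 0` is a bijection of the line whose inverse is
Lipschitz. -/
theorem exists_inverse_of_integral {s : ℝ → ℝ} (hs : Continuous s) {m : ℝ} (hm : 0 < m)
    (hsm : ∀ t, m ≤ s t) :
    ∃ τ : ℝ → ℝ, (∀ t, τ (∫ u in (0 : ℝ)..t, s u) = t) ∧ (∀ y, ∫ u in (0 : ℝ)..τ y, s u = y) ∧
      LipschitzWith m⁻¹.toNNReal τ := by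
  set M : ℝ → ℝ := fun t => ∫ u in (0 : ℝ)..t, s u with hM
  have hsi : ∀ a b, IntervalIntegrable s volume a b := fun a b => hs.intervalIntegrable a b
  have hexp : ∀ x y, x ≤ y → m * (y - x) ≤ M y - M x := by
    intro x y hxy
    have h1 : M y - M x = ∫ u in x..y, s u :=
      intervalIntegral.integral_interval_sub_left (hsi _ _) (hsi _ _)
    have h2 : ∫ _ in x..y, m ≤ ∫ u in x..y, s u :=
      intervalIntegral.integral_mono_on hxy (by simp) (hsi _ _) fun u _ => hsm u
    rw [intervalIntegral.integral_const, smul_eq_mul] at h2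
    rw [h1]
    linarith
  have habs : ∀ x y, m * |x - y| ≤ |M x - M y| := by
    intro x y
    rcases le_total x y with h | h
    · rw [abs_sub_comm x, abs_sub_comm (M x), abs_of_nonneg (sub_nonneg.2 h)]
      exact (hexp x y h).trans (le_abs_self _)
    · rw [abs_of_nonneg (sub_nonneg.2 h)]
      exact (hexp y x h).trans (le_abs_self _)
  have hM0 : M 0 = 0 := by simp [hM]
  have hMc : Continuous M := intervalIntegral.continuous_primitive hsi 0
  have htop : Tendsto M atTop atTop := by
    refine tendsto_atTop_mono' _ ?_ (tendsto_id.const_mul_atTop hm)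
    filter_upwards [eventually_ge_atTop 0] with t ht
    have := hexp 0 t ht
    rw [hM0, sub_zero, sub_zero] at this
    exact this
  have hbot : Tendsto M atBot atBot := by
    refine tendsto_atBot_mono' _ ?_ (tendsto_id.const_mul_atBot hm)
    filter_upwards [eventually_le_atBot 0] with t ht
    have := hexp t 0 ht
    rw [hM0, id_eq] at *
    linarith
  choose τ hτ using hMc.surjective htop hbot
  have hinj : ∀ x y, M x = M y → x = y := by
    intro x y h
    have h1 := habs x y
    rw [h, sub_self, abs_zero] at h1
    have h2 := abs_nonneg (x - y)
    have h3 : |x - y| = 0 := by nlinarith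
    exact sub_eq_zero.1 (abs_eq_zero.1 h3)
  refine ⟨τ, fun t => hinj _ _ (hτ _), hτ, LipschitzWith.of_dist_le_mul fun x y => ?_⟩
  rw [Real.coe_toNNReal _ (inv_pos.2 hm).le, Real.dist_eq, Real.dist_eq, inv_mul_eq_div,
    le_div_iff₀ hm, mul_comm]
  have := habs (τ x) (τ y)
  rwa [hτ, hτ] at this

/-- Existence for Lipschitz data. -/
theorem exists_strongSolution {μ T L : ℝ} (hT : 0 < T) (hL : 0 < L)
    {S₀ S₁ vin vL : ℝ → ℝ} {v_m V_M S_m S_M : ℝ} (hvm : 0 < v_m)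
    (hv : ∀ t ∈ Icc 0 T, v_m ≤ vin t ∧ vin t ≤ vL t ∧ vL t ≤ V_M) (hSm : 0 < S_m)
    (hS₀ : ∀ t ∈ Icc 0 T, S_m ≤ S₀ t ∧ S₀ t ≤ S_M)
    (hS₁ : ∀ x ∈ Icc 0 L, S_m ≤ S₁ x ∧ S₁ x ≤ S_M) (hcorner : S₀ 0 = S₁ 0)
    (hS₀l : IsLipOn S₀ (Icc 0 T)) (hS₁l : IsLipOn S₁ (Icc 0 L))
    (hvinl : IsLipOn vin (Icc 0 T)) (hvLl : IsLipOn vL (Icc 0 T)) :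
    ∃ A v : ℝ × ℝ → ℝ, IsStrongSolution μ T L S₀ S₁ vin vL A v ∧
      ∃ A_m : ℝ, 0 < A_m ∧ ∀ z ∈ Qbar T L, A_m ≤ A z := by
  have hmM : S_m ≤ S_M := (hS₀ 0 ⟨le_rfl, hT.le⟩).1.trans (hS₀ 0 ⟨le_rfl, hT.le⟩).2
  have hSM : 0 < S_M := hSm.trans_le hmM
  have hVM : 0 < V_M := by
    have := hv 0 ⟨le_rfl, hT.le⟩
    linarith
  -- the data are extended by constants beyond the end points
  set pT : ℝ → ℝ := fun t => (projIcc 0 T hT.le t : ℝ) with hpT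
  set pL : ℝ → ℝ := fun x => (projIcc 0 L hL.le x : ℝ) with hpL
  have pT_mem : ∀ t, pT t ∈ Icc 0 T := fun t => (projIcc 0 T hT.le t).2
  have pL_mem : ∀ t, pL t ∈ Icc 0 L := fun t => (projIcc 0 L hL.le t).2
  have pT_eq : ∀ t ∈ Icc 0 T, pT t = t := fun t ht => by simp [hpT, projIcc_of_mem hT.le ht]
  have pL_eq : ∀ t ∈ Icc 0 L, pL t = t := fun t ht => by simp [hpL, projIcc_of_mem hL.le ht]
  have pT_lip : LipschitzWith 1 pT := LipschitzWith.projIcc hT.le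
  have pL_lip : LipschitzWith 1 pL := LipschitzWith.projIcc hL.le
  have extT : ∀ f, IsLipOn f (Icc 0 T) → IsLipOn (fun t => f (pT t)) univ := fun f hf =>
    hf.comp pT_lip.lipschitzOnWith fun t _ => pT_mem t
  have s0l := extT _ hS₀l
  have vil := extT _ hvinl
  have vLl := extT _ hvLl
  have s1l : IsLipOn (fun t => S₁ (pL t)) univ :=
    hS₁l.comp pL_lip.lipschitzOnWith fun t _ => pL_mem t
  have s0c := continuousOn_univ.1 s0l.continuousOn
  have vic := continuousOn_univ.1 vil.continuousOn
  have vLc := continuousOn_univ.1 vLl.continuousOn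
  have s1c := continuousOn_univ.1 s1l.continuousOn
  -- the mass that has entered
  set M' : ℝ → ℝ := fun t => S₀ (pT t) * vin (pT t) with hM'def
  have hM'c : Continuous M' := s0c.mul vic
  have hM'low : ∀ t, S_m * v_m ≤ M' t := fun t =>
    mul_le_mul (hS₀ _ (pT_mem t)).1 (hv _ (pT_mem t)).1 hvm.le
      (hSm.le.trans (hS₀ _ (pT_mem t)).1)
  have hMm : 0 < S_m * v_m := mul_pos hSm hvm
  have hM'pos : ∀ t, 0 < M' t := fun t => hMm.trans_le (hM'low t)
  have hM'up : ∀ t, M' t ≤ S_M * V_M := fun t =>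
    mul_le_mul (hS₀ _ (pT_mem t)).2 ((hv _ (pT_mem t)).2.1.trans (hv _ (pT_mem t)).2.2)
      (hvm.le.trans (hv _ (pT_mem t)).1) hSM.le
  set M : ℝ → ℝ := fun t => ∫ u in (0 : ℝ)..t, M' u with hMdef
  have hMd : ∀ t, HasDerivAt M (M' t) t := fun t => (hM'c.integral_hasStrictDerivAt 0 t).hasDerivAt
  have hM0 : M 0 = 0 := by simp [hMdef]
  have hMmono : StrictMono M :=
    strictMono_of_deriv_pos fun t => by rw [(hMd t).deriv]; exact hM'pos t
  have hMnn : ∀ t, 0 ≤ t → 0 ≤ M t := fun t ht => hM0 ▸ hMmono.monotone ht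
  obtain ⟨τ, hτM, -, hτl⟩ := exists_inverse_of_integral hM'c hMm hM'low
  obtain ⟨σ, hσN, -, hσl⟩ := exists_inverse_of_integral s1c hSm fun x => (hS₁ _ (pL_mem x)).1
  have hτ0 : τ 0 = 0 := by
    have := hτM 0
    rwa [intervalIntegral.integral_same] at this
  have hσ0 : σ 0 = 0 := by
    have := hσN 0
    rwa [intervalIntegral.integral_same] at this
  have pT0 : pT 0 = 0 := pT_eq 0 ⟨le_rfl, hT.le⟩
  have pL0 : pL 0 = 0 := pL_eq 0 ⟨le_rfl, hL.le⟩
  -- the value of the cross-section on the material point with label `y`, before thinning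
  set g : ℝ → ℝ := fun y => S₀ (pT (τ (max y 0))) + S₁ (pL (σ (max (-y) 0))) - S₀ 0 with hg
  have hg_pos : ∀ y, 0 ≤ y → g y = S₀ (pT (τ y)) := fun y hy => by
    simp [hg, max_eq_left hy, max_eq_right (neg_nonpos.2 hy), hσ0, pL0, hcorner]
  have hg_neg : ∀ y, y ≤ 0 → g y = S₁ (pL (σ (-y))) := fun y hy => by
    simp [hg, max_eq_right hy, max_eq_left (neg_nonneg.2 hy), hτ0, pT0]
  have hgb : ∀ y, S_m ≤ g y ∧ g y ≤ S_M := fun y => by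
    rcases le_total 0 y with h | h
    · rw [hg_pos y h]
      exact hS₀ _ (pT_mem _)
    · rw [hg_neg y h]
      exact hS₁ _ (pL_mem _)
  have hgl : IsLipOn g univ := by
    have h1 : LipschitzWith _ fun y : ℝ => max y 0 := LipschitzWith.id.max_const 0
    have h2 : LipschitzWith _ fun y : ℝ => max (-y) 0 := LipschitzWith.id.neg.max_const 0
    exact ((s0l.comp (hτl.comp h1).lipschitzOnWith (mapsTo_univ _ _)).add
      (s1l.comp (hσl.comp h2).lipschitzOnWith (mapsTo_univ _ _))).sub (IsLipOn.const _)
  have hgc : Continuous g := continuousOn_univ.1 hgl.continuousOn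
  obtain ⟨k, hk0, hk⟩ := hgl.exists_bound
  -- the velocity difference divided by the rate of inflow, since the reduced time is the mass
  set b : ℝ → ℝ := fun θ => (vL (pT (τ θ)) - vin (pT (τ θ))) / M' (τ θ) with hb
  have hbc : Continuous b :=
    ((vLc.comp hτl.continuous).sub (vic.comp hτl.continuous)).div (hM'c.comp hτl.continuous)
      fun θ => (hM'pos _).ne'
  have hb0 : ∀ θ, 0 ≤ b θ := fun θ =>
    div_nonneg (sub_nonneg.2 (hv _ (pT_mem _)).2.1) (hM'pos _).le
  have hbB : ∀ θ, b θ ≤ V_M / (S_m * v_m) := fun θ => by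
    have h := hv _ (pT_mem (τ θ))
    exact div_le_div₀ hVM.le (by linarith) hMm (hM'low _)
  obtain ⟨c, a, ha, hc, hcB, hsol⟩ := exists_reduced_solution (k := k) hk0
    (fun x y => hk x (mem_univ _) y (mem_univ _)) hgb hbc hb0 hbB hSm hL
  obtain ⟨Y, A, hAY, hYc, hAb, hY0, hYinit, hflux, hYd⟩ := exists_mass_coordinate hL hgc
    (fun y => (hgb y).2) hc (fun θ => (hcB θ).1) ha hMd hM0 hM'pos hsol
  set Bc : ℝ := V_M / (S_m * v_m) * S_M / L with hBc
  have hBc0 : 0 ≤ Bc := (hcB 0).1.trans (hcB 0).2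
  have hAb' : ∀ z ∈ Qbar T L, a ≤ A z ∧ A z ≤ S_M := fun z hz => hAb z hz.2
  have hApos : ∀ z ∈ Qbar T L, 0 < A z := fun z hz => ha.trans_le (hAb' z hz).1
  have hQ := Q_subset_Qbar T L
  have hQb := isBounded_Q T L
  have hQo := isOpen_Q T L
  have hgM : ∀ t ∈ Icc 0 T, g (M t) = S₀ t := fun t ht => by
    rw [hg_pos _ (hMnn t ht.1), hτM, pT_eq t ht]
  -- the velocity
  set ct : ℝ → ℝ := fun t => c (M t) * M' t with hct
  have hMc : Continuous M := continuous_iff_continuousAt.2 fun t => (hMd t).continuousAt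
  have hctc : Continuous ct := (hc.comp hMc).mul hM'c
  have hct0 : ∀ t, 0 ≤ ct t := fun t => mul_nonneg (hcB _).1 (hM'pos t).le
  have hctB : ∀ t, ct t ≤ Bc * (S_M * V_M) := fun t =>
    mul_le_mul (hcB _).2 (hM'up t) (hM'pos t).le hBc0
  set J : ℝ × ℝ → ℝ := fun z => ∫ x in (0 : ℝ)..z.2, (A (z.1, x))⁻¹ with hJ
  set v : ℝ × ℝ → ℝ := fun z => vin (pT z.1) + ct z.1 * J z with hvdef
  have hYd' : ∀ z ∈ Q T L, HasFDerivAt Y ((A z * v z) • ContinuousLinearMap.fst ℝ ℝ ℝ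
      + (-A z) • ContinuousLinearMap.snd ℝ ℝ ℝ) z := by
    intro z hz
    have ht : z.1 ∈ Icc 0 T := Ioo_subset_Icc_self hz.1
    have h := hYd z hz.1.1 hz.2
    have e : M' z.1 * (g (M z.1))⁻¹ = vin (pT z.1) := by
      have := (hSm.trans_le (hS₀ _ ht).1).ne'
      rw [hgM z.1 ht, hM'def]
      simp only [pT_eq z.1 ht]
      field_simp
    rw [e] at h
    exact h
  have hAcont : ContinuousOn A {z | z.2 ∈ Icc 0 L} := by
    have hCc := continuous_primitive hc
    have : ContinuousOn (fun z => g (Y z) + primitive c (Y z) - primitive c (M z.1))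
        {z | z.2 ∈ Icc 0 L} :=
      ((hgc.add hCc).comp_continuousOn hYc).sub (hCc.comp (hMc.comp continuous_fst)).continuousOn
    exact this.congr fun z _ => hAY z
  have hslice : ∀ t, ContinuousOn (fun x => (A (t, x))⁻¹) (Icc 0 L) := fun t =>
    (hAcont.comp (Continuous.prodMk_right t).continuousOn fun x hx => hx).inv₀
      fun x hx => (ha.trans_le (hAb (t, x) hx).1).ne'
  have hJb : ∀ z ∈ Qbar T L, 0 ≤ J z ∧ J z ≤ a⁻¹ * L := by
    intro z hz
    have hsub : uIcc 0 z.2 ⊆ Icc 0 L := by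
      rw [uIcc_of_le hz.2.1]
      exact Icc_subset_Icc_right hz.2.2
    have hi : IntervalIntegrable (fun x => (A (z.1, x))⁻¹) volume 0 z.2 :=
      ((hslice z.1).mono hsub).intervalIntegrable
    have hmem : ∀ x ∈ Icc 0 z.2, (z.1, x) ∈ Qbar T L := fun x hx =>
      ⟨hz.1, hx.1, hx.2.trans hz.2.2⟩
    refine ⟨intervalIntegral.integral_nonneg hz.2.1 fun x hx =>
      (inv_pos.2 (hApos _ (hmem x hx))).le, ?_⟩
    have h1 : J z ≤ ∫ _ in (0 : ℝ)..z.2, a⁻¹ :=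
      intervalIntegral.integral_mono_on hz.2.1 hi (by simp) fun x hx =>
        inv_anti₀ ha (hAb' _ (hmem x hx)).1
    rw [intervalIntegral.integral_const, smul_eq_mul, sub_zero, mul_comm] at h1
    exact h1.trans (mul_le_mul_of_nonneg_left hz.2.2 (inv_pos.2 ha).le)
  have hYl : IsLipOn Y (Qbar T L) := by
    have h1 : IsLipOn Y (Q T L) := by
      refine IsLipOn.of_bound (K := S_M * (V_M + Bc * (S_M * V_M) * (a⁻¹ * L)) + S_M)
        fun x hx y hy => ?_
      rw [dist_comm, dist_eq_norm, abs_sub_comm]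
      refine (convex_Q T L).norm_image_sub_le_of_norm_hasFDerivWithin_le
        (fun z hz => (hYd' z hz).hasFDerivWithinAt) (fun z hz => ?_) hx hy
      have hA := hAb' z (hQ hz)
      have hA0 := (hApos z (hQ hz)).le
      have hv0 := hv (pT z.1) (pT_mem _)
      have hvnn : 0 ≤ v z :=
        add_nonneg (hvm.le.trans hv0.1) (mul_nonneg (hct0 _) (hJb z (hQ hz)).1)
      have hvb : v z ≤ V_M + Bc * (S_M * V_M) * (a⁻¹ * L) :=
        add_le_add (hv0.2.1.trans hv0.2.2)
          (mul_le_mul (hctB _) (hJb z (hQ hz)).2 (hJb z (hQ hz)).1 (by positivity))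
      refine (norm_add_le _ _).trans (add_le_add ?_ ?_)
      · rw [norm_smul, Real.norm_eq_abs, abs_of_nonneg (mul_nonneg hA0 hvnn)]
        calc A z * v z * ‖ContinuousLinearMap.fst ℝ ℝ ℝ‖ ≤ A z * v z * 1 := by
              gcongr
              exact ContinuousLinearMap.norm_fst_le ..
          _ ≤ _ := by
              rw [mul_one]
              exact mul_le_mul hA.2 hvb hvnn hSM.le
      · rw [norm_smul, norm_neg, Real.norm_eq_abs, abs_of_nonneg hA0]
        calc A z * ‖ContinuousLinearMap.snd ℝ ℝ ℝ‖ ≤ A z * 1 := by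
              gcongr
              exact ContinuousLinearMap.norm_snd_le ..
          _ ≤ S_M := by rw [mul_one]; exact hA.2
    rw [← closure_Q hT hL]
    exact h1.closure (hYc.mono (by rw [closure_Q hT hL]; exact fun z hz => hz.2))
  have hCl : IsLipOn (primitive c) univ := IsLipOn.of_bound (K := Bc) fun x _ y _ =>
    abs_primitive_sub_le_mul hc hcB x y
  have hMl : IsLipOn M univ := by
    refine IsLipOn.of_bound (K := S_M * V_M) fun x _ y _ => ?_
    have h : M x - M y = ∫ u in y..x, M' u := intervalIntegral.integral_interval_sub_left
      (hM'c.intervalIntegrable _ _) (hM'c.intervalIntegrable _ _)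
    rw [h]
    exact intervalIntegral.norm_integral_le_of_norm_le_const fun u _ => by
      rw [Real.norm_eq_abs, abs_of_pos (hM'pos u)]
      exact hM'up u
  have hAl : IsLipOn A (Qbar T L) := by
    obtain ⟨KY, hKY⟩ := hYl
    obtain ⟨KM, hKM⟩ := hMl
    have h1 := (hgl.comp hKY (mapsTo_univ _ _)).add (hCl.comp hKY (mapsTo_univ _ _))
    have h2 : IsLipOn (fun z : ℝ × ℝ => primitive c (M z.1)) (Qbar T L) :=
      isLipOn_fst (f := fun t => primitive c (M t)) (s := univ) (hCl.comp hKM (mapsTo_univ _ _))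
        fun _ _ => mem_univ _
    exact (h1.sub h2).congr fun z _ => hAY z
  have hAinv : IsLipOn (fun z => (A z)⁻¹) (Qbar T L) := hAl.inv ha fun z hz => (hAb' z hz).1
  have hJl : IsLipOn J (Qbar T L) := hAinv.integral_snd
  -- `ct` is Lipschitz because it is the quotient `(v_L - v_in) / ∫ 1/A` of Lipschitz functions
  have hctl : IsLipOn ct (Ioo 0 T) := by
    have h1 : IsLipOn (fun t => J (t, L)) (Ioo 0 T) :=
      hJl.comp (LipschitzWith.prodMk_right L).lipschitzOnWith fun t ht =>
        ⟨Ioo_subset_Icc_self ht, hL.le, le_rfl⟩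
    have h2 : ∀ t ∈ Ioo 0 T, S_M⁻¹ * L ≤ J (t, L) := by
      intro t ht
      have hmem : ∀ x ∈ Icc 0 L, (t, x) ∈ Qbar T L := fun x hx => ⟨Ioo_subset_Icc_self ht, hx⟩
      have h3 : ∫ _ in (0 : ℝ)..L, S_M⁻¹ ≤ J (t, L) := by
        refine intervalIntegral.integral_mono_on hL.le (by simp) ?_ fun x hx =>
          inv_anti₀ (hApos _ (hmem x hx)) (hAb' _ (hmem x hx)).2
        exact ContinuousOn.intervalIntegrable (by rw [uIcc_of_le hL.le]; exact hslice t)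
      rwa [intervalIntegral.integral_const, smul_eq_mul, sub_zero, mul_comm] at h3
    have h3 : IsLipOn (fun t => (vL t - vin t) * (J (t, L))⁻¹) (Ioo 0 T) :=
      ((hvLl.sub hvinl).mono Ioo_subset_Icc_self).mul (h1.inv (by positivity) h2)
        (isBounded_Ioo 0 T)
    refine h3.congr fun t ht => ?_
    have hJpos : 0 < J (t, L) := (by positivity : 0 < S_M⁻¹ * L).trans_le (h2 t ht)
    have h4 := hflux t ht.1
    have h5 : b (M t) = (vL t - vin t) / M' t := by
      simp only [hb, hMdef, hτM, pT_eq t (Ioo_subset_Icc_self ht)]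
    rw [h5, eq_div_iff (hM'pos t).ne'] at h4
    have h6 : vL t - vin t = ct t * J (t, L) := by
      rw [← h4]
      simp only [hct, hJ]
      ring
    simp only [h6]
    field_simp
  have hctl' : IsLipOn (fun z : ℝ × ℝ => ct z.1) (Q T L) := isLipOn_fst hctl fun z hz => hz.1
  have hvl : IsLipOn v (Q T L) :=
    (isLipOn_fst vil fun _ _ => mem_univ _).add (hctl'.mul (hJl.mono hQ) hQb)
  set vx : ℝ × ℝ → ℝ := fun z => ct z.1 * (A z)⁻¹ with hvx
  have hvxl : IsLipOn vx (Q T L) := hctl'.mul (hAinv.mono hQ) hQb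
  have hvc : ContinuousOn v (Qbar T L) :=
    (vic.comp continuous_fst).continuousOn.add
      ((hctc.comp continuous_fst).continuousOn.mul hJl.continuousOn)
  have hvxw : HasWeakDeriv (Q T L) dx v vx := by
    refine hasWeakDeriv_of_lipschitzOnWith hQo hvl.choose_spec fun z hz => hasLineDerivAt_dx ?_
    have hnhds : Icc 0 L ∈ 𝓝 z.2 := Icc_mem_nhds hz.2.1 hz.2.2
    have h1 : HasDerivAt (fun x => ∫ x' in (0 : ℝ)..x, (A (z.1, x'))⁻¹) (A z)⁻¹ z.2 := by
      refine intervalIntegral.integral_hasDerivAt_right ?_ ?_ ((hslice z.1).continuousAt hnhds)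
      · refine ((hslice z.1).mono ?_).intervalIntegrable
        rw [uIcc_of_le hz.2.1.le]
        exact Icc_subset_Icc_right hz.2.2.le
      · exact ((hslice z.1).mono Ioo_subset_Icc_self).stronglyMeasurableAtFilter isOpen_Ioo z.2 hz.2
    exact (h1.const_mul (ct z.1)).const_add (vin (pT z.1))
  have hAl' := hAl.mono hQ
  obtain ⟨At, hAt, hAtm⟩ := exists_hasWeakDeriv_of_lipschitzOnWith hQo dt hAl'.choose_spec
  obtain ⟨Ax, hAx, hAxm⟩ := exists_hasWeakDeriv_of_lipschitzOnWith hQo dx hAl'.choose_spec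
  obtain ⟨vt, hvt, hvtm⟩ := exists_hasWeakDeriv_of_lipschitzOnWith hQo dt hvl.choose_spec
  obtain ⟨vtx, hvtx, hvtxm⟩ := exists_hasWeakDeriv_of_lipschitzOnWith hQo dt hvxl.choose_spec
  obtain ⟨vxx, hvxx, hvxxm⟩ := exists_hasWeakDeriv_of_lipschitzOnWith hQo dx hvxl.choose_spec
  have hQm := hQo.measurableSet
  have hYl' := hYl.mono hQ
  -- `∂ₓ(vA) = ∂ₓ∂ₜY = ∂ₜ∂ₓY = -∂ₜA`
  have hYx : HasWeakDeriv (Q T L) dx Y fun z => -A z :=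
    hasWeakDeriv_of_lipschitzOnWith hQo hYl'.choose_spec fun z hz => by
      have := (hYd' z hz).hasLineDerivAt dx
      simpa [dx] using this
  have hYt : HasWeakDeriv (Q T L) dt Y fun z => v z * A z :=
    hasWeakDeriv_of_lipschitzOnWith hQo hYl'.choose_spec fun z hz => by
      have := (hYd' z hz).hasLineDerivAt dt
      simpa [dt, mul_comm] using this
  have hAtn : HasWeakDeriv (Q T L) dt (fun z => -A z) fun z => -At z :=
    ⟨hAt.1.neg, hAt.2.1.neg, fun φ hφ hc' hs => by
      have := hAt.2.2 φ hφ hc' hs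
      simp only [neg_mul, integral_neg]
      rw [this]⟩
  refine ⟨A, v, ⟨hAl.continuousOn, hvc, ⟨hAl'.memL hQb hQm, At, Ax, hAt, hAtm, hAx, hAxm⟩,
    ⟨hvl.memL hQb hQm, vt, vx, vtx, vxx, hvt, hvtm, hvxw, hvxl.memL hQb hQm, hvtx, hvtxm, hvxx,
      hvxxm⟩, ⟨At, fun z => -At z, hAt, hYx.symm hYt hAtn, Eventually.of_forall fun z => by ring⟩,
    ⟨vx, fun _ => 0, hvxw, ?_, Eventually.of_forall fun _ => rfl⟩, fun z hz => hApos z (hQ hz), ?_,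
    ?_, ?_, ?_⟩, a, ha, fun z hz => (hAb' z hz).1⟩
  · have h1 : IsLipOn (fun z : ℝ × ℝ => 3 * μ * ct z.1) (Q T L) := (IsLipOn.const _).mul hctl' hQb
    have h2 : HasWeakDeriv (Q T L) dx (fun z : ℝ × ℝ => 3 * μ * ct z.1) fun _ => 0 :=
      hasWeakDeriv_of_lipschitzOnWith hQo h1.choose_spec fun z _ =>
        hasLineDerivAt_dx (hasDerivAt_const z.2 (3 * μ * ct z.1))
    refine h2.congr ((ae_restrict_mem hQm).mono fun z hz => ?_) (ae_eq_refl _)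
    have := (hApos z (hQ hz)).ne'
    simp only [hvx]
    field_simp
  · intro t ht
    rw [hAY, hY0, add_sub_cancel_right, hgM t (Ioo_subset_Icc_self ht)]
  · intro x hx
    have hx' := Ioo_subset_Icc_self hx
    set N : ℝ → ℝ := fun x => ∫ u in (0 : ℝ)..x, S₁ (pL u) with hN
    have hs1pos : ∀ x, 0 < S₁ (pL x) := fun x => hSm.trans_le (hS₁ _ (pL_mem x)).1
    have hNd : ∀ x, HasDerivAt N (S₁ (pL x)) x := fun x =>
      (s1c.integral_hasStrictDerivAt 0 x).hasDerivAt
    have hNnn : 0 ≤ N x := intervalIntegral.integral_nonneg hx.1.le fun u _ => (hs1pos u).le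
    have hgN : ∀ u, 0 ≤ u → g (-N u) = S₁ (pL u) := fun u hu => by
      have : 0 ≤ N u := intervalIntegral.integral_nonneg hu fun u _ => (hs1pos u).le
      rw [hg_neg _ (neg_nonpos.2 this), neg_neg, hσN]
    have hginv : Continuous fun s => (g s)⁻¹ :=
      hgc.inv₀ fun s => (hSm.trans_le (hgb s).1).ne'
    -- the label `-N x` is initially at the position `x`
    have hpos : ∫ s in (-N x)..(0 : ℝ), (g s)⁻¹ = x := by
      have hd : ∀ u ∈ Ioo 0 x, HasDerivAt (fun u => ∫ s in (-N u)..(0 : ℝ), (g s)⁻¹) 1 u := by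
        intro u hu
        have h1 := (hginv.integral_hasStrictDerivAt 0 (-N u)).hasDerivAt.neg
        have h2 := h1.comp u (hNd u).neg
        have h3 : -(g (-N u))⁻¹ * -S₁ (pL u) = 1 := by
          rw [hgN u hu.1.le]
          have := (hs1pos u).ne'
          field_simp
        rw [h3] at h2
        refine h2.congr_of_eventuallyEq (Eventually.of_forall fun u => ?_)
        exact intervalIntegral.integral_symm _ _
      have hcont : Continuous fun u => ∫ s in (-N u)..(0 : ℝ), (g s)⁻¹ := by
        simp_rw [intervalIntegral.integral_symm (0 : ℝ)]
        exact ((intervalIntegral.continuous_primitive (fun a b => hginv.intervalIntegrable a b)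
          0).comp (continuous_iff_continuousAt.2 fun u => (hNd u).continuousAt).neg).neg
      have h := intervalIntegral.integral_eq_sub_of_hasDerivAt_of_le hx.1.le hcont.continuousOn hd
        (by simp)
      have hN0 : N 0 = 0 := by simp [hN]
      simp only [intervalIntegral.integral_const, smul_eq_mul, mul_one, sub_zero, hN0, neg_zero,
        intervalIntegral.integral_same] at h
      exact h.symm
    have hYx0 := hYinit x hx' (-N x) (neg_nonpos.2 hNnn) hpos
    rw [hAY, hYx0, hgN x hx.1.le, pL_eq x hx', primitive_of_nonpos c (neg_nonpos.2 hNnn)]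
    simp [hM0, primitive_of_nonpos c le_rfl]
  · intro t ht
    simp [hvdef, hJ, pT_eq t (Ioo_subset_Icc_self ht)]
  · intro t ht
    have h4 := hflux t ht.1
    have h5 : b (M t) = (vL t - vin t) / M' t := by
      simp only [hb, hMdef, hτM, pT_eq t (Ioo_subset_Icc_self ht)]
    rw [h5, eq_div_iff (hM'pos t).ne'] at h4
    simp only [hvdef, hct, hJ, pT_eq t (Ioo_subset_Icc_self ht)]
    linarith

/-! ### Lipschitz functions on the rectangle -/

/-- A Lipschitz function has its weak derivative as classical derivative almost everywhere. -/
theorem HasWeakDeriv.ae_hasLineDerivAt {E : Type*} [NormedAddCommGroup E] [NormedSpace ℝ E]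
    [MeasureSpace E] [BorelSpace E] [FiniteDimensional ℝ E] [(volume : Measure E).IsAddHaarMeasure]
    {Ω : Set E} (hΩ : IsOpen Ω) {e : E} {u g : E → ℝ} (hu : IsLipOn u Ω)
    (h : HasWeakDeriv Ω e u g) : ∀ᵐ z ∂(volume.restrict Ω), HasLineDerivAt ℝ u (g z) z e := by
  obtain ⟨K, hK⟩ := hu
  obtain ⟨U, hU, hUu⟩ := hK.extend_real
  have h1 : HasWeakDeriv Ω e u fun z => lineDeriv ℝ U z e :=
    (hasWeakDeriv_lineDeriv hU Ω e).congr
      ((ae_restrict_mem hΩ.measurableSet).mono fun z hz => (hUu hz).symm) (ae_eq_refl _)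
  filter_upwards [h.ae_eq hΩ h1, ae_restrict_of_ae (hU.ae_lineDifferentiableAt (μ := volume) e),
    ae_restrict_mem hΩ.measurableSet] with z hz hd hzΩ
  rw [hz]
  refine hd.hasLineDerivAt.congr_of_eventuallyEq ?_
  filter_upwards [hΩ.mem_nhds hzΩ] with w hw using hUu hw

theorem lineDeriv_dx (U : ℝ × ℝ → ℝ) (t x : ℝ) :
    lineDeriv ℝ U (t, x) dx = deriv (fun y => U (t, y)) x := by
  have := deriv_comp_const_add (fun y => U (t, y)) x 0
  rw [add_zero] at this
  rw [lineDeriv, ← this]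
  congr 1
  ext s
  simp [dx]

theorem lineDeriv_dt (U : ℝ × ℝ → ℝ) (t x : ℝ) :
    lineDeriv ℝ U (t, x) dt = deriv (fun s => U (s, x)) t := by
  have := deriv_comp_const_add (fun s => U (s, x)) t 0
  rw [add_zero] at this
  rw [lineDeriv, ← this]
  congr 1
  ext s
  simp [dt]

theorem integral_deriv_snd {K : ℝ≥0} {U : ℝ × ℝ → ℝ} (hU : LipschitzWith K U) (t x y : ℝ) :
    ∫ s in x..y, deriv (fun s => U (t, s)) s = U (t, y) - U (t, x) :=
  (hU.comp (LipschitzWith.prodMk_left t)).lipschitzOnWith.absolutelyContinuousOnInterval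
    |>.integral_deriv_eq_sub

theorem integral_deriv_fst {K : ℝ≥0} {U : ℝ × ℝ → ℝ} (hU : LipschitzWith K U) (x s t : ℝ) :
    ∫ r in s..t, deriv (fun r => U (r, x)) r = U (t, x) - U (s, x) :=
  (hU.comp (LipschitzWith.prodMk_right x)).lipschitzOnWith.absolutelyContinuousOnInterval
    |>.integral_deriv_eq_sub

theorem volume_restrict_Q (T L : ℝ) : (volume : Measure (ℝ × ℝ)).restrict (Q T L)
    = (volume.restrict (Ioo 0 T)).prod (volume.restrict (Ioo 0 L)) := by
  rw [Measure.prod_restrict, ← Measure.volume_eq_prod]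
  rfl

theorem integral_Ioo_eq {a b : ℝ} (h : a ≤ b) (f : ℝ → ℝ) :
    ∫ x in Ioo a b, f x = ∫ x in a..b, f x := by
  rw [intervalIntegral.integral_of_le h, integral_Ioc_eq_integral_Ioo]

instance isFiniteMeasure_restrict_Q (T L : ℝ) :
    IsFiniteMeasure ((volume : Measure (ℝ × ℝ)).restrict (Q T L)) :=
  isFiniteMeasure_restrict.2 (isBounded_Q T L).measure_lt_top.ne

/-- Divergence inequality on a rectangle for a Lipschitz field `(f₁, f₂)`. -/
theorem integral_boundary_le {T L : ℝ} (hT : 0 ≤ T) (hL : 0 ≤ L) {f₁ f₂ r : ℝ × ℝ → ℝ}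
    (hf₁ : IsLipOn f₁ (Qbar T L)) (hf₂ : IsLipOn f₂ (Qbar T L)) (hr : IntegrableOn r (Q T L))
    (h : ∀ᵐ z ∂(volume.restrict (Q T L)), ∃ d₁ d₂, HasLineDerivAt ℝ f₁ d₁ z dt ∧
      HasLineDerivAt ℝ f₂ d₂ z dx ∧ d₁ + d₂ ≤ r z) :
    (∫ x in (0 : ℝ)..L, (f₁ (T, x) - f₁ (0, x))) + ∫ t in (0 : ℝ)..T, (f₂ (t, L) - f₂ (t, 0))
      ≤ ∫ z in Q T L, r z := by
  obtain ⟨K₁, hK₁⟩ := hf₁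
  obtain ⟨K₂, hK₂⟩ := hf₂
  obtain ⟨U₁, hU₁, hUf₁⟩ := hK₁.extend_real
  obtain ⟨U₂, hU₂, hUf₂⟩ := hK₂.extend_real
  have hi₁ : IntegrableOn (fun z => lineDeriv ℝ U₁ z dt) (Q T L) :=
    (hU₁.memLp_lineDeriv dt).integrable le_top
  have hi₂ : IntegrableOn (fun z => lineDeriv ℝ U₂ z dx) (Q T L) :=
    (hU₂.memLp_lineDeriv dx).integrable le_top
  have e₁ : ∫ z in Q T L, lineDeriv ℝ U₁ z dt = ∫ x in (0 : ℝ)..L, (f₁ (T, x) - f₁ (0, x)) := by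
    rw [IntegrableOn, volume_restrict_Q] at hi₁
    rw [volume_restrict_Q, integral_prod_symm _ hi₁, integral_Ioo_eq hL]
    refine intervalIntegral.integral_congr fun x hx => ?_
    rw [uIcc_of_le hL] at hx
    simp only [lineDeriv_dt]
    rw [integral_Ioo_eq hT, integral_deriv_fst hU₁, hUf₁ ⟨⟨hT, le_rfl⟩, hx⟩,
      hUf₁ ⟨⟨le_rfl, hT⟩, hx⟩]
  have e₂ : ∫ z in Q T L, lineDeriv ℝ U₂ z dx = ∫ t in (0 : ℝ)..T, (f₂ (t, L) - f₂ (t, 0)) := by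
    rw [IntegrableOn, volume_restrict_Q] at hi₂
    rw [volume_restrict_Q, integral_prod _ hi₂, integral_Ioo_eq hT]
    refine intervalIntegral.integral_congr fun t ht => ?_
    rw [uIcc_of_le hT] at ht
    simp only [lineDeriv_dx]
    rw [integral_Ioo_eq hL, integral_deriv_snd hU₂, hUf₂ ⟨ht, ⟨hL, le_rfl⟩⟩,
      hUf₂ ⟨ht, ⟨le_rfl, hL⟩⟩]
  rw [← e₁, ← e₂, ← integral_add hi₁ hi₂]
  refine integral_mono_ae (hi₁.add hi₂) hr ?_
  filter_upwards [h, ae_restrict_mem (isOpen_Q T L).measurableSet] with z ⟨d₁, d₂, h₁, h₂, h₃⟩ hz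
  have hnhds := (isOpen_Q T L).mem_nhds hz
  have l₁ : lineDeriv ℝ U₁ z dt = d₁ := HasLineDerivAt.lineDeriv (h₁.congr_of_eventuallyEq (by
    filter_upwards [hnhds] with w hw using (hUf₁ (Q_subset_Qbar T L hw)).symm))
  have l₂ : lineDeriv ℝ U₂ z dx = d₂ := HasLineDerivAt.lineDeriv (h₂.congr_of_eventuallyEq (by
    filter_upwards [hnhds] with w hw using (hUf₂ (Q_subset_Qbar T L hw)).symm))
  simp only [l₁, l₂]
  exact h₃

/-- The fundamental theorem of calculus in the space variable, on every time slice. -/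
theorem HasWeakDeriv.integral_snd_eq {T L : ℝ} (hT : 0 < T) {f g : ℝ × ℝ → ℝ}
    (hf : IsLipOn f (Qbar T L)) (hg : IsLipOn g (Qbar T L)) (h : HasWeakDeriv (Q T L) dx f g)
    {t x : ℝ} (ht : t ∈ Icc 0 T) (hx : x ∈ Icc 0 L) :
    f (t, x) - f (t, 0) = ∫ y in (0 : ℝ)..x, g (t, y) := by
  obtain ⟨K, hK⟩ := id hf
  obtain ⟨U, hU, hUf⟩ := hK.extend_real
  have h0 : (0 : ℝ) ∈ Icc 0 L := ⟨le_rfl, hx.1.trans hx.2⟩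
  have h1 : HasWeakDeriv (Q T L) dx f fun z => lineDeriv ℝ U z dx :=
    (hasWeakDeriv_lineDeriv hU _ dx).congr ((ae_restrict_mem (isOpen_Q T L).measurableSet).mono
      fun z hz => (hUf (Q_subset_Qbar T L hz)).symm) (ae_eq_refl _)
  have h2 := h.ae_eq (isOpen_Q T L) h1
  rw [volume_restrict_Q] at h2
  have h3 := Measure.ae_ae_of_ae_prod h2
  -- almost every slice inherits the identity, and both sides are continuous in time
  have h4 : (fun t => f (t, x) - f (t, 0)) =ᵐ[volume.restrict (Icc 0 T)]
      fun t => ∫ y in (0 : ℝ)..x, g (t, y) := by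
    rw [restrict_Ioo_eq_restrict_Icc.symm]
    filter_upwards [h3, ae_restrict_mem measurableSet_Ioo] with s hs hsm
    have hs' := Ioo_subset_Icc_self hsm
    rw [hUf ⟨hs', hx⟩, hUf ⟨hs', h0⟩, ← integral_deriv_snd hU]
    refine intervalIntegral.integral_congr_ae ?_
    rw [uIoc_of_le hx.1, ← ae_restrict_iff' measurableSet_Ioc, ← restrict_Ioo_eq_restrict_Ioc]
    filter_upwards [ae_restrict_of_ae_restrict_of_subset (Ioo_subset_Ioo_right hx.2) hs] with y hy
    rw [hy, lineDeriv_dx]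
  have hsl : ∀ (F : ℝ × ℝ → ℝ) (y : ℝ), y ∈ Icc 0 L → IsLipOn F (Qbar T L) →
      ContinuousOn (fun t => F (t, y)) (Icc 0 T) := fun F y hy hF =>
    hF.continuousOn.comp (Continuous.prodMk_left y).continuousOn fun s hs => ⟨hs, hy⟩
  exact Measure.eqOn_Icc_of_ae_eq volume hT.ne h4 ((hsl f x hx hf).sub (hsl f 0 h0 hf))
    (hsl _ x hx hg.integral_snd) ht

/-- `W^{1,∞}` functions on the rectangle have a Lipschitz representative up to the boundary. -/
theorem exists_lipschitz_repr_Q {T L : ℝ} {u ut ux : ℝ × ℝ → ℝ} (hu : MemL (Q T L) ∞ u)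
    (ht : HasWeakDeriv (Q T L) dt u ut) (htm : MemL (Q T L) ∞ ut)
    (hx : HasWeakDeriv (Q T L) dx u ux) (hxm : MemL (Q T L) ∞ ux) :
    ∃ U, IsLipOn U (Qbar T L) ∧ u =ᵐ[volume.restrict (Q T L)] U := by
  obtain ⟨K₁, hK₁0, hK₁⟩ := htm.exists_ae_abs_le
  obtain ⟨K₂, hK₂0, hK₂⟩ := hxm.exists_ae_abs_le
  obtain ⟨U, hU, hUu⟩ := exists_lipschitzWith_ae_eq (ι := Bool) (K := K₁ + K₂)
    (C := (2 * (K₁ + K₂)).toNNReal) (isOpen_Q T L) (convex_Q T L) (MemLp.integrable le_top hu)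
    (fun i => if i then dt else dx) (fun i => if i then ut else ux)
    (by rintro (_ | _) <;> simpa) (by
      rintro (_ | _)
      · simp only [Bool.false_eq_true, if_false]
        filter_upwards [hK₂] with z hz
        linarith
      · simp only [if_true]
        filter_upwards [hK₁] with z hz
        linarith) (by
      intro f' hf'
      have h1 := hf' true
      have h2 := hf' false
      simp only [if_true, Bool.false_eq_true, if_false] at h1 h2
      rw [Real.coe_toNNReal _ (by positivity)]
      refine f'.opNorm_le_bound (by positivity) fun z => ?_
      have e : f' z = z.1 * f' dt + z.2 * f' dx := by
        have : z = z.1 • dt + z.2 • dx := by ext <;> simp [dt, dx]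
        conv_lhs => rw [this]
        simp
      rw [e, Real.norm_eq_abs]
      have n1 : |z.1| ≤ ‖z‖ := norm_fst_le z
      have n2 : |z.2| ≤ ‖z‖ := norm_snd_le z
      calc |z.1 * f' dt + z.2 * f' dx| ≤ |z.1| * |f' dt| + |z.2| * |f' dx| := by
            rw [← abs_mul, ← abs_mul]
            exact abs_add_le _ _
        _ ≤ ‖z‖ * (K₁ + K₂) + ‖z‖ * (K₁ + K₂) := by gcongr
        _ = _ := by ring)
  exact ⟨U, ⟨_, hU.lipschitzOnWith⟩, hUu⟩

theorem eqOn_Qbar_of_eqOn_Q {T L : ℝ} (hT : 0 < T) (hL : 0 < L) {f g : ℝ × ℝ → ℝ}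
    (hf : ContinuousOn f (Qbar T L)) (hg : ContinuousOn g (Qbar T L)) (h : EqOn f g (Q T L)) :
    EqOn f g (Qbar T L) :=
  h.of_subset_closure hf hg (Q_subset_Qbar T L) (closure_Q hT hL).ge

theorem isLipOn_Qbar_of_memL {T L : ℝ} (hT : 0 < T) (hL : 0 < L) {u ut ux : ℝ × ℝ → ℝ}
    (huc : ContinuousOn u (Qbar T L)) (hu : MemL (Q T L) ∞ u)
    (ht : HasWeakDeriv (Q T L) dt u ut) (htm : MemL (Q T L) ∞ ut)
    (hx : HasWeakDeriv (Q T L) dx u ux) (hxm : MemL (Q T L) ∞ ux) : IsLipOn u (Qbar T L) := by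
  obtain ⟨U, hU, hUu⟩ := exists_lipschitz_repr_Q hu ht htm hx hxm
  have h1 : EqOn u U (Q T L) := Measure.eqOn_open_of_ae_eq hUu (isOpen_Q T L)
    (huc.mono (Q_subset_Qbar T L)) (hU.continuousOn.mono (Q_subset_Qbar T L))
  exact hU.congr (eqOn_Qbar_of_eqOn_Q hT hL huc hU.continuousOn h1)

/-! ### Uniqueness -/

/-- The almost everywhere form of the system. The tension `A ∂ₓv = c t` is constant in space, so
that the velocity is an explicit functional of `A`, and the mass equation becomes the transport
equation `∂ₜA + v ∂ₓA = -c`. Here `W` stands for `∂ₓv` and `Ax` for `∂ₓA`. The lower bound on `A` is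
only required up to times `T' < T`, since a strong solution is not assumed to be positive at the
final time. -/
structure IsFluxSolution (T L : ℝ) (vin vL : ℝ → ℝ) (A v W Ax : ℝ × ℝ → ℝ) (c : ℝ → ℝ) : Prop where
  lip_A : IsLipOn A (Qbar T L)
  lip_v : IsLipOn v (Qbar T L)
  lip_W : IsLipOn W (Qbar T L)
  lower : ∀ T' < T, ∃ α > 0, ∀ z ∈ Icc 0 T' ×ˢ Icc 0 L, α ≤ A z
  tension : ∀ t ∈ Ioo 0 T, ∀ x ∈ Icc 0 L, A (t, x) * W (t, x) = c t
  velocity : ∀ t ∈ Ioo 0 T, ∀ x ∈ Icc 0 L, v (t, x) = vin t + ∫ y in (0 : ℝ)..x, W (t, y)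
  velocity_right : ∀ t ∈ Ioo 0 T, v (t, L) = vL t
  bound : ∃ K : ℝ, 0 ≤ K ∧ ∀ᵐ z ∂(volume.restrict (Q T L)), |Ax z| ≤ K
  deriv : ∀ᵐ z ∂(volume.restrict (Q T L)), HasLineDerivAt ℝ A (Ax z) z dx ∧
    HasLineDerivAt ℝ A (-(v z * Ax z) - c z.1) z dt ∧ HasLineDerivAt ℝ v (W z) z dx

theorem HasLineDerivAt.mul' {f g : ℝ × ℝ → ℝ} {f' g' : ℝ} {z e : ℝ × ℝ}
    (hf : HasLineDerivAt ℝ f f' z e) (hg : HasLineDerivAt ℝ g g' z e) :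
    HasLineDerivAt ℝ (fun z => f z * g z) (f' * g z + f z * g') z e := by
  have := HasDerivAt.mul hf hg
  simp only [zero_smul, add_zero] at this
  exact this

theorem HasLineDerivAt.sub' {f g : ℝ × ℝ → ℝ} {f' g' : ℝ} {z e : ℝ × ℝ}
    (hf : HasLineDerivAt ℝ f f' z e) (hg : HasLineDerivAt ℝ g g' z e) :
    HasLineDerivAt ℝ (fun z => f z - g z) (f' - g') z e :=
  HasDerivAt.sub hf hg

/-- A strong solution satisfies the almost everywhere form of the system, with `W` the Lipschitz
representative of `∂ₓv` and `c t = A (t, 0) W (t, 0)`. -/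
theorem IsStrongSolution.exists_isFluxSolution {μ T L : ℝ} (hμ : 0 < μ) (hT : 0 < T) (hL : 0 < L)
    {S₀ S₁ vin vL : ℝ → ℝ} {S_m : ℝ} (hSm : 0 < S_m)
    (hS₀c : ContinuousOn S₀ (Icc 0 T)) (hS₁c : ContinuousOn S₁ (Icc 0 L))
    (hS₀ : ∀ t ∈ Icc 0 T, S_m ≤ S₀ t) (hS₁ : ∀ x ∈ Icc 0 L, S_m ≤ S₁ x)
    (hv : ∀ t ∈ Ioo 0 T, vin t < vL t) {A v : ℝ × ℝ → ℝ}
    (h : IsStrongSolution μ T L S₀ S₁ vin vL A v) :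
    ∃ W Ax c, IsFluxSolution T L vin vL A v W Ax c := by
  have hQ := Q_subset_Qbar T L
  have hQo := isOpen_Q T L
  have hQb := isBounded_Q T L
  obtain ⟨hAm, At, Ax, hAt, hAtm, hAx, hAxm⟩ := h.regularity_A
  obtain ⟨hvm, vt, vx, vtx, vxx, hvt, hvtm, hvx, hvxm, hvtx, hvtxm, hvxx, hvxxm⟩ := h.regularity_v
  have hAl := isLipOn_Qbar_of_memL hT hL h.continuousOn_A hAm hAt hAtm hAx hAxm
  have hvl := isLipOn_Qbar_of_memL hT hL h.continuousOn_v hvm hvt hvtm hvx hvxm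
  obtain ⟨W, hWl, hWvx⟩ := exists_lipschitz_repr_Q hvxm hvtx hvtxm hvxx hvxxm
  have hvW : HasWeakDeriv (Q T L) dx v W := hvx.congr (ae_eq_refl _) hWvx
  have h0L : (0 : ℝ) ∈ Icc 0 L := ⟨le_rfl, hL.le⟩
  have hLL : L ∈ Icc 0 L := ⟨hL.le, le_rfl⟩
  have hAW : IsLipOn (fun z => 3 * μ * A z * W z) (Qbar T L) :=
    ((IsLipOn.const (3 * μ)).mul hAl (isBounded_Qbar T L)).mul hWl (isBounded_Qbar T L)
  have hAWw : HasWeakDeriv (Q T L) dx (fun z => 3 * μ * A z * W z) fun _ => 0 := by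
    obtain ⟨vx', G, hvx', hG, hG0⟩ := h.momentum
    refine hG.congr ?_ hG0
    filter_upwards [hvx'.ae_eq hQo hvW] with z hz
    rw [hz]
  have htension : ∀ t ∈ Icc 0 T, ∀ x ∈ Icc 0 L, A (t, x) * W (t, x) = A (t, 0) * W (t, 0) := by
    intro t ht x hx
    have := hAWw.integral_snd_eq hT hAW (IsLipOn.const 0) ht hx
    rw [intervalIntegral.integral_zero, sub_eq_zero, mul_assoc (3 * μ), mul_assoc (3 * μ)] at this
    exact mul_left_cancel₀ (by positivity) this
  have hvel : ∀ t ∈ Icc 0 T, ∀ x ∈ Icc 0 L, v (t, x) - v (t, 0) = ∫ y in (0 : ℝ)..x, W (t, y) :=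
    fun t ht x hx => hvW.integral_snd_eq hT hvl hWl ht hx
  have hslx : ∀ (F : ℝ × ℝ → ℝ) (t : ℝ), t ∈ Icc 0 T → ContinuousOn F (Qbar T L) →
      ContinuousOn (fun x => F (t, x)) (Icc 0 L) := fun F t ht hF =>
    hF.comp (Continuous.prodMk_right t).continuousOn fun s hs => ⟨ht, hs⟩
  have hslt : ∀ (F : ℝ × ℝ → ℝ) (x : ℝ), x ∈ Icc 0 L → ContinuousOn F (Qbar T L) →
      ContinuousOn (fun t => F (t, x)) (Icc 0 T) := fun F x hx hF =>
    hF.comp (Continuous.prodMk_left x).continuousOn fun s hs => ⟨hs, hx⟩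
  have hA0 : ∀ t ∈ Icc 0 T, A (t, 0) = S₀ t :=
    EqOn.of_subset_closure (s := Ioo 0 T) (fun t ht => h.inflow t ht)
      (hslt A 0 h0L h.continuousOn_A) hS₀c Ioo_subset_Icc_self (closure_Ioo hT.ne).ge
  have hA1 : ∀ x ∈ Icc 0 L, A (0, x) = S₁ x :=
    EqOn.of_subset_closure (s := Ioo 0 L) (fun x hx => h.initial x hx)
      (hslx A 0 ⟨le_rfl, hT.le⟩ h.continuousOn_A) hS₁c Ioo_subset_Icc_self (closure_Ioo hL.ne).ge
  -- the tension is positive, since the velocity increases from the inlet to the outlet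
  have hc : ∀ t ∈ Ioo 0 T, 0 < A (t, 0) * W (t, 0) := by
    intro t ht
    have ht' := Ioo_subset_Icc_self ht
    by_contra hneg
    have hW0 : ∀ x ∈ Ioo 0 L, W (t, x) ≤ 0 := by
      intro x hx
      have h1 := htension t ht' x (Ioo_subset_Icc_self hx)
      have h2 := h.pos (t, x) ⟨ht, hx⟩
      by_contra h3
      have := mul_pos h2 (not_le.1 h3)
      linarith
    have h1 : ∫ y in (0 : ℝ)..L, W (t, y) ≤ 0 := by
      rw [← integral_Ioo_eq hL.le]
      exact setIntegral_nonpos measurableSet_Ioo hW0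
    rw [← hvel t ht' L hLL, h.velocity_left t ht, h.velocity_right t ht] at h1
    have := hv t ht
    linarith
  -- at the outlet positivity follows from that of the tension `A W`
  have hpos : ∀ t, 0 ≤ t → t < T → ∀ x ∈ Icc 0 L, 0 < A (t, x) := by
    intro t ht htT x hx
    rcases ht.eq_or_lt with rfl | ht0
    · rw [hA1 x hx]
      exact hSm.trans_le (hS₁ x hx)
    rcases hx.1.eq_or_lt with rfl | hx0
    · rw [hA0 t ⟨ht, htT.le⟩]
      exact hSm.trans_le (hS₀ t ⟨ht, htT.le⟩)
    rcases hx.2.eq_or_lt with rfl | hxL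
    · have h1 := htension t ⟨ht, htT.le⟩ x hx
      have h2 := hc t ⟨ht0, htT⟩
      have h3 : 0 ≤ A (t, x) := by
        have hcl : x ∈ closure (Ioo 0 x) := by rw [closure_Ioo hL.ne]; exact hx
        have hcont : ContinuousOn (fun y => A (t, y)) (closure (Ioo 0 x)) := by
          rw [closure_Ioo hL.ne]
          exact hslx A t ⟨ht, htT.le⟩ h.continuousOn_A
        exact le_on_closure (f := fun _ => (0 : ℝ)) (fun y hy => (h.pos (t, y) ⟨⟨ht0, htT⟩, hy⟩).le)
          continuousOn_const hcont hcl
      refine lt_of_le_of_ne h3 fun h4 => ?_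
      rw [← h4, zero_mul] at h1
      linarith
    · exact h.pos (t, x) ⟨⟨ht0, htT⟩, hx0, hxL⟩
  obtain ⟨K, hK0, hK⟩ := MemL.exists_ae_abs_le hAxm
  refine ⟨W, Ax, fun t => A (t, 0) * W (t, 0), hAl, hvl, hWl, ?_,
    fun t ht x hx => htension t (Ioo_subset_Icc_self ht) x hx, ?_, h.velocity_right,
    ⟨K, hK0, hK⟩, ?_⟩
  · intro T' hT'
    rcases (Icc 0 T' ×ˢ Icc 0 L).eq_empty_or_nonempty with he | hne
    · exact ⟨1, one_pos, by simp [he]⟩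
    have hsub : Icc 0 T' ×ˢ Icc 0 L ⊆ Qbar T L := prod_mono (Icc_subset_Icc_right hT'.le) subset_rfl
    obtain ⟨z₀, hz₀, hmin⟩ := (isCompact_Icc.prod isCompact_Icc).exists_isMinOn hne
      (h.continuousOn_A.mono hsub)
    exact ⟨A z₀, hpos z₀.1 hz₀.1.1 (hz₀.1.2.trans_lt hT') z₀.2 hz₀.2, fun z hz => hmin hz⟩
  · intro t ht x hx
    rw [← hvel t (Ioo_subset_Icc_self ht) x hx, h.velocity_left t ht]
    ring
  · obtain ⟨At', F, hAt', hF, hmass⟩ := h.mass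
    have hvAl : IsLipOn (fun z => v z * A z) (Q T L) := (hvl.mono hQ).mul (hAl.mono hQ) hQb
    filter_upwards [hmass, hAx.ae_hasLineDerivAt hQo (hAl.mono hQ),
      hAt'.ae_hasLineDerivAt hQo (hAl.mono hQ), hF.ae_hasLineDerivAt hQo hvAl,
      hvW.ae_hasLineDerivAt hQo (hvl.mono hQ), ae_restrict_mem hQo.measurableSet]
      with z hm hx ht hFz hW hz
    have e1 : F z = W z * A z + v z * Ax z := HasDerivAt.unique hFz (HasLineDerivAt.mul' hW hx)
    have e2 := htension z.1 (Ioo_subset_Icc_self hz.1) z.2 (Ioo_subset_Icc_self hz.2)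
    have e3 : At' z = -(v z * Ax z) - A (z.1, 0) * W (z.1, 0) := by
      rw [← e2]
      change _ = -(v z * Ax z) - A z * W z
      linarith
    exact ⟨hx, e3 ▸ ht, hW⟩

/-- Lipschitz dependence of the tension and of the velocity on the cross-section, in `L¹`. -/
theorem tension_velocity_stability {α B L V : ℝ} (hα : 0 < α) (hL : 0 < L) :
    ∃ K, 0 ≤ K ∧ ∀ (A A' : ℝ → ℝ) (w c c' : ℝ), ContinuousOn A (Icc 0 L) →
      ContinuousOn A' (Icc 0 L) → (∀ x ∈ Icc 0 L, α ≤ A x ∧ A x ≤ B) →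
      (∀ x ∈ Icc 0 L, α ≤ A' x ∧ A' x ≤ B) → 0 ≤ w → w ≤ V →
      c * ∫ x in (0 : ℝ)..L, (A x)⁻¹ = w → c' * ∫ x in (0 : ℝ)..L, (A' x)⁻¹ = w →
      |c - c'| ≤ K * (∫ x in (0 : ℝ)..L, |A' x - A x|) ∧
      ∀ x ∈ Icc 0 L, |(c * ∫ y in (0 : ℝ)..x, (A y)⁻¹) - c' * ∫ y in (0 : ℝ)..x, (A' y)⁻¹|
        ≤ K * ∫ x in (0 : ℝ)..L, |A' x - A x| := by
  set m : ℝ := L / |B| with hm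
  set K₁ : ℝ := |V| / m ^ 2 * (1 / α ^ 2) with hK₁
  set K₂ : ℝ := |V| / m * (1 / α ^ 2) + K₁ * (α⁻¹ * L) with hK₂
  have hm0 : 0 ≤ m := by positivity
  have hK₁0 : 0 ≤ K₁ := by positivity
  have hK₂0 : 0 ≤ K₂ := by positivity
  refine ⟨K₁ + K₂, by positivity, fun A A' w c c' hA hA' hAb hAb' hw hwV hc hc' => ?_⟩
  have h0 : (0 : ℝ) ∈ Icc 0 L := ⟨le_rfl, hL.le⟩
  have hB : 0 < B := hα.trans_le ((hAb 0 h0).1.trans (hAb 0 h0).2)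
  have hmpos : 0 < m := by rw [hm, abs_of_pos hB]; positivity
  have hV : |V| = V := abs_of_nonneg (hw.trans hwV)
  have hi : ∀ F : ℝ → ℝ, ContinuousOn F (Icc 0 L) → ∀ x ∈ Icc 0 L,
      IntervalIntegrable F volume 0 x := fun F hF x hx => by
    refine (hF.mono ?_).intervalIntegrable
    rw [uIcc_of_le hx.1]
    exact Icc_subset_Icc_right hx.2
  have hinv : ∀ F : ℝ → ℝ, ContinuousOn F (Icc 0 L) → (∀ x ∈ Icc 0 L, α ≤ F x ∧ F x ≤ B) →
      ContinuousOn (fun x => (F x)⁻¹) (Icc 0 L) := fun F hF hFb =>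
    hF.inv₀ fun x hx => (hα.trans_le (hFb x hx).1).ne'
  have hN : ∀ F : ℝ → ℝ, ContinuousOn F (Icc 0 L) → (∀ x ∈ Icc 0 L, α ≤ F x ∧ F x ≤ B) →
      m ≤ ∫ x in (0 : ℝ)..L, (F x)⁻¹ := by
    intro F hF hFb
    have : ∫ _ in (0 : ℝ)..L, B⁻¹ ≤ ∫ x in (0 : ℝ)..L, (F x)⁻¹ :=
      intervalIntegral.integral_mono_on hL.le (by simp) (hi _ (hinv F hF hFb) L ⟨hL.le, le_rfl⟩)
        fun x hx => inv_anti₀ (hα.trans_le (hFb x hx).1) (hFb x hx).2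
    rw [intervalIntegral.integral_const, smul_eq_mul, sub_zero] at this
    rwa [hm, abs_of_pos hB, div_eq_mul_inv]
  have hAi := hinv A hA hAb
  have hAi' := hinv A' hA' hAb'
  set I : ℝ := ∫ x in (0 : ℝ)..L, |A' x - A x| with hI
  have hdc : ContinuousOn (fun x => |A' x - A x|) (Icc 0 L) := (hA'.sub hA).abs
  have hI0 : 0 ≤ I := intervalIntegral.integral_nonneg hL.le fun x _ => abs_nonneg _
  have hJ : ∀ x ∈ Icc 0 L, |(∫ y in (0 : ℝ)..x, (A y)⁻¹) - ∫ y in (0 : ℝ)..x, (A' y)⁻¹|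
      ≤ 1 / α ^ 2 * I := by
    intro x hx
    rw [← intervalIntegral.integral_sub (hi _ hAi x hx) (hi _ hAi' x hx)]
    have hb : IntervalIntegrable (fun y => 1 / α ^ 2 * |A' y - A y|) volume 0 L :=
      (hi _ hdc L ⟨hL.le, le_rfl⟩).const_mul _
    calc |∫ y in (0 : ℝ)..x, ((A y)⁻¹ - (A' y)⁻¹)|
        ≤ ∫ y in (0 : ℝ)..x, |(A y)⁻¹ - (A' y)⁻¹| :=
          intervalIntegral.abs_integral_le_integral_abs hx.1
      _ ≤ ∫ y in (0 : ℝ)..x, 1 / α ^ 2 * |A' y - A y| := by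
          refine intervalIntegral.integral_mono_on hx.1 ((hi _ (hAi.sub hAi').abs x hx))
            ((hi _ hdc x hx).const_mul _) fun y hy => ?_
          have hy' : y ∈ Icc 0 L := ⟨hy.1, hy.2.trans hx.2⟩
          refine (abs_inv_sub_inv_le hα (hAb y hy').1 (hAb' y hy').1).trans ?_
          rw [abs_sub_comm, div_eq_mul_one_div, mul_comm]
      _ ≤ ∫ y in (0 : ℝ)..L, 1 / α ^ 2 * |A' y - A y| :=
          intervalIntegral.integral_mono_interval le_rfl hx.1 hx.2
            (Eventually.of_forall fun y => by positivity) hb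
      _ = 1 / α ^ 2 * I := intervalIntegral.integral_const_mul _ _
  have hN₁ := hN A hA hAb
  have hN₂ := hN A' hA' hAb'
  have ec : c = w / ∫ x in (0 : ℝ)..L, (A x)⁻¹ :=
    (eq_div_iff (hmpos.trans_le hN₁).ne').2 hc
  have ec' : c' = w / ∫ x in (0 : ℝ)..L, (A' x)⁻¹ :=
    (eq_div_iff (hmpos.trans_le hN₂).ne').2 hc'
  have hcc : |c - c'| ≤ K₁ * I := by
    rw [ec, ec']
    refine (abs_div_sub_div_le hmpos hw (hwV.trans hV.ge) hN₁ hN₂).trans ?_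
    rw [hK₁, mul_assoc]
    exact mul_le_mul_of_nonneg_left (hJ L ⟨hL.le, le_rfl⟩) (by positivity)
  refine ⟨hcc.trans (by nlinarith), fun x hx => ?_⟩
  have hcb : |c| ≤ |V| / m := by
    rw [ec, abs_of_nonneg (div_nonneg hw (hmpos.trans_le hN₁).le)]
    exact div_le_div₀ (abs_nonneg _) (hwV.trans hV.ge) hmpos hN₁
  have hJ' : |∫ y in (0 : ℝ)..x, (A' y)⁻¹| ≤ α⁻¹ * L := by
    have := intervalIntegral.norm_integral_le_of_norm_le_const (a := 0) (b := x)
      (f := fun y => (A' y)⁻¹) (C := α⁻¹) fun y hy => by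
        rw [uIoc_of_le hx.1] at hy
        have hy' : y ∈ Icc 0 L := ⟨hy.1.le, hy.2.trans hx.2⟩
        rw [Real.norm_eq_abs, abs_of_pos (inv_pos.2 (hα.trans_le (hAb' y hy').1))]
        exact inv_anti₀ hα (hAb' y hy').1
    rw [sub_zero, abs_of_nonneg hx.1] at this
    exact this.trans (mul_le_mul_of_nonneg_left hx.2 (inv_pos.2 hα).le)
  have e : ((c * ∫ y in (0 : ℝ)..x, (A y)⁻¹) - c' * ∫ y in (0 : ℝ)..x, (A' y)⁻¹)
      = c * ((∫ y in (0 : ℝ)..x, (A y)⁻¹) - ∫ y in (0 : ℝ)..x, (A' y)⁻¹)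
        + (c - c') * ∫ y in (0 : ℝ)..x, (A' y)⁻¹ := by ring
  rw [e]
  refine (abs_add_le _ _).trans ?_
  rw [abs_mul, abs_mul]
  calc _ ≤ |V| / m * (1 / α ^ 2 * I) + K₁ * I * (α⁻¹ * L) := by
        gcongr
        exact hJ x hx
    _ = K₂ * I := by rw [hK₂]; ring
    _ ≤ (K₁ + K₂) * I := by nlinarith

/-- Grönwall's inequality in integral form. -/
theorem eq_zero_of_le_integral {E : ℝ → ℝ} {T K : ℝ} (hT : 0 ≤ T) (hE : ContinuousOn E (Icc 0 T))
    (hE0 : ∀ t ∈ Icc 0 T, 0 ≤ E t)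
    (h : ∀ t ∈ Icc 0 T, E t ≤ K * ∫ s in (0 : ℝ)..t, E s) : ∀ t ∈ Icc 0 T, E t = 0 := by
  set e : ℝ → ℝ := IccExtend hT ((Icc 0 T).domRestrict E) with he
  have hec : Continuous e := (continuousOn_iff_continuous_domRestrict.1 hE).Icc_extend'
  have heE : ∀ t ∈ Icc 0 T, e t = E t := fun t ht => IccExtend_of_mem hT _ ht
  set F : ℝ → ℝ := fun t => ∫ s in (0 : ℝ)..t, e s with hF
  have hFE : ∀ t ∈ Icc 0 T, F t = ∫ s in (0 : ℝ)..t, E s := fun t ht => by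
    refine intervalIntegral.integral_congr fun s hs => ?_
    rw [uIcc_of_le ht.1] at hs
    exact heE s ⟨hs.1, hs.2.trans ht.2⟩
  have hFd : ∀ t, HasDerivAt F (e t) t := fun t => (hec.integral_hasStrictDerivAt 0 t).hasDerivAt
  have hF0 : ∀ t ∈ Icc 0 T, 0 ≤ F t := fun t ht => by
    rw [hFE t ht]
    exact intervalIntegral.integral_nonneg ht.1 fun s hs => hE0 s ⟨hs.1, hs.2.trans ht.2⟩
  have hg := norm_le_gronwallBound_of_norm_deriv_right_le (f := F) (f' := e) (δ := 0) (K := K)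
    (ε := 0) (a := 0) (b := T) (continuous_iff_continuousAt.2 fun t =>
      (hFd t).continuousAt).continuousOn (fun t _ => (hFd t).hasDerivWithinAt) (by simp [hF])
    fun t ht => by
      have ht' := Ico_subset_Icc_self ht
      rw [Real.norm_eq_abs, Real.norm_eq_abs, heE t ht', abs_of_nonneg (hE0 t ht'),
        abs_of_nonneg (hF0 t ht'), add_zero, hFE t ht']
      exact h t ht'
  intro t ht
  have h1 := hg t ht
  rw [gronwallBound_ε0_δ0, norm_le_zero_iff] at h1
  have h2 := h t ht
  rw [← hFE t ht, h1, mul_zero] at h2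
  exact le_antisymm h2 (hE0 t ht)

/-- The Cauchy–Schwarz inequality for `∫ |f|`. -/
theorem sq_integral_abs_le {f : ℝ → ℝ} {L : ℝ} (hL : 0 < L) (hf : ContinuousOn f (Icc 0 L)) :
    (∫ x in (0 : ℝ)..L, |f x|) ^ 2 ≤ L * ∫ x in (0 : ℝ)..L, f x ^ 2 := by
  set I := ∫ x in (0 : ℝ)..L, |f x| with hI
  rw [← uIcc_of_le hL.le] at hf
  -- the variance of `|f|`, multiplied by `L³`, is nonnegative
  have h1 : 0 ≤ ∫ x in (0 : ℝ)..L, (L * |f x| - I) ^ 2 :=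
    intervalIntegral.integral_nonneg hL.le fun x _ => sq_nonneg _
  have h2 : ∫ x in (0 : ℝ)..L, (L * |f x| - I) ^ 2
      = L ^ 2 * (∫ x in (0 : ℝ)..L, f x ^ 2) - 2 * L * I * I + L * I ^ 2 := by
    have e : ∀ x, (L * |f x| - I) ^ 2 = L ^ 2 * f x ^ 2 - 2 * L * I * |f x| + I ^ 2 := fun x => by
      rw [← sq_abs (f x)]
      ring
    simp_rw [e]
    have i1 : IntervalIntegrable (fun x => L ^ 2 * f x ^ 2) volume 0 L :=
      ((hf.pow 2).intervalIntegrable).const_mul _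
    have i2 : IntervalIntegrable (fun x => 2 * L * I * |f x|) volume 0 L :=
      (hf.abs.intervalIntegrable).const_mul _
    rw [intervalIntegral.integral_add (i1.sub i2) (by simp), intervalIntegral.integral_sub i1 i2,
      intervalIntegral.integral_const_mul, intervalIntegral.integral_const_mul,
      intervalIntegral.integral_const, smul_eq_mul, sub_zero]
  rw [h2] at h1
  have h3 : 0 ≤ L * (L * (∫ x in (0 : ℝ)..L, f x ^ 2) - I ^ 2) := by linarith
  have := nonneg_of_mul_nonneg_right h3 hL
  linarith

/-- Uniqueness, by an energy estimate for the difference `d` of the cross-sections: the divergence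
of `(d², v' d²)` is controlled by the energy, and the boundary term at the outlet has a sign. -/
theorem IsFluxSolution.eq_of_eq_data {T L V : ℝ} (hL : 0 < L) {vin vL : ℝ → ℝ}
    {A v W Ax A' v' W' Ax' : ℝ × ℝ → ℝ} {c c' : ℝ → ℝ}
    (h : IsFluxSolution T L vin vL A v W Ax c) (h' : IsFluxSolution T L vin vL A' v' W' Ax' c')
    (hv : ∀ t ∈ Ioo 0 T, 0 ≤ vL t ∧ 0 ≤ vL t - vin t ∧ vL t - vin t ≤ V)
    (h0 : ∀ t ∈ Ioo 0 T, A' (t, 0) = A (t, 0)) (h1 : ∀ x ∈ Ioo 0 L, A' (0, x) = A (0, x))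
    {t : ℝ} (ht : t ∈ Ioo 0 T) {x : ℝ} (hx : x ∈ Icc 0 L) :
    A' (t, x) = A (t, x) ∧ v' (t, x) = v (t, x) := by
  have hLL : L ∈ Icc 0 L := ⟨hL.le, le_rfl⟩
  obtain ⟨α, hα, hAα⟩ := h.lower t ht.2
  obtain ⟨α', hα', hAα'⟩ := h'.lower t ht.2
  obtain ⟨B, -, hB⟩ := h.lip_A.exists_abs_le (isBounded_Qbar T L)
  obtain ⟨B', -, hB'⟩ := h'.lip_A.exists_abs_le (isBounded_Qbar T L)
  obtain ⟨KW, hKW0, hKW⟩ := h'.lip_W.exists_abs_le (isBounded_Qbar T L)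
  obtain ⟨KA, hKA0, hKA⟩ := h.bound
  obtain ⟨K, hK0, hK⟩ := tension_velocity_stability (B := max B B') (V := V) (lt_min hα hα') hL
  set d : ℝ × ℝ → ℝ := fun z => A' z - A z with hd
  have hdl : IsLipOn d (Qbar T L) := h'.lip_A.sub h.lip_A
  have hd2l : IsLipOn (fun z => d z * d z) (Qbar T L) := hdl.mul hdl (isBounded_Qbar T L)
  set E : ℝ → ℝ := fun s => ∫ y in (0 : ℝ)..L, d (s, y) * d (s, y) with hE
  have hEl : IsLipOn E (Icc 0 T) := hd2l.integral_snd.comp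
    (LipschitzWith.prodMk_right L).lipschitzOnWith fun s hs => ⟨hs, hLL⟩
  have hE0 : ∀ s, 0 ≤ E s := fun s =>
    intervalIntegral.integral_nonneg hL.le fun y _ => mul_self_nonneg _
  have hslx : ∀ (F : ℝ × ℝ → ℝ) (s : ℝ), s ∈ Icc 0 T → ContinuousOn F (Qbar T L) →
      ContinuousOn (fun x => F (s, x)) (Icc 0 L) := fun F s hs hF =>
    hF.comp (Continuous.prodMk_right s).continuousOn fun y hy => ⟨hs, hy⟩
  have hstab : ∀ s ∈ Ioc 0 t, |c s - c' s| ≤ K * (∫ y in (0 : ℝ)..L, |d (s, y)|) ∧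
      ∀ y ∈ Icc 0 L, |v (s, y) - v' (s, y)| ≤ K * ∫ y in (0 : ℝ)..L, |d (s, y)| := by
    intro s hs
    have hsT : s ∈ Ioo 0 T := ⟨hs.1, hs.2.trans_lt ht.2⟩
    have hsT' := Ioo_subset_Icc_self hsT
    have hst : s ∈ Icc 0 t := Ioc_subset_Icc_self hs
    have hint : ∀ {A v W Ax : ℝ × ℝ → ℝ} {c : ℝ → ℝ}, IsFluxSolution T L vin vL A v W Ax c →
        (∀ y ∈ Icc 0 L, 0 < A (s, y)) → ∀ y ∈ Icc 0 L,
        v (s, y) = vin s + c s * ∫ u in (0 : ℝ)..y, (A (s, u))⁻¹ := by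
      intro A v W Ax c h hpos y hy
      rw [h.velocity s hsT y hy, ← intervalIntegral.integral_const_mul]
      congr 1
      refine intervalIntegral.integral_congr fun u hu => ?_
      rw [uIcc_of_le hy.1] at hu
      have hu' : u ∈ Icc 0 L := ⟨hu.1, hu.2.trans hy.2⟩
      have h3 := hpos u hu'
      simp only [← h.tension s hsT u hu']
      field_simp
    have hv₁ := hint h fun y hy => hα.trans_le (hAα (s, y) ⟨hst, hy⟩)
    have hv₂ := hint h' fun y hy => hα'.trans_le (hAα' (s, y) ⟨hst, hy⟩)
    have hc₁ := hv₁ L hLL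
    have hc₂ := hv₂ L hLL
    rw [h.velocity_right s hsT] at hc₁
    rw [h'.velocity_right s hsT] at hc₂
    have := hK (fun y => A (s, y)) (fun y => A' (s, y)) (vL s - vin s) (c s) (c' s)
      (hslx A s hsT' h.lip_A.continuousOn) (hslx A' s hsT' h'.lip_A.continuousOn)
      (fun y hy => ⟨(min_le_left _ _).trans (hAα (s, y) ⟨hst, hy⟩),
        (le_abs_self _).trans ((hB (s, y) ⟨hsT', hy⟩).trans (le_max_left _ _))⟩)
      (fun y hy => ⟨(min_le_right _ _).trans (hAα' (s, y) ⟨hst, hy⟩),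
        (le_abs_self _).trans ((hB' (s, y) ⟨hsT', hy⟩).trans (le_max_right _ _))⟩)
      (hv s hsT).2.1 (hv s hsT).2.2 (by linarith) (by linarith)
    refine ⟨this.1, fun y hy => ?_⟩
    rw [hv₁ y hy, hv₂ y hy, add_sub_add_left_eq_sub]
    exact this.2 y hy
  set k : ℝ := K * (KA + 1) with hk
  have hk0 : 0 ≤ k := by positivity
  have hdiv : ∀ᵐ z ∂(volume.restrict (Q t L)), ∃ d₁ d₂,
      HasLineDerivAt ℝ (fun z => d z * d z) d₁ z dt ∧
      HasLineDerivAt ℝ (fun z => v' z * (d z * d z)) d₂ z dx ∧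
      d₁ + d₂ ≤ (k + KW) * (d z * d z) + k * L * E z.1 := by
    have hsub : Q t L ⊆ Q T L := prod_mono (Ioo_subset_Ioo_right ht.2.le) subset_rfl
    filter_upwards [ae_restrict_of_ae_restrict_of_subset hsub h.deriv,
      ae_restrict_of_ae_restrict_of_subset hsub h'.deriv,
      ae_restrict_of_ae_restrict_of_subset hsub hKA, ae_restrict_mem (isOpen_Q t L).measurableSet]
      with z ⟨hx₁, ht₁, _⟩ ⟨hx₂, ht₂, hW₂⟩ hAxz hz
    have hdt := HasLineDerivAt.sub' ht₂ ht₁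
    have hdx := HasLineDerivAt.sub' hx₂ hx₁
    refine ⟨_, _, HasLineDerivAt.mul' hdt hdt,
      HasLineDerivAt.mul' hW₂ (HasLineDerivAt.mul' hdx hdx), ?_⟩
    obtain ⟨s1, s2⟩ := hstab z.1 ⟨hz.1.1, hz.1.2.le⟩
    have s3 := s2 z.2 (Ioo_subset_Icc_self hz.2)
    have hzT : z.1 ∈ Icc 0 T := ⟨hz.1.1.le, hz.1.2.le.trans ht.2.le⟩
    set I := ∫ y in (0 : ℝ)..L, |d (z.1, y)| with hI
    have hI2 : I ^ 2 ≤ L * E z.1 := by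
      have := sq_integral_abs_le hL (hslx d z.1 hzT hdl.continuousOn)
      simpa only [sq (d _)] using this
    have hW : |W' z| ≤ KW := hKW z (Q_subset_Qbar T L (hsub hz))
    have hI0 : 0 ≤ I := intervalIntegral.integral_nonneg hL.le fun y _ => abs_nonneg _
    have s4 : |(v z - v' z) * Ax z + (c z.1 - c' z.1)| ≤ k * I := by
      refine (abs_add_le _ _).trans ?_
      rw [abs_mul]
      calc |v z - v' z| * |Ax z| + |c z.1 - c' z.1| ≤ K * I * KA + K * I := by
            gcongr
        _ = k * I := by rw [hk]; ring
    have s5 : d z * ((v z - v' z) * Ax z + (c z.1 - c' z.1)) ≤ |d z| * (k * I) := by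
      refine (le_abs_self _).trans ?_
      rw [abs_mul]
      gcongr
    have s6 : 2 * (|d z| * (k * I)) ≤ k * (d z * d z) + k * (L * E z.1) := by
      have h6 : 2 * (|d z| * I) ≤ d z * d z + L * E z.1 := by
        have := sq_nonneg (|d z| - I)
        have e := abs_mul_abs_self (d z)
        nlinarith
      have := mul_le_mul_of_nonneg_left h6 hk0
      linarith
    have s7 : W' z * (d z * d z) ≤ KW * (d z * d z) :=
      mul_le_mul_of_nonneg_right ((le_abs_self _).trans hW) (mul_self_nonneg _)
    have e : (-(v' z * Ax' z) - c' z.1 - (-(v z * Ax z) - c z.1)) * (A' z - A z)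
        + (A' z - A z) * (-(v' z * Ax' z) - c' z.1 - (-(v z * Ax z) - c z.1))
        + (W' z * ((A' z - A z) * (A' z - A z)) + v' z * ((Ax' z - Ax z) * (A' z - A z)
          + (A' z - A z) * (Ax' z - Ax z)))
        = 2 * (d z * ((v z - v' z) * Ax z + (c z.1 - c' z.1))) + W' z * (d z * d z) := by
      simp only [hd]
      ring
    rw [e]
    linarith
  have hineq : ∀ s ∈ Icc 0 t, E s ≤ (k + KW + k * L * L) * ∫ r in (0 : ℝ)..s, E r := by
    intro s hs
    have hsT : s ∈ Icc 0 T := ⟨hs.1, hs.2.trans ht.2.le⟩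
    have hsubs : Qbar s L ⊆ Qbar T L := prod_mono (Icc_subset_Icc_right hsT.2) subset_rfl
    have hr1 : IntegrableOn (fun z => d z * d z) (Q s L) :=
      MemLp.integrable le_top ((hd2l.mono ((Q_subset_Qbar s L).trans hsubs)).memL (isBounded_Q s L)
        (isOpen_Q s L).measurableSet)
    have hE1 : IsLipOn (fun z : ℝ × ℝ => E z.1) (Q s L) :=
      isLipOn_fst (hEl.mono (Icc_subset_Icc_right hsT.2)) fun z hz => Ioo_subset_Icc_self hz.1
    have hr2 : IntegrableOn (fun z : ℝ × ℝ => E z.1) (Q s L) :=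
      MemLp.integrable le_top (hE1.memL (isBounded_Q s L) (isOpen_Q s L).measurableSet)
    have hb := integral_boundary_le hs.1 hL.le (hd2l.mono hsubs)
      ((h'.lip_v.mul hd2l (isBounded_Qbar T L)).mono hsubs)
      ((hr1.const_mul (k + KW)).add (hr2.const_mul (k * L)))
      (ae_restrict_of_ae_restrict_of_subset
        (prod_mono (Ioo_subset_Ioo_right hs.2) subset_rfl) hdiv)
    have e1 : ∫ y in (0 : ℝ)..L, (d (s, y) * d (s, y) - d (0, y) * d (0, y)) = E s := by
      rw [← integral_Ioo_eq hL.le, hE]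
      simp only
      rw [← integral_Ioo_eq hL.le]
      refine setIntegral_congr_fun measurableSet_Ioo fun y hy => ?_
      simp [hd, h1 y hy]
    have e2 : 0 ≤ ∫ r in (0 : ℝ)..s, (v' (r, L) * (d (r, L) * d (r, L))
        - v' (r, 0) * (d (r, 0) * d (r, 0))) := by
      rw [← integral_Ioo_eq hs.1]
      refine setIntegral_nonneg measurableSet_Ioo fun r hr => ?_
      have hrT : r ∈ Ioo 0 T := ⟨hr.1, hr.2.trans_le hsT.2⟩
      have : d (r, 0) = 0 := by simp [hd, h0 r hrT]
      rw [this, mul_zero, mul_zero, sub_zero, h'.velocity_right r hrT]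
      exact mul_nonneg (hv r hrT).1 (mul_self_nonneg _)
    have e3 : ∫ z in Q s L, d z * d z = ∫ r in (0 : ℝ)..s, E r := by
      rw [IntegrableOn, volume_restrict_Q] at hr1
      rw [volume_restrict_Q, integral_prod _ hr1, integral_Ioo_eq hs.1]
      simp only [integral_Ioo_eq hL.le]
      rfl
    have e4 : ∫ z in Q s L, E z.1 = L * ∫ r in (0 : ℝ)..s, E r := by
      rw [IntegrableOn, volume_restrict_Q] at hr2
      rw [volume_restrict_Q, integral_prod _ hr2, integral_Ioo_eq hs.1]
      simp [hL.le]
    have e5 : ∫ z in Q s L, ((k + KW) * (d z * d z) + k * L * E z.1)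
        = (k + KW + k * L * L) * ∫ r in (0 : ℝ)..s, E r := by
      rw [integral_add (hr1.const_mul _) (hr2.const_mul _), integral_const_mul, integral_const_mul,
        e3, e4]
      ring
    rw [e1] at hb
    have hb' := hb.trans e5.le
    linarith
  have htt : t ∈ Icc 0 t := ⟨ht.1.le, le_rfl⟩
  have hEt := eq_zero_of_le_integral ht.1.le
    (hEl.continuousOn.mono (Icc_subset_Icc_right ht.2.le)) (fun s _ => hE0 s) hineq t htt
  have hdt0 : ∀ y ∈ Icc 0 L, d (t, y) = 0 := by
    intro y hy
    by_contra hne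
    have hpos : 0 < E t := intervalIntegral.integral_pos hL
      (hslx (fun z => d z * d z) t (Ioo_subset_Icc_self ht) hd2l.continuousOn)
      (fun y _ => mul_self_nonneg _) ⟨y, hy, mul_self_pos.2 hne⟩
    linarith
  refine ⟨sub_eq_zero.1 (hdt0 x hx), ?_⟩
  have hI : ∫ y in (0 : ℝ)..L, |d (t, y)| = 0 := by
    rw [intervalIntegral.integral_congr (g := fun _ => 0) fun y hy => ?_,
      intervalIntegral.integral_zero]
    rw [uIcc_of_le hL.le] at hy
    simp [hdt0 y hy]
  have hvv := (hstab t ⟨ht.1, le_rfl⟩).2 x hx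
  rw [hI, mul_zero, abs_nonpos_iff, sub_eq_zero] at hvv
  exact hvv.symm

theorem le_on_Icc_of_le_on_Ioo {a b : ℝ} (hab : a < b) {f g : ℝ → ℝ} (hf : ContinuousOn f (Icc a b))
    (hg : ContinuousOn g (Icc a b)) (h : ∀ t ∈ Ioo a b, f t ≤ g t) : ∀ t ∈ Icc a b, f t ≤ g t := by
  rw [← closure_Ioo hab.ne] at hf hg ⊢
  exact fun t ht => le_on_closure h hf hg ht

end MatovichPearson

theorem theorem3 (μ T L : ℝ) (hμ : 0 < μ) (hT : 0 < T) (hL : 0 < L)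
    (S₀ S₁ vin vL : ℝ → ℝ) (v_m V_M S_m S_M : ℝ)
    -- the data are the representatives that are continuous up to the end points
    (hS₀c : ContinuousOn S₀ (Icc 0 T)) (hS₁c : ContinuousOn S₁ (Icc 0 L))
    (hvinc : ContinuousOn vin (Icc 0 T)) (hvLc : ContinuousOn vL (Icc 0 T))
    -- bounds on the data
    (hvm : 0 < v_m)
    (hv : ∀ t ∈ Ioo 0 T, v_m ≤ vin t ∧ vin t < vL t ∧ vL t ≤ V_M)
    (hSm : 0 < S_m)
    (hS₀ : ∀ t ∈ Ioo 0 T, S_m ≤ S₀ t ∧ S₀ t ≤ S_M)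
    (hS₁ : ∀ x ∈ Ioo 0 L, S_m ≤ S₁ x ∧ S₁ x ≤ S_M)
    (hcorner : S₀ 0 = S₁ 0)
    -- regularity of the data
    (hS₀r : MatovichPearson.MemSobolev (Ioo 0 T) ⊤ 2 S₀)
    (hS₁r : MatovichPearson.MemSobolev (Ioo 0 L) 2 2 S₁)
    (hvinr : MatovichPearson.MemSobolev (Ioo 0 T) ⊤ 1 vin)
    (hvLr : MatovichPearson.MemSobolev (Ioo 0 T) ⊤ 1 vL) :
    ∃ A v : ℝ × ℝ → ℝ,
      MatovichPearson.IsStrongSolution μ T L S₀ S₁ vin vL A v ∧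
      (∃ A_m : ℝ, 0 < A_m ∧ ∀ z ∈ MatovichPearson.Qbar T L, A_m ≤ A z) ∧
      ∀ A' v' : ℝ × ℝ → ℝ,
        MatovichPearson.IsStrongSolution μ T L S₀ S₁ vin vL A' v' →
        EqOn A' A (MatovichPearson.Qbar T L) ∧ EqOn v' v (MatovichPearson.Qbar T L) := by
  have hv1 := MatovichPearson.le_on_Icc_of_le_on_Ioo hT continuousOn_const hvinc
    fun t ht => (hv t ht).1
  have hv2 := MatovichPearson.le_on_Icc_of_le_on_Ioo hT hvinc hvLc fun t ht => (hv t ht).2.1.le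
  have hv3 := MatovichPearson.le_on_Icc_of_le_on_Ioo hT hvLc continuousOn_const
    fun t ht => (hv t ht).2.2
  have hS01 := MatovichPearson.le_on_Icc_of_le_on_Ioo hT continuousOn_const hS₀c
    fun t ht => (hS₀ t ht).1
  have hS02 := MatovichPearson.le_on_Icc_of_le_on_Ioo hT hS₀c continuousOn_const
    fun t ht => (hS₀ t ht).2
  have hS11 := MatovichPearson.le_on_Icc_of_le_on_Ioo hL continuousOn_const hS₁c
    fun x hx => (hS₁ x hx).1
  have hS12 := MatovichPearson.le_on_Icc_of_le_on_Ioo hL hS₁c continuousOn_const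
    fun x hx => (hS₁ x hx).2
  obtain ⟨A, v, hAv, hAm⟩ := MatovichPearson.exists_strongSolution (μ := μ) hT hL hvm
    (fun t ht => ⟨hv1 t ht, hv2 t ht, hv3 t ht⟩) hSm (fun t ht => ⟨hS01 t ht, hS02 t ht⟩)
    (fun x hx => ⟨hS11 x hx, hS12 x hx⟩) hcorner
    (hS₀r.one_of_two.isLipOn hT hS₀c) (hS₁r.isLipOn_of_two hL hS₁c)
    (hvinr.isLipOn hT hvinc) (hvLr.isLipOn hT hvLc)
  refine ⟨A, v, hAv, hAm, fun A' v' hAv' => ?_⟩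
  obtain ⟨W, Ax, c, h⟩ := hAv.exists_isFluxSolution hμ hT hL hSm hS₀c hS₁c hS01 hS11
    fun t ht => (hv t ht).2.1
  obtain ⟨W', Ax', c', h'⟩ := hAv'.exists_isFluxSolution hμ hT hL hSm hS₀c hS₁c hS01 hS11
    fun t ht => (hv t ht).2.1
  have heq : ∀ z ∈ MatovichPearson.Q T L, A' z = A z ∧ v' z = v z := fun z hz =>
    h.eq_of_eq_data (V := V_M) hL h'
      (fun t ht => by
        obtain ⟨h1, h2, h3⟩ := hv t ht
        refine ⟨?_, ?_, ?_⟩ <;> linarith)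
      (fun t ht => (hAv'.inflow t ht).trans (hAv.inflow t ht).symm)
      (fun x hx => (hAv'.initial x hx).trans (hAv.initial x hx).symm)
      hz.1 (Ioo_subset_Icc_self hz.2)
  exact ⟨MatovichPearson.eqOn_Qbar_of_eqOn_Q hT hL hAv'.continuousOn_A hAv.continuousOn_A
      fun z hz => (heq z hz).1,
    MatovichPearson.eqOn_Qbar_of_eqOn_Q hT hL hAv'.continuousOn_v hAv.continuousOn_v
      fun z hz => (heq z hz).2⟩
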